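/- **Conventions.** Let $G\subset GL(m,\mathbb C)$ be a compact matrix Lie group with Lie algebra $\mathfrak g$, equipped with an $\operatorname{Ad}$-invariant inner product with norm $|\cdot|$. Let $\Omega\subset\mathbb R^n$ be open. For $A=\sum_i A_i\,dx^i\in (W^{1,2}\cap L^4)(\Omega,T^*\Omega\otimes\mathfrak g)$ let $F_A=dA+A\wedge A\in L^2$ be the curvature, with components $F_{ij}=\partial_iA_j-\partial_jA_i+A_iA_j-A_jA_i$, and put $$|F_A|^2=\sum_{i<j}|F_{ij}|^2,\qquad |F_A\llcorner\nu_y|^2=\sum_j\Big|\sum_i(\nu_y)_iF_{ij}\Big|^2,\qquad \nu_y(x)=\frac{x-y}{|x-y|}.$$ $A$ is an *almost $\operatorname{YM}$-energy minimizer* on $\Omega$ if there are $C_0,\alpha_0,\rho_0>0$ such that for every ball $B=B_r(y)$ with $0<r<\rho_0$ and $\overline B\subset\Omega$, $$\int_B|F_A|^2\,d\mathcal L^n\le\int_B|F_{\tilde A}|^2\,d\mathcal L^n+C_0\,r^{n-4+\alpha_0}$$ for every $\tilde A\in (W^{1,2}\cap L^4)(B,T^*B\otimes\mathfrak g)$ with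 $\iota_{\partial B}^*\tilde A=\iota_{\partial B}^*A$ (equality of the tangential parts of the boundary traces). **Proposition (almost monotonicity formula).** Let $n\ge5$ and let $A\in (W^{1,2}\cap L^4)(\Omega,T^*\Omega\otimes\mathfrak g)$ be an almost $\operatorname{YM}$-energy minimizer on $\Omega$. Put $\Theta(\rho,y)=\rho^{4-n}\int_{B_\rho(y)}|F_A|^2\,d\mathcal L^n$. 1. There exist $C,\alpha>0$ such that for every $y\in\Omega$ and all $0<\sigma<\rho<\operatorname{dist}(y,\partial\Omega)$ $$\int_{B_\rho(y)\smallsetminus B_\sigma(y)}\frac{|F_A\llcorner\nu_y|^2}{|x-y|^{n-4}}\,d\mathcal L^n(x)\le\big(\Theta(\rho,y)+C\rho^{\alpha}\big)-\big(\Theta(\sigma,y)+C\sigma^{\alpha}\big).$$ 2. There exist $C,\alpha,\rho_1>0$ such that for every $y\in\Omega$ and all $0<\sigma<\rho<\min\{\rho_1,\operatorname{dist}(y,\partial\Omega)\}$ $$C\int_{B_\rho(y)\smallsetminus B_\sigma(y)}\frac{|F_A\llcorner\nu_y|^2}{|x-y|^{n-4}}\,d\mathcal L^n(x)\le\big(\Theta(\rho,y)+\rho^{\alpha}\big)-\big(\Theta(\sigma,y)+\sigma^{\alpha}\big).$$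 (If $\partial\Omega=\emptyset$, then $\operatorname{dist}(y,\partial\Omega)=+\infty$.) In particular $\rho\mapsto\Theta(\rho,y)+C\rho^\alpha$ is non-decreasing on $(0,\operatorname{dist}(y,\partial\Omega))$, with $C,\alpha$ as in 1, and $\rho\mapsto\Theta(\rho,y)+\rho^\alpha$ is non-decreasing for $\rho<\min\{\rho_1,\operatorname{dist}(y,\partial\Omega)\}$, with $\alpha,\rho_1$ as in 2. -/

import Mathlib

open MeasureTheory Metric
open scoped ContDiff

noncomputable section

/-- Euclidean space `ℝⁿ`. -/
abbrev Euc (n : ℕ) : Type := EuclideanSpace ℝ (Fin n)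

/-- Complex `m × m` matrices; real matrix groups embed in the complex ones. -/
abbrev CMat (m : ℕ) : Type := Matrix (Fin m) (Fin m) ℂ

/-- The Lie algebra of a matrix group `G`: its tangent space at the identity, i.e. the velocities
`γ'(0)` of the curves `γ` in `G` with `γ(0) = 1` (the derivative is taken entry by entry). -/
def lieAlg {m : ℕ} (G : Subgroup (GL (Fin m) ℂ)) : Submodule ℝ (CMat m) where
  carrier := {X | ∃ γ : ℝ → GL (Fin m) ℂ, (∀ t, γ t ∈ G) ∧ γ 0 = 1 ∧
    ∀ a b, HasDerivAt (fun t => (γ t : CMat m) a b) (X a b) 0}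
  zero_mem' := ⟨fun _ => 1, fun _ => G.one_mem, rfl, fun a b => by
    simpa using hasDerivAt_const (0 : ℝ) (((1 : GL (Fin m) ℂ) : CMat m) a b)⟩
  add_mem' := by
    rintro X Y ⟨γ, hγ, hγ0, hX⟩ ⟨η, hη, hη0, hY⟩
    refine ⟨fun t => γ t * η t, fun t => G.mul_mem (hγ t) (hη t), by simp [hγ0, hη0], ?_⟩
    intro a b
    have h : HasDerivAt (fun t => ∑ c, (γ t : CMat m) a c * (η t : CMat m) c b)
        (∑ c, (X a c * (η 0 : CMat m) c b + (γ 0 : CMat m) a c * Y c b)) 0 :=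
      HasDerivAt.fun_sum fun c _ => (hX a c).mul (hY c b)
    have e : (∑ c, (X a c * (η 0 : CMat m) c b + (γ 0 : CMat m) a c * Y c b)) = (X + Y) a b := by
      simp [hγ0, hη0, Finset.sum_add_distrib, Matrix.one_apply]
    rw [e] at h
    simpa [Matrix.mul_apply] using h
  smul_mem' := by
    rintro c X ⟨γ, hγ, hγ0, hX⟩
    refine ⟨fun t => γ (c * t), fun t => hγ _, by simp [hγ0], fun a b => ?_⟩
    have h1 : HasDerivAt (fun t : ℝ => c * t) c 0 := by
      simpa using (hasDerivAt_id (0 : ℝ)).const_mul c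
    have h2 : HasDerivAt (fun t => (γ t : CMat m) a b) (X a b) (c * 0) := by
      simpa using hX a b
    exact h2.scomp (0 : ℝ) h1

/-- `κ` restricts to an inner product on the Lie algebra of `G` that is invariant under the adjoint
action of `G`.  Only the values of `κ` on the Lie algebra matter; every bilinear form on the Lie
algebra is the restriction of one on the space of matrices. -/
structure IsAdInvariantInner {m : ℕ} (G : Subgroup (GL (Fin m) ℂ))
    (κ : LinearMap.BilinForm ℝ (CMat m)) : Prop where
  symm : ∀ X ∈ lieAlg G, ∀ Y ∈ lieAlg G, κ X Y = κ Y X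
  pos : ∀ X ∈ lieAlg G, X ≠ 0 → 0 < κ X X
  ad_invariant : ∀ g ∈ G, ∀ X ∈ lieAlg G, ∀ Y ∈ lieAlg G,
    κ ((g : CMat m) * X * ((g⁻¹ : GL (Fin m) ℂ) : CMat m))
      ((g : CMat m) * Y * ((g⁻¹ : GL (Fin m) ℂ) : CMat m)) = κ X Y

/-- The classical partial derivative `∂ᵢφ(x)` of a function on `ℝⁿ`. -/
def partialD {n : ℕ} (i : Fin n) (φ : Euc n → ℝ) (x : Euc n) : ℝ :=
  fderiv ℝ φ x (EuclideanSpace.single i 1)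

/-- `v` is the weak `i`-th partial derivative of `u` on the open set `Ω`. -/
def IsWeakPartial {n : ℕ} (Ω : Set (Euc n)) (i : Fin n) (u v : Euc n → ℂ) : Prop :=
  ∀ φ : Euc n → ℝ, ContDiff ℝ ∞ φ → HasCompactSupport φ → tsupport φ ⊆ Ω →
    ∫ x in Ω, partialD i φ x • u x = -∫ x in Ω, φ x • v x

/-- An element `A = ∑ᵢ Aᵢ dxⁱ` of `(W^{1,2} ∩ L⁴)(Ω, T*Ω ⊗ 𝔤)`, where `𝔤` is the Lie algebra of `G`,
together with its weak derivatives. -/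
structure SobolevForm {m : ℕ} (G : Subgroup (GL (Fin m) ℂ)) {n : ℕ} (Ω : Set (Euc n)) where
  /-- `coeff x i` is `Aᵢ(x)`. -/
  coeff : Euc n → Fin n → CMat m
  /-- `grad x i j` is the weak derivative `∂ᵢAⱼ(x)`. -/
  grad : Euc n → Fin n → Fin n → CMat m
  coeff_mem : ∀ᵐ x ∂(volume.restrict Ω), ∀ i, coeff x i ∈ lieAlg G
  grad_mem : ∀ᵐ x ∂(volume.restrict Ω), ∀ i j, grad x i j ∈ lieAlg G
  memLp_two : ∀ i a b, MemLp (fun x => coeff x i a b) 2 (volume.restrict Ω)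
  memLp_four : ∀ i a b, MemLp (fun x => coeff x i a b) 4 (volume.restrict Ω)
  grad_memLp : ∀ i j a b, MemLp (fun x => grad x i j a b) 2 (volume.restrict Ω)
  weak : ∀ i j a b, IsWeakPartial Ω i (fun x => coeff x j a b) (fun x => grad x i j a b)

namespace SobolevForm

variable {m : ℕ} {G : Subgroup (GL (Fin m) ℂ)} {n : ℕ} {Ω : Set (Euc n)}

/-- The components `F_{ij} = ∂ᵢAⱼ - ∂ⱼAᵢ + AᵢAⱼ - AⱼAᵢ` of the curvature `F_A = dA + A ∧ A`. -/
def curv (A : SobolevForm G Ω) (x : Euc n) (i j : Fin n) : CMat m :=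
  A.grad x i j - A.grad x j i + (A.coeff x i * A.coeff x j - A.coeff x j * A.coeff x i)

/-- `|F_A|² = ∑_{i<j} |F_{ij}|²`, with the norm of the inner product `κ`. -/
def curvSq (κ : LinearMap.BilinForm ℝ (CMat m)) (A : SobolevForm G Ω) (x : Euc n) : ℝ :=
  ∑ i, ∑ j ∈ Finset.Ioi i, κ (A.curv x i j) (A.curv x i j)

/-- The components of the `𝔤`-valued 1-form `F_A ⌟ ν_y` at `x`, where
`ν_y(x) = (x - y) / |x - y|`. -/
def radialCurv (A : SobolevForm G Ω) (y x : Euc n) (j : Fin n) : CMat m :=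
  ∑ i, ((x i - y i) / ‖x - y‖) • A.curv x i j

/-- `|F_A ⌟ ν_y|²` at `x`. -/
def radialCurvSq (κ : LinearMap.BilinForm ℝ (CMat m)) (A : SobolevForm G Ω) (y x : Euc n) : ℝ :=
  ∑ j, κ (A.radialCurv y x j) (A.radialCurv y x j)

/-- The Yang--Mills energy `YM(A; U)` of `A` localized in `U ⊆ Ω`; the integrand is in `L¹(Ω)` since
`F_A ∈ L²(Ω)`. -/
def energy (κ : LinearMap.BilinForm ℝ (CMat m)) (A : SobolevForm G Ω) (U : Set (Euc n)) : ℝ :=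
  ∫ x in U, A.curvSq κ x

/-- `τ` is the boundary trace on `∂B_r(y)` of the coefficients of `A`, for a ball `B_r(y) ⊆ Ω`: it is
square integrable for the surface measure, and the Gauss--Green formula
`∫_B (φ ∂ᵢu + u ∂ᵢφ) = ∫_{∂B} φ u νᵢ` holds for every coefficient `u` and all `φ ∈ C_c^∞(ℝⁿ)`.  The
sphere is parametrized by `θ ↦ y + rθ` with `θ` in the unit sphere. -/
def IsTrace (A : SobolevForm G Ω) (y : Euc n) (r : ℝ)
    (τ : sphere (0 : Euc n) 1 → Fin n → CMat m) : Prop :=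
  (∀ j a b, MemLp (fun θ => τ θ j a b) 2 (volume : Measure (Euc n)).toSphere) ∧
  ∀ φ : Euc n → ℝ, ContDiff ℝ ∞ φ → HasCompactSupport φ → ∀ i j a b,
    ∫ x in ball y r, (φ x • A.grad x i j a b + partialD i φ x • A.coeff x j a b) =
      r ^ (n - 1) • ∫ θ : sphere (0 : Euc n) 1, (φ (y + r • (θ : Euc n)) * (θ : Euc n) i) • τ θ j a b
        ∂(volume : Measure (Euc n)).toSphere

end SobolevForm

/-- `ι*Ã = ι*A` for the inclusion `ι` of `∂B_r(y)`: the traces of `A` and `Ã` agree on the vectors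
tangent to the sphere, almost everywhere. -/
def SameTangentialTrace {m : ℕ} {G : Subgroup (GL (Fin m) ℂ)} {n : ℕ} {Ω Ω' : Set (Euc n)}
    (A : SobolevForm G Ω) (A' : SobolevForm G Ω') (y : Euc n) (r : ℝ) : Prop :=
  ∃ τ τ' : sphere (0 : Euc n) 1 → Fin n → CMat m, A.IsTrace y r τ ∧ A'.IsTrace y r τ' ∧
    ∀ᵐ θ : sphere (0 : Euc n) 1 ∂(volume : Measure (Euc n)).toSphere,
      ∀ v : Euc n, inner ℝ v (θ : Euc n) = 0 →
        ∑ i, v i • τ θ i = ∑ i, v i • τ' θ i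

/-- `A` is an almost `YM`-energy minimizer on `Ω`. -/
def IsAlmostMinimizer {m : ℕ} {G : Subgroup (GL (Fin m) ℂ)} (κ : LinearMap.BilinForm ℝ (CMat m))
    {n : ℕ} {Ω : Set (Euc n)} (A : SobolevForm G Ω) : Prop :=
  ∃ C > (0 : ℝ), ∃ α > (0 : ℝ), ∃ ρ₀ > (0 : ℝ), ∀ (y : Euc n) (r : ℝ), 0 < r → r < ρ₀ → closedBall y r ⊆ Ω →
    ∀ A' : SobolevForm G (ball y r), SameTangentialTrace A A' y r →
      A.energy κ (ball y r) ≤ A'.energy κ (ball y r) + C * r ^ ((n : ℝ) - 4 + α)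

/-- The normalized energy `ρ^{4-n} ∫_{B_ρ(y)} |F_A|²` (for `n ≥ 4`). -/
def normalizedEnergy {m : ℕ} {G : Subgroup (GL (Fin m) ℂ)} (κ : LinearMap.BilinForm ℝ (CMat m))
    {n : ℕ} {Ω : Set (Euc n)} (A : SobolevForm G Ω) (y : Euc n) (ρ : ℝ) : ℝ :=
  1 / ρ ^ (n - 4) * A.energy κ (ball y ρ)

/-- `∫_{B_ρ(y) \ B_σ(y)} |x - y|^{4-n} |F_A ⌟ ν_y|² dx` (for `n ≥ 4`). -/
def radialEnergy {m : ℕ} {G : Subgroup (GL (Fin m) ℂ)} (κ : LinearMap.BilinForm ℝ (CMat m))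
    {n : ℕ} {Ω : Set (Euc n)} (A : SobolevForm G Ω) (y : Euc n) (σ ρ : ℝ) : ℝ :=
  ∫ x in ball y ρ \ ball y σ, 1 / ‖x - y‖ ^ (n - 4) * A.radialCurvSq κ y x

end

/-! On `B_r(y)` the form `A` is compared with its pull-back by a radial map that squeezes the
punctured ball onto the thin annulus `(1-ε)r < |x-y| < r` and is the identity near the sphere. As `ε
→ 0` this approaches the pull-back of `A` by the retraction onto `∂B_r(y)`, whose curvature has no
radial part; the gap between the two energies is what pays for `|F_A ⌟ ν|²`. Let `h` be the inverse
profile and `t = |z-y|`. A radial map scales tangential and mixed curvature components separately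
(`radial_conj_sq`), so after a change of variables the competitor has energy `∫ (h/t)^(n-5) h' (|F|²
- |F⌟ν|²) + (h/t)^(n-3)/h' |F⌟ν|²` over the annulus (`energy_pullback`).

The classical argument lets `ε → 0` at a fixed radius and integrates a differential inequality for
`Θ`. Here the comparison is multiplied by `(n-4) r^(3-n)` and integrated over `σ < r < ρ` before the
limit, so that no Lebesgue points of the energy are needed. By Fubini each point enters through a
one-dimensional integral in `r`. The tangential kernel is the `r`-derivative of `-(h(t/r)/t)^(n-4)`,
so its integral is at most `t^(4-n)` for every profile (`integral_tangential_kernel_le`). The radial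
kernel lives on an interval of length `O(εt)` and contributes `O(ε)` (`integral_radial_kernel_le`).
The left side equals `∫ t^(4-n)|F|² + Θ(σ) - Θ(ρ)` (`integral_integral_ballKernel`), and the
minimality error integrates to a multiple of `ρ^α - σ^α`. In the limit the integrals of
`t^(4-n)|F|²` cancel and the formula remains (`radialEnergy_le_of_le`).

Two facts make the competitor admissible. Its first and second derivatives blow up like `1/|x-y|`
and `1/|x-y|²`, but the Jacobian of the inverse map compensates when `n ≥ 5`, and a point is
removable for the weak equations (`pullback`, `IsWeakPartial.of_punctured`). For almost every `r`
the restriction of `A` to the sphere is its trace, and changing the form away from the sphere does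
not affect it (`ae_isTrace`, `IsTrace.of_eq_near_boundary`).

Beyond the scale `ρ₀` of minimality, finiteness of the total energy gives the same inequality with
another constant. The second statement follows by halving `α` and restricting to small radii. -/

noncomputable section

/-! ### Algebra of the curvature under radial linear maps -/

section Algebra

variable {m n : ℕ} {κ : LinearMap.BilinForm ℝ (CMat m)} {L : Submodule ℝ (CMat m)}
  {F : Fin n → Fin n → CMat m} {ν : Fin n → ℝ}

theorem two_mul_sum_Ioi_of_symm {n : ℕ} (q : Fin n → Fin n → ℝ) (hs : ∀ i j, q i j = q j i)
    (h0 : ∀ i, q i i = 0) : 2 * ∑ i, ∑ j ∈ Finset.Ioi i, q i j = ∑ i, ∑ j, q i j := by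
  have key : ∀ i, ∑ j, q i j = ∑ j ∈ Finset.Ioi i, q i j + ∑ j ∈ Finset.Iio i, q i j := by
    intro i
    have hu : (Finset.univ : Finset (Fin n)) =
        insert i (Finset.Ioi i ∪ Finset.Iio i) := by
      ext j; rcases lt_trichotomy i j with h | h | h <;> simp [h]
    have hd : Disjoint (Finset.Ioi i) (Finset.Iio i) := by
      rw [Finset.disjoint_left]; intro j hj hj'
      simp at hj hj'; exact absurd hj (not_lt.2 hj'.le)
    rw [hu, Finset.sum_insert (by simp), h0, zero_add, Finset.sum_union hd]
  have swap : ∑ i, ∑ j ∈ Finset.Iio i, q i j = ∑ i, ∑ j ∈ Finset.Ioi i, q i j := by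
    rw [Finset.sum_comm' (t' := Finset.univ) (s' := fun j => Finset.Ioi j) (by simp)]
    exact Finset.sum_congr rfl fun i _ => Finset.sum_congr rfl fun j _ => hs _ _
  simp_rw [key, Finset.sum_add_distrib, swap]
  ring

theorem sum_smul_sum_smul_eq_zero_of_antisymm (hF : ∀ i j, F j i = -F i j) :
    ∑ j, ν j • ∑ i, ν i • F i j = 0 := by
  have h : ∑ j, ν j • ∑ i, ν i • F i j = -∑ j, ν j • ∑ i, ν i • F i j := by
    conv_rhs => simp only [Finset.smul_sum]
    rw [Finset.sum_comm, ← Finset.sum_neg_distrib]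
    refine Finset.sum_congr rfl fun j _ => ?_
    rw [Finset.smul_sum, ← Finset.sum_neg_distrib]
    refine Finset.sum_congr rfl fun i _ => ?_
    rw [hF i j, smul_neg, smul_neg, smul_comm, neg_neg]
  have h2 : (2 : ℝ) • ∑ j, ν j • ∑ i, ν i • F i j = 0 := by
    rw [two_smul]; nth_rewrite 1 [h]; simp
  simpa using h2

/-- Conjugation of an antisymmetric form by `a I + c ν νᵀ`. -/
theorem radial_conj_eq (hF : ∀ i j, F j i = -F i j) (a c : ℝ) (i j : Fin n) :
    ∑ k, ∑ l, (((if i = l then a else 0) + c * (ν i * ν l)) *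
      ((if j = k then a else 0) + c * (ν j * ν k))) • F l k =
      (a ^ 2) • F i j + (a * c) • (ν i • ∑ l, ν l • F l j - ν j • ∑ l, ν l • F l i) := by
  have h0 := sum_smul_sum_smul_eq_zero_of_antisymm (ν := ν) hF
  have e1 : ∀ k, ∑ l, (((if i = l then a else 0) + c * (ν i * ν l)) *
      ((if j = k then a else 0) + c * (ν j * ν k))) • F l k =
      ((if j = k then a else 0) + c * (ν j * ν k)) •
        (a • F i k + (c * ν i) • ∑ l, ν l • F l k) := by
    intro k
    generalize ((if j = k then a else 0) + c * (ν j * ν k)) = p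
    rw [smul_add, Finset.smul_sum, Finset.smul_sum]
    simp only [add_mul, add_smul, Finset.sum_add_distrib, ite_mul, zero_mul, ite_smul, zero_smul,
      Finset.sum_ite_eq, Finset.mem_univ, if_true, smul_smul]
    congr 1
    · congr 1; ring
    · refine Finset.sum_congr rfl fun l _ => ?_
      congr 1; ring
  simp_rw [e1, add_smul, Finset.sum_add_distrib, ite_smul, zero_smul]
  simp only [Finset.sum_ite_eq, Finset.mem_univ, if_true]
  -- The part quadratic in `c` contains `∑ ν_k ν_l F_{lk}`, which vanishes by antisymmetry.
  have e2 : ∑ k, (c * (ν j * ν k)) • (a • F i k + (c * ν i) • ∑ l, ν l • F l k) =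
      -((a * c) • ν j • ∑ l, ν l • F l i) := by
    have : ∀ k, (c * (ν j * ν k)) • (a • F i k + (c * ν i) • ∑ l, ν l • F l k) =
        -((a * c * ν j) • ν k • F k i) + (c * ν j * c * ν i) • ν k • ∑ l, ν l • F l k := by
      intro k
      rw [hF k i, smul_add]
      simp only [smul_neg, smul_smul]
      congr 1
      · congr 1; ring_nf
      · congr 1; ring
    simp_rw [this, Finset.sum_add_distrib, ← Finset.smul_sum, h0, Finset.sum_neg_distrib]
    rw [smul_zero, add_zero, ← Finset.smul_sum, smul_smul]
  rw [e2]
  simp only [smul_add, smul_sub, smul_smul]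
  rw [sub_eq_add_neg, ← add_assoc]
  congr 2
  · congr 1; ring
  · congr 1; ring

/-- The matrix `a I + c ν νᵀ` has eigenvalue `a + c` on `ν` and `a` on its orthogonal complement.
Hence tangential components of `F` scale by `a²` and those containing `ν` once by `a(a + c)`; the
latter carry the norm of `F ⌟ ν`, the former the rest of `|F|²`. -/
theorem radial_conj_sq (hκ : ∀ X ∈ L, ∀ Y ∈ L, κ X Y = κ Y X) (hF : ∀ i j, F j i = -F i j)
    (hFL : ∀ i j, F i j ∈ L) (hν : ∑ i, ν i ^ 2 = 1) (a c : ℝ) {F' : Fin n → Fin n → CMat m}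
    (hF' : ∀ i j, F' i j = ∑ k, ∑ l, (((if i = l then a else 0) + c * (ν i * ν l)) *
      ((if j = k then a else 0) + c * (ν j * ν k))) • F l k) :
    ∑ i, ∑ j ∈ Finset.Ioi i, κ (F' i j) (F' i j) =
      a ^ 4 * (∑ i, ∑ j ∈ Finset.Ioi i, κ (F i j) (F i j) -
        ∑ j, κ (∑ i, ν i • F i j) (∑ i, ν i • F i j)) +
      a ^ 2 * (a + c) ^ 2 * ∑ j, κ (∑ i, ν i • F i j) (∑ i, ν i • F i j) := by
  have h0 := sum_smul_sum_smul_eq_zero_of_antisymm (ν := ν) hF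
  set R : Fin n → CMat m := fun j => ∑ i, ν i • F i j with hR
  have hRL : ∀ j, R j ∈ L := fun j => L.sum_mem fun i _ => L.smul_mem _ (hFL i j)
  have hF2 : ∀ i j, F' i j = (a ^ 2) • F i j + (a * c) • (ν i • R j - ν j • R i) :=
    fun i j => (hF' i j).trans (radial_conj_eq hF a c i j)
  have anti' : ∀ i j, F' j i = -F' i j := by
    intro i j; rw [hF2, hF2, hF i j]; module
  have diag : ∀ (H : Fin n → Fin n → CMat m), (∀ i j, H j i = -H i j) → ∀ i, κ (H i i) (H i i) = 0 := by
    intro H hH i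
    have : (2 : ℝ) • H i i = 0 := by rw [two_smul]; nth_rewrite 1 [hH i i]; simp
    have : H i i = 0 := by simpa using this
    simp [this]
  have t1 := two_mul_sum_Ioi_of_symm (fun i j => κ (F i j) (F i j))
    (fun i j => by simp [hF i j]) (diag F hF)
  have t2 := two_mul_sum_Ioi_of_symm (fun i j => κ (F' i j) (F' i j))
    (fun i j => by simp [anti' i j]) (diag F' anti')
  have c1 : ∑ i, ∑ j, ν i * κ (F i j) (R j) = ∑ j, κ (R j) (R j) := by
    rw [Finset.sum_comm]
    refine Finset.sum_congr rfl fun j _ => ?_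
    have : κ (R j) (R j) = κ (∑ i, ν i • F i j) (R j) := rfl
    rw [this]
    simp [LinearMap.sum_apply]
  have c2 : ∑ i, ∑ j, ν j * κ (F i j) (R i) = -∑ j, κ (R j) (R j) := by
    rw [← c1, Finset.sum_comm, ← Finset.sum_neg_distrib]
    refine Finset.sum_congr rfl fun j _ => ?_
    rw [← Finset.sum_neg_distrib]
    refine Finset.sum_congr rfl fun i _ => ?_
    rw [hF j i]; simp
  have c3 : ∑ i, ∑ j, ν i ^ 2 * κ (R j) (R j) = ∑ j, κ (R j) (R j) := by
    simp_rw [← Finset.mul_sum, ← Finset.sum_mul, hν, one_mul]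
  have c4 : ∑ i, ∑ j, ν j ^ 2 * κ (R i) (R i) = ∑ j, κ (R j) (R j) := by
    simp_rw [← Finset.sum_mul, hν, one_mul]
  have c5 : ∑ i, ∑ j, ν i * ν j * κ (R i) (R j) = 0 := by
    have : ∀ i, ∑ j, ν i * ν j * κ (R i) (R j) = ν i * κ (R i) (∑ j, ν j • R j) := by
      intro i; simp [Finset.mul_sum, mul_assoc]
    simp_rw [this]
    rw [show ∑ j, ν j • R j = 0 from h0]; simp
  have expand : ∀ i j, κ (F' i j) (F' i j) = a ^ 4 * κ (F i j) (F i j) +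
      2 * a ^ 3 * c * (ν i * κ (F i j) (R j)) - 2 * a ^ 3 * c * (ν j * κ (F i j) (R i)) +
      a ^ 2 * c ^ 2 * (ν i ^ 2 * κ (R j) (R j)) + a ^ 2 * c ^ 2 * (ν j ^ 2 * κ (R i) (R i)) -
      2 * a ^ 2 * c ^ 2 * (ν i * ν j * κ (R i) (R j)) := by
    intro i j
    rw [hF2]
    simp only [map_add, map_sub, map_smul, LinearMap.add_apply, LinearMap.sub_apply,
      LinearMap.smul_apply, smul_eq_mul]
    rw [hκ (R j) (hRL j) (F i j) (hFL i j), hκ (R i) (hRL i) (F i j) (hFL i j),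
      hκ (R j) (hRL j) (R i) (hRL i)]
    ring
  have tot : ∑ i, ∑ j, κ (F' i j) (F' i j) = a ^ 4 * ∑ i, ∑ j, κ (F i j) (F i j) +
      (4 * a ^ 3 * c + 2 * a ^ 2 * c ^ 2) * ∑ j, κ (R j) (R j) := by
    simp only [← Finset.mul_sum] at c1 c2 c3 c4 c5
    simp only [expand, Finset.sum_sub_distrib, Finset.sum_add_distrib, ← Finset.mul_sum]
    rw [c1, c2, c3, c4]
    simp only [mul_assoc, ← Finset.mul_sum] at c5 ⊢
    rw [c5]
    ring
  rw [← t1, ← t2] at tot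
  linarith

/-- For `a = 1`, `c = -1` the matrix is the projection orthogonal to `ν`, and `|F|² - |F ⌟ ν|²` is
the squared norm of the projected form, hence nonnegative. -/
theorem sum_radial_sq_le (hκ : ∀ X ∈ L, ∀ Y ∈ L, κ X Y = κ Y X) (hpos : ∀ X ∈ L, 0 ≤ κ X X)
    (hF : ∀ i j, F j i = -F i j) (hFL : ∀ i j, F i j ∈ L) (hν : ∑ i, ν i ^ 2 = 1) :
    ∑ j, κ (∑ i, ν i • F i j) (∑ i, ν i • F i j) ≤ ∑ i, ∑ j ∈ Finset.Ioi i, κ (F i j) (F i j) := by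
  have h := radial_conj_sq hκ hF hFL hν 1 (-1) (F' := fun i j => _) fun i j => rfl
  have h' : 0 ≤ ∑ i, ∑ j ∈ Finset.Ioi i, κ (∑ k, ∑ l, (((if i = l then (1 : ℝ) else 0) +
      -1 * (ν i * ν l)) * ((if j = k then (1 : ℝ) else 0) + -1 * (ν j * ν k))) • F l k)
      (∑ k, ∑ l, (((if i = l then (1 : ℝ) else 0) + -1 * (ν i * ν l)) *
      ((if j = k then (1 : ℝ) else 0) + -1 * (ν j * ν k))) • F l k) :=
    Finset.sum_nonneg fun i _ => Finset.sum_nonneg fun j _ => hpos _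
      (L.sum_mem fun k _ => L.sum_mem fun l _ => L.smul_mem _ (hFL l k))
  rw [h] at h'
  linarith

end Algebra

/-! ### The Lie algebra and the integrability of the curvature. -/

theorem conj_mem_lieAlg {m : ℕ} {G : Subgroup (GL (Fin m) ℂ)} {g : GL (Fin m) ℂ} (hg : g ∈ G)
    {X : CMat m} (hX : X ∈ lieAlg G) :
    (g : CMat m) * X * ((g⁻¹ : GL (Fin m) ℂ) : CMat m) ∈ lieAlg G := by
  obtain ⟨γ, hγ, hγ0, hd⟩ := hX
  refine ⟨fun t => g * γ t * g⁻¹, fun t => G.mul_mem (G.mul_mem hg (hγ t)) (G.inv_mem hg),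
    by simp [hγ0], fun a b => ?_⟩
  have h : HasDerivAt (fun t => ∑ d, (∑ c, (g : CMat m) a c * (γ t : CMat m) c d) *
      ((g⁻¹ : GL (Fin m) ℂ) : CMat m) d b) (∑ d, (∑ c, (g : CMat m) a c * X c d) *
      ((g⁻¹ : GL (Fin m) ℂ) : CMat m) d b) 0 :=
    HasDerivAt.fun_sum fun d _ => (HasDerivAt.fun_sum fun c _ =>
      (hd c d).const_mul _).mul_const _
  simpa [Matrix.mul_apply] using h

/-- The bracket is the derivative at `0` of `γ Y γ⁻¹`. Its difference quotients lie in the Lie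
algebra and equal `(D Y - Y D) γ⁻¹` with `D = (γ - 1)/t`; the limit stays in the subspace because a
finite-dimensional subspace is closed. -/
theorem bracket_mem_lieAlg {m : ℕ} {G : Subgroup (GL (Fin m) ℂ)} {X Y : CMat m}
    (hX : X ∈ lieAlg G) (hY : Y ∈ lieAlg G) : X * Y - Y * X ∈ lieAlg G := by
  obtain ⟨γ, hγ, hγ0, hd⟩ := hX
  have hslope : Filter.Tendsto (fun t : ℝ => t⁻¹ • ((γ t : CMat m) - 1)) (nhdsWithin 0 {0}ᶜ)
      (nhds X) := by
    refine tendsto_pi_nhds.2 fun a => tendsto_pi_nhds.2 fun b => ?_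
    have := (hd a b).tendsto_slope
    refine this.congr fun t => ?_
    simp [slope_def_module, hγ0]
  have hcont : Filter.Tendsto (fun t : ℝ => (γ t : CMat m)) (nhdsWithin 0 {0}ᶜ) (nhds 1) := by
    refine tendsto_pi_nhds.2 fun a => tendsto_pi_nhds.2 fun b => ?_
    have := (hd a b).continuousAt.tendsto
    rw [hγ0] at this
    exact this.mono_left nhdsWithin_le_nhds
  have hinv : Filter.Tendsto (fun t : ℝ => ((γ t)⁻¹ : CMat m)) (nhdsWithin 0 {0}ᶜ) (nhds 1) := by
    have hdet : Filter.Tendsto (fun t : ℝ => (γ t : CMat m).det) (nhdsWithin 0 {0}ᶜ) (nhds 1) := by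
      have : Continuous fun M : CMat m => M.det := continuous_id.matrix_det
      simpa [Function.comp_def] using (this.tendsto 1).comp hcont
    have hadj : Filter.Tendsto (fun t : ℝ => (γ t : CMat m).adjugate) (nhdsWithin 0 {0}ᶜ)
        (nhds 1) := by
      have : Continuous fun M : CMat m => M.adjugate := continuous_id.matrix_adjugate
      simpa [Function.comp_def] using (this.tendsto 1).comp hcont
    have := (hdet.inv₀ one_ne_zero).smul hadj
    simpa [Matrix.inv_def] using this
  have hlim : Filter.Tendsto (fun t : ℝ => t⁻¹ • ((γ t : CMat m) * Y * (γ t : CMat m)⁻¹ - Y))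
      (nhdsWithin 0 {0}ᶜ) (nhds ((X * Y - Y * X) * 1)) := by
    have h := ((hslope.mul_const Y).sub (hslope.const_mul Y)).mul hinv
    refine h.congr fun t => ?_
    have hu : (γ t : CMat m) * (γ t : CMat m)⁻¹ = 1 := by
      rw [← Matrix.coe_units_inv]; simp
    simp only [smul_mul_assoc, mul_smul_comm, ← smul_sub, sub_mul, mul_sub, one_mul, mul_one]
    congr 1
    rw [Matrix.mul_assoc Y, hu]
    simp
  rw [mul_one] at hlim
  have hclosed : IsClosed (lieAlg G : Set (CMat m)) := (lieAlg G).closed_of_finiteDimensional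
  refine hclosed.mem_of_tendsto hlim (Filter.Eventually.of_forall fun t => ?_)
  refine (lieAlg G).smul_mem _ ((lieAlg G).sub_mem ?_ hY)
  have := conj_mem_lieAlg (hγ t) hY
  rwa [Matrix.coe_units_inv] at this


/-- Expanding both arguments in the real basis formed by the matrix units and `i` times them leaves
finitely many products of two `L²` functions. -/
theorem integrable_bilin {m : ℕ} {α : Type*} [MeasurableSpace α] {μ : Measure α}
    (κ : LinearMap.BilinForm ℝ (CMat m)) {X Y : α → CMat m}
    (hX : ∀ a b, MemLp (fun x => X x a b) 2 μ) (hY : ∀ a b, MemLp (fun x => Y x a b) 2 μ) :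
    Integrable (fun x => κ (X x) (Y x)) μ := by
  have dec : ∀ M : CMat m, M = ∑ a, ∑ b, ((M a b).re • Matrix.single a b (1 : ℂ) +
      (M a b).im • Matrix.single a b Complex.I) := by
    intro M
    conv_lhs => rw [Matrix.matrix_eq_sum_single M]
    refine Finset.sum_congr rfl fun a _ => Finset.sum_congr rfl fun b _ => ?_
    rw [Matrix.smul_single, Matrix.smul_single, ← Matrix.single_add]
    congr 1
    simp [Complex.re_add_im]
  have e : (fun x => κ (X x) (Y x)) = fun x => κ (∑ a, ∑ b, ((X x a b).re • Matrix.single a b (1 : ℂ) +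
      (X x a b).im • Matrix.single a b Complex.I)) (∑ a, ∑ b, ((Y x a b).re • Matrix.single a b (1 : ℂ) +
      (Y x a b).im • Matrix.single a b Complex.I)) := by
    funext x; rw [← dec, ← dec]
  rw [e]
  simp only [map_sum, map_add, map_smul, LinearMap.sum_apply, LinearMap.add_apply,
    LinearMap.smul_apply, smul_eq_mul]
  have re := fun a b => (hX a b).re
  have im := fun a b => (hX a b).im
  have re' := fun a b => (hY a b).re
  have im' := fun a b => (hY a b).im
  have hS : ∀ c d : CMat m, MemLp (fun x => ∑ a, ∑ b, ((X x a b).re * κ (Matrix.single a b 1) c +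
      (X x a b).im * κ (Matrix.single a b Complex.I) d)) 2 μ := fun c d =>
    memLp_finsetSum _ fun a _ => memLp_finsetSum _ fun b _ =>
      ((re a b).mul_const _).add ((im a b).mul_const _)
  exact integrable_finsetSum _ fun a _ => integrable_finsetSum _ fun b _ =>
    ((re' a b).integrable_mul (hS _ _)).add ((im' a b).integrable_mul (hS _ _))

namespace SobolevForm

variable {m : ℕ} {G : Subgroup (GL (Fin m) ℂ)} {n : ℕ} {Ω : Set (Euc n)}

theorem curv_antisymm (A : SobolevForm G Ω) (x : Euc n) (i j : Fin n) :
    A.curv x j i = -A.curv x i j := by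
  simp only [curv]; abel

theorem curv_mem (A : SobolevForm G Ω) :
    ∀ᵐ x ∂(volume.restrict Ω), ∀ i j, A.curv x i j ∈ lieAlg G := by
  filter_upwards [A.coeff_mem, A.grad_mem] with x hc hg i j
  exact (lieAlg G).add_mem ((lieAlg G).sub_mem (hg i j) (hg j i))
    (bracket_mem_lieAlg (hc i) (hc j))

/-- The quadratic terms are in `L²` by Hölder with exponents `4, 4`; this is the role of the `L⁴`
condition on the coefficients. -/
theorem curv_memLp (A : SobolevForm G Ω) (i j : Fin n) (a b : Fin m) :
    MemLp (fun x => A.curv x i j a b) 2 (volume.restrict Ω) := by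
  have : ENNReal.HolderTriple 4 4 2 := ⟨by
    have : (4 : ENNReal)⁻¹ = 2⁻¹ * 2⁻¹ := by
      rw [← ENNReal.mul_inv (by simp) (by simp)]; norm_num
    rw [this, ← two_mul, ← mul_assoc, ENNReal.mul_inv_cancel (by simp) (by simp), one_mul]⟩
  have hp : ∀ i j, MemLp (fun x => (A.coeff x i * A.coeff x j) a b) 2 (volume.restrict Ω) := by
    intro i j
    simp only [Matrix.mul_apply]
    exact memLp_finsetSum _ fun c _ => (A.memLp_four j c b).mul' (A.memLp_four i a c)
  exact ((A.grad_memLp i j a b).sub (A.grad_memLp j i a b)).add ((hp i j).sub (hp j i))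

theorem integrable_curvSq (κ : LinearMap.BilinForm ℝ (CMat m)) (A : SobolevForm G Ω) :
    IntegrableOn (A.curvSq κ) Ω :=
  integrable_finsetSum _ fun i _ => integrable_finsetSum _ fun j _ =>
    integrable_bilin κ (A.curv_memLp i j) (A.curv_memLp i j)

theorem radialCurv_memLp (A : SobolevForm G Ω) (y : Euc n) (j : Fin n) (a b : Fin m) :
    MemLp (fun x => A.radialCurv y x j a b) 2 (volume.restrict Ω) := by
  have e : (fun x => A.radialCurv y x j a b) =
      fun x => ∑ i, (((x i - y i) / ‖x - y‖ : ℝ) : ℂ) * A.curv x i j a b := by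
    funext x; simp [radialCurv, Matrix.sum_apply]
  rw [e]
  refine memLp_finsetSum _ fun i _ => ?_
  refine (A.curv_memLp i j a b).of_le_mul (c := 1) ?_ (Filter.Eventually.of_forall fun x => ?_)
  · refine AEStronglyMeasurable.mul (Measurable.aestronglyMeasurable ?_)
      (A.curv_memLp i j a b).aestronglyMeasurable
    fun_prop
  · rw [norm_mul]
    gcongr
    rw [Complex.norm_real, Real.norm_eq_abs, abs_div, abs_norm]
    refine div_le_one_of_le₀ ?_ (norm_nonneg _)
    simpa using PiLp.norm_apply_le (x - y) i

theorem integrable_radialCurvSq (κ : LinearMap.BilinForm ℝ (CMat m)) (A : SobolevForm G Ω)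
    (y : Euc n) : IntegrableOn (A.radialCurvSq κ y) Ω :=
  integrable_finsetSum _ fun j _ =>
    integrable_bilin κ (A.radialCurv_memLp y j) (A.radialCurv_memLp y j)

end SobolevForm

theorem sum_sq_direction {n : ℕ} {x y : Euc n} (h : x ≠ y) :
    ∑ i, ((x i - y i) / ‖x - y‖) ^ 2 = 1 := by
  have h0 : ‖x - y‖ ≠ 0 := norm_ne_zero_iff.2 (sub_ne_zero.2 h)
  simp_rw [div_pow, ← Finset.sum_div]
  rw [div_eq_one_iff_eq (pow_ne_zero _ h0), EuclideanSpace.real_norm_sq_eq]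
  simp

theorem IsAdInvariantInner.nonneg {m : ℕ} {G : Subgroup (GL (Fin m) ℂ)}
    {κ : LinearMap.BilinForm ℝ (CMat m)} (hκ : IsAdInvariantInner G κ) {X : CMat m}
    (hX : X ∈ lieAlg G) : 0 ≤ κ X X := by
  by_cases h : X = 0
  · simp [h]
  · exact (hκ.pos X hX h).le

namespace SobolevForm

variable {m : ℕ} {G : Subgroup (GL (Fin m) ℂ)} {n : ℕ} {Ω : Set (Euc n)}
  {κ : LinearMap.BilinForm ℝ (CMat m)}

theorem radialCurvSq_nonneg (hκ : IsAdInvariantInner G κ) (A : SobolevForm G Ω) {x : Euc n}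
    (y : Euc n) (hx : ∀ i j, A.curv x i j ∈ lieAlg G) : 0 ≤ A.radialCurvSq κ y x :=
  Finset.sum_nonneg fun j _ => hκ.nonneg
    ((lieAlg G).sum_mem fun i _ => (lieAlg G).smul_mem _ (hx i j))

theorem radialCurvSq_le (hκ : IsAdInvariantInner G κ) (A : SobolevForm G Ω) {x y : Euc n}
    (hxy : x ≠ y) (hx : ∀ i j, A.curv x i j ∈ lieAlg G) :
    A.radialCurvSq κ y x ≤ A.curvSq κ x :=
  sum_radial_sq_le hκ.symm (fun _ => hκ.nonneg) (A.curv_antisymm x) hx (sum_sq_direction hxy)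

end SobolevForm

/-! ### Weak derivatives -/

section WeakDerivatives

variable {n : ℕ} {i : Fin n}

theorem ContDiff.partialD {φ : Euc n → ℝ} (h : ContDiff ℝ ∞ φ) (i : Fin n) :
    ContDiff ℝ ∞ (partialD i φ) :=
  (h.fderiv_right (m := ∞) (by simp)).clm_apply contDiff_const

theorem HasCompactSupport.partialD {φ : Euc n → ℝ} (h : HasCompactSupport φ) (i : Fin n) :
    HasCompactSupport (partialD i φ) :=
  h.fderiv_apply ℝ _

theorem tsupport_partialD_subset (φ : Euc n → ℝ) (i : Fin n) :
    tsupport (partialD i φ) ⊆ tsupport φ :=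
  tsupport_fderiv_apply_subset ℝ _

theorem partialD_mul {f g : Euc n → ℝ} {x : Euc n} (hf : DifferentiableAt ℝ f x)
    (hg : DifferentiableAt ℝ g x) (i : Fin n) :
    partialD i (fun x => f x * g x) x = f x * partialD i g x + partialD i f x * g x := by
  simp only [partialD]
  rw [fderiv_fun_mul hf hg]
  simp [mul_comm]

theorem contDiff_of_forall_tsupport {E F : Type*} [NormedAddCommGroup E] [NormedSpace ℝ E]
    [NormedAddCommGroup F] [NormedSpace ℝ F] {f : E → F}
    (h : ∀ x ∈ tsupport f, ContDiffAt ℝ ∞ f x) : ContDiff ℝ ∞ f := by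
  refine contDiff_iff_contDiffAt.2 fun x => ?_
  by_cases hx : x ∈ tsupport f
  · exact h x hx
  · exact contDiffAt_const.congr_of_eventuallyEq (notMem_tsupport_iff_eventuallyEq.1 hx)

theorem contDiff_mul_of_tsupport_subset {U : Set (Euc n)} (hU : IsOpen U) {s η : Euc n → ℝ}
    (hs : ContDiffOn ℝ ∞ s U) (hη : ContDiff ℝ ∞ η) (hηU : tsupport η ⊆ U) :
    ContDiff ℝ ∞ (fun x => s x * η x) := by
  refine contDiff_of_forall_tsupport fun x hx => ?_
  have hx' : x ∈ U := hηU (tsupport_mul_subset_right hx)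
  exact (hs.contDiffAt (hU.mem_nhds hx')).mul hη.contDiffAt

theorem integrableOn_smul_of_hasCompactSupport {U : Set (Euc n)} {g : Euc n → ℝ} {w : Euc n → ℂ}
    (hg : Continuous g) (hgc : HasCompactSupport g) (hw : IntegrableOn w U) :
    IntegrableOn (fun x => g x • w x) U := by
  obtain ⟨C, hC⟩ := hgc.exists_bound_of_continuous hg
  exact Integrable.bdd_smul hw C hg.aestronglyMeasurable (Filter.Eventually.of_forall hC)

theorem setIntegral_eq_integral_of_tsupport_subset {E : Type*} [NormedAddCommGroup E]
    [NormedSpace ℝ E] {U : Set (Euc n)} {f : Euc n → E} {η : Euc n → ℝ}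
    (h : ∀ x, η x = 0 → f x = 0) (hη : tsupport η ⊆ U) :
    ∫ x in U, f x = ∫ x, f x := by
  refine setIntegral_eq_integral_of_forall_compl_eq_zero fun x hx => h x ?_
  by_contra h0
  exact hx (hη (subset_tsupport η h0))

theorem IsWeakPartial.mono {Ω U : Set (Euc n)} (hU : U ⊆ Ω) {u v : Euc n → ℂ}
    (h : IsWeakPartial Ω i u v) : IsWeakPartial U i u v := by
  intro φ hφ hc hs
  have := h φ hφ hc (hs.trans hU)
  rw [setIntegral_eq_integral_of_tsupport_subset (η := partialD i φ) (by intro x hx; simp [hx])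
      ((tsupport_partialD_subset φ i).trans (hs.trans hU)),
    setIntegral_eq_integral_of_tsupport_subset (η := φ) (by intro x hx; simp [hx])
      (hs.trans hU)] at this
  rwa [setIntegral_eq_integral_of_tsupport_subset (η := partialD i φ) (by intro x hx; simp [hx])
      ((tsupport_partialD_subset φ i).trans hs),
    setIntegral_eq_integral_of_tsupport_subset (η := φ) (by intro x hx; simp [hx]) hs]

/-- The product rule, obtained by testing with `s_k η`. The factors may be singular off `U`, since
the compact support of `η` inside `U` makes `s_k η` globally smooth. This covers Jacobian entries
that blow up at the centre. -/
theorem IsWeakPartial.sum_smul {ι : Type*} [Fintype ι] {U : Set (Euc n)} (hU : IsOpen U)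
    {s : ι → Euc n → ℝ} (hs : ∀ k, ContDiffOn ℝ ∞ (s k) U) {w v : ι → Euc n → ℂ}
    (hw : ∀ k, IntegrableOn (w k) U) (hv : ∀ k, IntegrableOn (v k) U)
    (h : ∀ k, IsWeakPartial U i (w k) (v k)) :
    IsWeakPartial U i (fun x => ∑ k, s k x • w k x)
      (fun x => ∑ k, (partialD i (s k) x • w k x + s k x • v k x)) := by
  intro η hη hc hηU
  have hds : ∀ k, ContDiffOn ℝ ∞ (partialD i (s k)) U := fun k =>
    ((hs k).fderiv_of_isOpen hU (m := ∞) (by simp)).clm_apply contDiffOn_const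
  have t0 := fun k => contDiff_mul_of_tsupport_subset hU (hs k) hη hηU
  have c0 : ∀ k, HasCompactSupport (fun x => s k x * η x) := fun k => hc.mul_left
  have s0 : ∀ k, tsupport (fun x => s k x * η x) ⊆ U := fun k =>
    tsupport_mul_subset_right.trans hηU
  have t1 := fun k => contDiff_mul_of_tsupport_subset hU (hs k) (hη.partialD i)
    ((tsupport_partialD_subset η i).trans hηU)
  have t2 := fun k => contDiff_mul_of_tsupport_subset hU (hds k) hη hηU
  have I1 := fun k => integrableOn_smul_of_hasCompactSupport (U := U) (t1 k).continuous
    (hc.partialD i).mul_left (hw k)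
  have I2 := fun k => integrableOn_smul_of_hasCompactSupport (U := U) (t2 k).continuous
    hc.mul_left (hw k)
  have I3 := fun k => integrableOn_smul_of_hasCompactSupport (U := U) (t0 k).continuous
    (c0 k) (hv k)
  have key : ∀ k, ∫ x in U, (s k x * partialD i η x) • w k x =
      -((∫ x in U, (partialD i (s k) x * η x) • w k x) + ∫ x in U, (s k x * η x) • v k x) := by
    intro k
    have := h k _ (t0 k) (c0 k) (s0 k)
    have e : ∀ x, partialD i (fun x => s k x * η x) x =
        s k x * partialD i η x + partialD i (s k) x * η x := by
      intro x
      by_cases hx : x ∈ U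
      · exact partialD_mul (((hs k).contDiffAt (hU.mem_nhds hx)).differentiableAt (by simp))
          (hη.differentiable (by simp)).differentiableAt i
      · have h1 : partialD i (fun x => s k x * η x) x = 0 := image_eq_zero_of_notMem_tsupport
          fun hx' => hx (s0 k (tsupport_partialD_subset _ i hx'))
        have h2 : partialD i η x = 0 := image_eq_zero_of_notMem_tsupport
          fun hx' => hx (hηU (tsupport_partialD_subset _ i hx'))
        have h3 : η x = 0 := image_eq_zero_of_notMem_tsupport fun hx' => hx (hηU hx')
        rw [h1, h2, h3]; ring
    simp_rw [e, add_smul] at this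
    rw [integral_add (I1 k) (I2 k)] at this
    linear_combination this
  have l : ∀ x, partialD i η x • ∑ k, s k x • w k x =
      ∑ k, (s k x * partialD i η x) • w k x := by
    intro x; rw [Finset.smul_sum]
    exact Finset.sum_congr rfl fun k _ => by rw [smul_smul, mul_comm]
  have r : ∀ x, η x • ∑ k, (partialD i (s k) x • w k x + s k x • v k x) =
      ∑ k, ((partialD i (s k) x * η x) • w k x + (s k x * η x) • v k x) := by
    intro x; rw [Finset.smul_sum]
    refine Finset.sum_congr rfl fun k _ => ?_
    rw [smul_add, smul_smul, smul_smul, mul_comm (η x), mul_comm (η x)]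
  simp_rw [l, r]
  have I23 : ∀ k, IntegrableOn (fun x => (partialD i (s k) x * η x) • w k x +
      (s k x * η x) • v k x) U := fun k => (I2 k).add (I3 k)
  rw [integral_finsetSum _ fun k _ => I1 k, integral_finsetSum _ fun k _ => I23 k,
    ← Finset.sum_neg_distrib]
  refine Finset.sum_congr rfl fun k _ => ?_
  rw [key, ← integral_add (I2 k) (I3 k)]

/-- Pulling a test function back by a diffeomorphism, multiplied by a smooth function. -/
theorem testFunction_comp_diffeo {U V : Set (Euc n)} (hV : IsOpen V)
    {φ ψ : Euc n → Euc n} (hφ : ContDiffOn ℝ ∞ φ U) (hψ : ContDiffOn ℝ ∞ ψ V)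
    (hφV : Set.MapsTo φ U V) (hφψ : ∀ z ∈ V, φ (ψ z) = z)
    {g η : Euc n → ℝ} (hg : ContDiffOn ℝ ∞ g V) (hη : ContDiff ℝ ∞ η) (hc : HasCompactSupport η)
    (hηU : tsupport η ⊆ U) :
    ContDiff ℝ ∞ (V.indicator fun z => g z * η (ψ z)) ∧
      HasCompactSupport (V.indicator fun z => g z * η (ψ z)) ∧
      tsupport (V.indicator fun z => g z * η (ψ z)) ⊆ V := by
  have hK : IsCompact (φ '' tsupport η) := hc.isCompact.image_of_continuousOn
    (hφ.continuousOn.mono hηU)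
  have hsup : Function.support (V.indicator fun z => g z * η (ψ z)) ⊆ φ '' tsupport η := by
    intro z hz
    have hzV : z ∈ V := by
      by_contra h; exact hz (Set.indicator_of_notMem h _)
    refine ⟨ψ z, subset_tsupport _ fun h0 => hz ?_, hφψ z hzV⟩
    rw [Set.indicator_of_mem hzV, h0, mul_zero]
  have hts : tsupport (V.indicator fun z => g z * η (ψ z)) ⊆ φ '' tsupport η :=
    closure_minimal hsup hK.isClosed
  have hKV : φ '' tsupport η ⊆ V := by
    rintro _ ⟨x, hx, rfl⟩; exact hφV (hηU hx)
  refine ⟨contDiff_of_forall_tsupport fun z hz => ?_, HasCompactSupport.of_support_subset_isCompact hK hsup,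
    hts.trans hKV⟩
  have hzV := hKV (hts hz)
  have h1 : ContDiffAt ℝ ∞ (fun z => g z * η (ψ z)) z :=
    (hg.contDiffAt (hV.mem_nhds hzV)).mul
      (hη.contDiffAt.comp z (hψ.contDiffAt (hV.mem_nhds hzV)))
  refine h1.congr_of_eventuallyEq ?_
  filter_upwards [hV.mem_nhds hzV] with w hw
  exact Set.indicator_of_mem hw _

/-- The chain rule for weak derivatives and smooth changes of variables. -/
theorem IsWeakPartial.comp_diffeo {U V : Set (Euc n)} (hU : IsOpen U) (hV : IsOpen V)
    {φ ψ : Euc n → Euc n} (hφ : ContDiffOn ℝ ∞ φ U) (hψ : ContDiffOn ℝ ∞ ψ V)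
    (hφV : Set.MapsTo φ U V) (hψU : Set.MapsTo ψ V U) (hφψ : ∀ z ∈ V, φ (ψ z) = z)
    (hψφ : ∀ x ∈ U, ψ (φ x) = x) {J : Euc n → ℝ} (hJ : ContDiffOn ℝ ∞ J V)
    (hJdet : ∀ z ∈ V, |(fderiv ℝ ψ z).det| = J z) {u : Euc n → ℂ} {v : Fin n → Euc n → ℂ}
    (hu : IntegrableOn u V) (hv : ∀ l, IntegrableOn (v l) V)
    (h : ∀ l, IsWeakPartial V l u (v l)) :
    IsWeakPartial U i (fun x => u (φ x))
      (fun x => ∑ l, (fderiv ℝ φ x (EuclideanSpace.single i 1) l) • v l (φ x)) := by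
  have himg : ψ '' V = U := by
    refine Set.Subset.antisymm (Set.image_subset_iff.2 hψU) fun x hx => ⟨φ x, hφV hx, hψφ x hx⟩
  have cov : ∀ {E : Type} [NormedAddCommGroup E] [NormedSpace ℝ E] (g : Euc n → E),
      ∫ x in U, g x = ∫ z in V, J z • g (ψ z) := by
    intro E _ _ g
    rw [← himg, integral_image_eq_integral_abs_det_fderiv_smul volume hV.measurableSet
      (f' := fderiv ℝ ψ) (fun z hz => ((hψ.contDiffAt (hV.mem_nhds hz)).differentiableAt
        (by simp)).hasFDerivAt.hasFDerivWithinAt)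
      (fun z hz z' hz' e => by rw [← hφψ z hz, ← hφψ z' hz', e])]
    exact setIntegral_congr_fun hV.measurableSet fun z hz => by simp only [hJdet z hz]
  intro η hη hc hηU
  set d : Fin n → Euc n → ℝ := fun l x => fderiv ℝ φ x (EuclideanSpace.single i 1) l with hd
  have hdU : ∀ l, ContDiffOn ℝ ∞ (d l) U := by
    intro l
    have h1 : ContDiffOn ℝ ∞ (fun x => fderiv ℝ φ x (EuclideanSpace.single i 1)) U :=
      (hφ.fderiv_of_isOpen hU (m := ∞) (by simp)).clm_apply contDiffOn_const
    exact (EuclideanSpace.proj l : Euc n →L[ℝ] ℝ).contDiff.comp_contDiffOn h1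
  have hgQ : ∀ l, ContDiffOn ℝ ∞ (fun z => J z * d l (ψ z)) V := fun l =>
    hJ.mul ((hdU l).comp hψ hψU)
  obtain ⟨P1, P2, P3⟩ := testFunction_comp_diffeo hV hφ hψ hφV hφψ hJ (hη.partialD i)
    (hc.partialD i) ((tsupport_partialD_subset η i).trans hηU)
  have hQ := fun l => testFunction_comp_diffeo hV hφ hψ hφV hφψ (hgQ l) hη hc hηU
  set P := V.indicator fun z => J z * partialD i η (ψ z) with hP
  set Q : Fin n → Euc n → ℝ := fun l => V.indicator fun z => J z * d l (ψ z) * η (ψ z) with hQd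
  have Q1 : ∀ l, ContDiff ℝ ∞ (Q l) := fun l => (hQ l).1
  have Q2 : ∀ l, HasCompactSupport (Q l) := fun l => (hQ l).2.1
  have Q3 : ∀ l, tsupport (Q l) ⊆ V := fun l => (hQ l).2.2
  -- The Piola identity, which contains the chain rule: `J (∂ᵢη)∘ψ` is the divergence of the field
  -- `Q`. Both sides are tested against a smooth `g`; pulling the integrals back to `U` and
  -- integrating by parts there avoids differentiating the Jacobian determinant.
  have piola : ∀ᵐ z, P z = ∑ l, partialD l (Q l) z := by
    refine ae_eq_of_integral_contDiff_smul_eq P1.continuous.locallyIntegrable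
      (continuous_finsetSum _ fun l _ => ((Q1 l).partialD l).continuous).locallyIntegrable
      fun g hg hgc => ?_
    have hgφ : ContDiffOn ℝ ∞ (fun x => g (φ x)) U := hg.comp_contDiffOn hφ
    have hdgφ : ContDiffOn ℝ ∞ (partialD i fun x => g (φ x)) U :=
      (hgφ.fderiv_of_isOpen hU (m := ∞) (by simp)).clm_apply contDiffOn_const
    have hdgφ' : ∀ x ∈ U, partialD i (fun x => g (φ x)) x = ∑ l, d l x * partialD l g (φ x) := by
      intro x hx
      have h1 : fderiv ℝ (fun x => g (φ x)) x = (fderiv ℝ g (φ x)).comp (fderiv ℝ φ x) :=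
        fderiv_comp x (hg.differentiable (by simp)).differentiableAt
          ((hφ.contDiffAt (hU.mem_nhds hx)).differentiableAt (by simp))
      simp only [partialD, h1, ContinuousLinearMap.comp_apply]
      set w := fderiv ℝ φ x (EuclideanSpace.single i 1) with hw
      have hwe : w = ∑ l, w l • EuclideanSpace.single l (1 : ℝ) := by
        ext k; simp [Pi.single_apply]
      conv_lhs => rw [hwe]
      simp [hd, hw]
    have e1 : ∫ z, g z • P z = ∫ x in U, g (φ x) * partialD i η x := by
      rw [cov, ← setIntegral_eq_integral_of_tsupport_subset (U := V) (η := P) (by simp_all) P3]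
      refine setIntegral_congr_fun hV.measurableSet fun z hz => ?_
      simp only [hP, Set.indicator_of_mem hz, hφψ z hz, smul_eq_mul]
      ring
    have e2 : ∫ x in U, g (φ x) * partialD i η x =
        -∫ x in U, partialD i (fun x => g (φ x)) x * η x := by
      rw [setIntegral_eq_integral_of_tsupport_subset (η := partialD i η) (by simp_all)
        ((tsupport_partialD_subset η i).trans hηU),
        setIntegral_eq_integral_of_tsupport_subset (η := η) (by simp_all) hηU]
      refine integral_mul_fderiv_eq_neg_fderiv_mul_of_integrable ?_ ?_ ?_ ?_ ?_
      · exact (contDiff_mul_of_tsupport_subset hU hdgφ hη hηU).continuous.integrable_of_hasCompactSupport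
          hc.mul_left
      · exact (contDiff_mul_of_tsupport_subset hU hgφ (hη.partialD i)
          ((tsupport_partialD_subset η i).trans hηU)).continuous.integrable_of_hasCompactSupport
          (hc.partialD i).mul_left
      · exact (contDiff_mul_of_tsupport_subset hU hgφ hη hηU).continuous.integrable_of_hasCompactSupport
          hc.mul_left
      · exact fun x hx => (hgφ.contDiffAt (hU.mem_nhds (hηU hx))).differentiableAt (by simp)
      · exact fun x _ => (hη.differentiable (by simp)).differentiableAt
    have e3 : ∫ x in U, partialD i (fun x => g (φ x)) x * η x =
        ∑ l, ∫ z, partialD l g z * Q l z := by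
      rw [cov, ← integral_finsetSum]
      · rw [← setIntegral_eq_integral_of_forall_compl_eq_zero (s := V)
            (f := fun z => ∑ l, partialD l g z * Q l z)]
        · refine setIntegral_congr_fun hV.measurableSet fun z hz => ?_
          simp only [hQd, Set.indicator_of_mem hz, hdgφ' _ (hψU hz), hφψ z hz, smul_eq_mul,
            Finset.sum_mul, Finset.mul_sum]
          exact Finset.sum_congr rfl fun l _ => by ring
        · intro z hz
          exact Finset.sum_eq_zero fun l _ => by simp [hQd, Set.indicator_of_notMem hz]
      · intro l _
        exact ((hg.partialD l).continuous.mul (Q1 l).continuous).integrable_of_hasCompactSupport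
          (Q2 l).mul_left
    have e4 : ∀ l, ∫ z, partialD l g z * Q l z = -∫ z, g z * partialD l (Q l) z := by
      intro l
      rw [eq_neg_iff_add_eq_zero, add_comm, ← eq_neg_iff_add_eq_zero]
      refine integral_mul_fderiv_eq_neg_fderiv_mul_of_integrable ?_ ?_ ?_ ?_ ?_
      · exact ((hg.partialD l).continuous.mul (Q1 l).continuous).integrable_of_hasCompactSupport
          (Q2 l).mul_left
      · exact (hg.continuous.mul ((Q1 l).partialD l).continuous).integrable_of_hasCompactSupport
          ((Q2 l).partialD l).mul_left
      · exact (hg.continuous.mul (Q1 l).continuous).integrable_of_hasCompactSupport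
          (Q2 l).mul_left
      · exact fun x _ => (hg.differentiable (by simp)).differentiableAt
      · exact fun x _ => ((Q1 l).differentiable (by simp)).differentiableAt
    rw [e1, e2, e3]
    simp_rw [e4, smul_eq_mul, Finset.mul_sum]
    rw [integral_finsetSum, Finset.sum_neg_distrib, neg_neg]
    intro l _
    exact (hg.continuous.mul ((Q1 l).partialD l).continuous).integrable_of_hasCompactSupport
      ((Q2 l).partialD l).mul_left
  have f1 : ∫ x in U, partialD i η x • u (φ x) = ∫ z in V, P z • u z := by
    rw [cov]
    refine setIntegral_congr_fun hV.measurableSet fun z hz => ?_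
    simp only [hP, Set.indicator_of_mem hz, hφψ z hz, smul_smul]
  have f2 : ∫ z in V, P z • u z = ∑ l, ∫ z in V, partialD l (Q l) z • u z := by
    rw [← integral_finsetSum]
    · refine integral_congr_ae ?_
      filter_upwards [ae_restrict_of_ae piola] with z hz
      rw [hz, Finset.sum_smul]
    · exact fun l _ => integrableOn_smul_of_hasCompactSupport ((Q1 l).partialD l).continuous
        ((Q2 l).partialD l) hu
  have f3 : ∫ x in U, η x • ∑ l, d l x • v l (φ x) = ∑ l, ∫ z in V, Q l z • v l z := by
    rw [cov, ← integral_finsetSum]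
    · refine setIntegral_congr_fun hV.measurableSet fun z hz => ?_
      simp only [hQd, Set.indicator_of_mem hz, hφψ z hz, Finset.smul_sum, smul_smul]
      exact Finset.sum_congr rfl fun l _ => by congr 1; ring
    · exact fun l _ => integrableOn_smul_of_hasCompactSupport (Q1 l).continuous (Q2 l) (hv l)
  rw [f1, f2, f3, ← Finset.sum_neg_distrib]
  -- Only here are the weak derivatives of `u` used, with `Q l` as test functions.
  exact Finset.sum_congr rfl fun l _ => h l _ (Q1 l) (Q2 l) (Q3 l)

end WeakDerivatives

/-! ### Removability of a point for weak derivatives. -/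

section RemovablePoint

variable {n : ℕ} {i : Fin n}

theorem exists_bound_deriv_smoothTransition :
    ∃ B : ℝ, 0 ≤ B ∧ ∀ t, |deriv Real.smoothTransition t| ≤ B := by
  have hc : HasCompactSupport (deriv Real.smoothTransition) := by
    refine HasCompactSupport.of_support_subset_isCompact (isCompact_Icc (a := (0 : ℝ)) (b := 1)) ?_
    intro t ht
    by_contra h
    rw [Set.mem_Icc, not_and_or, not_le, not_le] at h
    refine ht ?_
    rcases h with h | h
    · have : Real.smoothTransition =ᶠ[nhds t] fun _ => 0 := by
        filter_upwards [Iio_mem_nhds h] with s hs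
        exact Real.smoothTransition.zero_of_nonpos (le_of_lt hs)
      rw [this.deriv_eq]; simp
    · have : Real.smoothTransition =ᶠ[nhds t] fun _ => 1 := by
        filter_upwards [Ioi_mem_nhds h] with s hs
        exact Real.smoothTransition.one_of_one_le (le_of_lt hs)
      rw [this.deriv_eq]; simp
  have hcont : Continuous (deriv Real.smoothTransition) :=
    (Real.smoothTransition.contDiff (n := 1)).continuous_deriv le_rfl
  obtain ⟨B, hB⟩ := hc.exists_bound_of_continuous hcont
  exact ⟨B, (norm_nonneg _).trans (hB 0), hB⟩

/-- A cutoff function vanishing near `y`. -/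
def pointCutoff (y : Euc n) (δ : ℝ) (x : Euc n) : ℝ :=
  Real.smoothTransition (‖x - y‖ ^ 2 / δ ^ 2 - 1)

theorem contDiff_pointCutoff (y : Euc n) (δ : ℝ) : ContDiff ℝ ∞ (pointCutoff y δ) := by
  refine Real.smoothTransition.contDiff.comp ?_
  exact (((contDiff_id.sub contDiff_const).norm_sq ℝ).div_const _).sub contDiff_const

theorem pointCutoff_eq_zero {y x : Euc n} {δ : ℝ} (hδ : 0 < δ) (h : ‖x - y‖ ≤ δ) :
    pointCutoff y δ x = 0 := by
  refine Real.smoothTransition.zero_of_nonpos ?_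
  have : ‖x - y‖ ^ 2 / δ ^ 2 ≤ 1 := by
    rw [div_le_one (by positivity)]; gcongr
  linarith

theorem pointCutoff_eq_one {y x : Euc n} {δ : ℝ} (hδ : 0 < δ) (h : 2 * δ ≤ ‖x - y‖) :
    pointCutoff y δ x = 1 := by
  refine Real.smoothTransition.one_of_one_le ?_
  have : 4 ≤ ‖x - y‖ ^ 2 / δ ^ 2 := by
    rw [le_div_iff₀ (by positivity)]; nlinarith
  linarith

theorem partialD_pointCutoff_eq_zero {y x : Euc n} {δ : ℝ} (hδ : 0 < δ) (h : 2 * δ < ‖x - y‖) :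
    partialD i (pointCutoff y δ) x = 0 := by
  have : pointCutoff y δ =ᶠ[nhds x] fun _ => 1 := by
    have hc : Continuous fun x : Euc n => ‖x - y‖ := by fun_prop
    filter_upwards [hc.isOpen_preimage _ isOpen_Ioi |>.mem_nhds h] with z hz
    exact pointCutoff_eq_one hδ (le_of_lt hz)
  rw [partialD, this.fderiv_eq]; simp

/-- The inner derivative is at most `2‖x - y‖/δ²`, and only `‖x - y‖ ≤ 2δ` matters; this gives the
factor `4/δ`. -/
theorem exists_bound_partialD_pointCutoff (n : ℕ) :
    ∃ B : ℝ, 0 ≤ B ∧ ∀ (i : Fin n) (y x : Euc n) (δ : ℝ), 0 < δ →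
      |partialD i (pointCutoff y δ) x| ≤ B / δ := by
  obtain ⟨B, hB0, hB⟩ := exists_bound_deriv_smoothTransition
  refine ⟨4 * B, by positivity, fun i y x δ hδ => ?_⟩
  rcases lt_or_ge (2 * δ) ‖x - y‖ with h | h
  · rw [partialD_pointCutoff_eq_zero hδ h, abs_zero]; positivity
  · have h1 : HasFDerivAt (fun x : Euc n => ‖x - y‖ ^ 2 / δ ^ 2 - 1)
        ((δ ^ 2)⁻¹ • (2 • (innerSL ℝ (x - y)).comp (ContinuousLinearMap.id ℝ (Euc n)))) x := by
      have := (((hasFDerivAt_id x).sub_const y).norm_sq.const_mul ((δ ^ 2)⁻¹)).sub_const 1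
      simpa [div_eq_inv_mul] using this
    have h2 : HasDerivAt Real.smoothTransition (deriv Real.smoothTransition (‖x - y‖ ^ 2 / δ ^ 2 - 1))
        (‖x - y‖ ^ 2 / δ ^ 2 - 1) :=
      ((Real.smoothTransition.contDiff (n := 1)).differentiable (by simp)).differentiableAt.hasDerivAt
    have h3 := h2.comp_hasFDerivAt x h1
    have h4 : partialD i (pointCutoff y δ) x =
        deriv Real.smoothTransition (‖x - y‖ ^ 2 / δ ^ 2 - 1) * ((δ ^ 2)⁻¹ * (2 * (x i - y i))) := by
      rw [partialD, show pointCutoff y δ = Real.smoothTransition ∘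
        (fun x : Euc n => ‖x - y‖ ^ 2 / δ ^ 2 - 1) from rfl, h3.fderiv]
      simp [EuclideanSpace.inner_single_right]
    rw [h4, abs_mul]
    have h5 : |(δ ^ 2)⁻¹ * (2 * (x i - y i))| ≤ 4 / δ := by
      have : |x i - y i| ≤ ‖x - y‖ := by simpa using PiLp.norm_apply_le (x - y) i
      rw [abs_mul, abs_mul, abs_of_pos (by positivity : (0 : ℝ) < (δ ^ 2)⁻¹), abs_two,
        ← div_eq_inv_mul, div_le_div_iff₀ (by positivity) hδ]
      nlinarith
    calc _ ≤ B * (4 / δ) := by gcongr; exact hB _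
      _ = _ := by ring

/-- Points are removable for weak derivatives of square integrable functions in dimension `≥ 3`. -/
theorem IsWeakPartial.of_punctured (hn : 3 ≤ n) {U : Set (Euc n)} {y : Euc n}
    {u v : Euc n → ℂ} (hu2 : MemLp u 2 (volume.restrict U)) (hu : IntegrableOn u U)
    (hv : IntegrableOn v U) (h : IsWeakPartial (U \ {y}) i u v) : IsWeakPartial U i u v := by
  have : Nonempty (Fin n) := ⟨⟨0, by omega⟩⟩
  intro η hη hc hηU
  obtain ⟨B, hB0, hB⟩ := exists_bound_partialD_pointCutoff n
  obtain ⟨M, hM⟩ := hc.exists_bound_of_continuous hη.continuous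
  have hM0 : 0 ≤ M := (norm_nonneg _).trans (hM y)
  set δ : ℕ → ℝ := fun k => 1 / ((k : ℝ) + 1) with hδ
  have hδ0 : ∀ k, 0 < δ k := fun k => by simp only [hδ]; positivity
  have hδt : Filter.Tendsto δ Filter.atTop (nhds 0) := tendsto_one_div_add_atTop_nhds_zero_nat
  have hχ := fun k => contDiff_pointCutoff y (δ k)
  have hle : ∀ k x, ‖pointCutoff y (δ k) x‖ ≤ 1 := fun k x => by
    rw [pointCutoff, Real.norm_eq_abs, abs_of_nonneg (Real.smoothTransition.nonneg _)]
    exact Real.smoothTransition.le_one _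
  have hne : ∀ᵐ x ∂(volume.restrict U), x ≠ y :=
    ae_restrict_of_ae (by simp [ae_iff])
  have hlim : ∀ x, x ≠ y → Filter.Tendsto (fun k => pointCutoff y (δ k) x) Filter.atTop (nhds 1) := by
    intro x hx
    have h0 : 0 < ‖x - y‖ := norm_pos_iff.2 (sub_ne_zero.2 hx)
    refine tendsto_const_nhds.congr' ?_
    have := hδt.eventually (gt_mem_nhds (half_pos h0))
    filter_upwards [this] with k hk
    exact (pointCutoff_eq_one (hδ0 k) (by linarith)).symm
  have Iu : IntegrableOn (fun x => partialD i η x • u x) U :=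
    integrableOn_smul_of_hasCompactSupport (hη.partialD i).continuous (hc.partialD i) hu
  have Iv : IntegrableOn (fun x => η x • v x) U :=
    integrableOn_smul_of_hasCompactSupport hη.continuous hc hv
  have L : ∀ {f : Euc n → ℂ}, IntegrableOn f U → Filter.Tendsto
      (fun k => ∫ x in U, pointCutoff y (δ k) x • f x) Filter.atTop (nhds (∫ x in U, f x)) := by
    intro f hf
    refine tendsto_integral_of_dominated_convergence (fun x => ‖f x‖) ?_ hf.norm ?_ ?_
    · exact fun k => (hχ k).continuous.aestronglyMeasurable.smul hf.aestronglyMeasurable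
    · intro k
      refine Filter.Eventually.of_forall fun x => ?_
      rw [norm_smul]
      exact mul_le_of_le_one_left (norm_nonneg _) (hle k x)
    · filter_upwards [hne] with x hx
      simpa using (hlim x hx).smul_const (f x)
  -- Testing with the cutoff times `η` is allowed on the punctured set; the term in which the cutoff
  -- is differentiated is the only obstruction to passing to the limit.
  have hid : ∀ k, ∫ x in U, (partialD i (pointCutoff y (δ k)) x * η x) • u x =
      -(∫ x in U, pointCutoff y (δ k) x • (η x • v x)) -
        ∫ x in U, pointCutoff y (δ k) x • (partialD i η x • u x) := by
    intro k
    have hd := (hχ k).partialD i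
    have I1 : IntegrableOn (fun x => (partialD i (pointCutoff y (δ k)) x * η x) • u x) U :=
      integrableOn_smul_of_hasCompactSupport (hd.continuous.mul hη.continuous) hc.mul_left hu
    have I2 : IntegrableOn (fun x => (pointCutoff y (δ k) x * partialD i η x) • u x) U :=
      integrableOn_smul_of_hasCompactSupport
        ((hχ k).continuous.mul (hη.partialD i).continuous) (hc.partialD i).mul_left hu
    have hts : tsupport (fun x => pointCutoff y (δ k) x * η x) ⊆ U \ {y} := by
      intro x hx
      refine ⟨hηU (tsupport_mul_subset_right hx), ?_⟩
      rintro rfl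
      refine (notMem_tsupport_iff_eventuallyEq.2 ?_) (tsupport_mul_subset_left hx)
      filter_upwards [ball_mem_nhds x (hδ0 k)] with z hz
      exact pointCutoff_eq_zero (hδ0 k) (by rw [← dist_eq_norm]; exact (mem_ball.1 hz).le)
    have := h _ ((hχ k).mul hη) hc.mul_left hts
    have hres : volume.restrict (U \ {y}) = volume.restrict U :=
      Measure.restrict_congr_set (sdiff_null_ae_eq_self (measure_singleton y))
    rw [hres] at this
    have e : ∀ x, partialD i (fun x => pointCutoff y (δ k) x * η x) x =
        pointCutoff y (δ k) x * partialD i η x + partialD i (pointCutoff y (δ k)) x * η x :=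
      fun x => partialD_mul ((hχ k).differentiable (by simp)).differentiableAt
        (hη.differentiable (by simp)).differentiableAt i
    simp_rw [e, add_smul] at this
    rw [integral_add I2 I1] at this
    simp_rw [smul_smul]
    linear_combination this
  have hzero : Filter.Tendsto
      (fun k => ∫ x in U, (partialD i (pointCutoff y (δ k)) x * η x) • u x) Filter.atTop (nhds 0) := by
    set c : ℝ := (volume (ball (0 : Euc n) 1)).toReal with hcdef
    set S : ℕ → Set (Euc n) := fun k => closedBall y (2 * δ k) with hS
    have hvol : ∀ k, volume.real (S k) = (2 * δ k) ^ n * c := by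
      intro k
      rw [measureReal_def, hS, Measure.addHaar_closedBall _ _ (by linarith [hδ0 k]), ENNReal.toReal_mul,
        ENNReal.toReal_ofReal (by have := hδ0 k; positivity)]
      simp [hcdef]
    have hu2' : IntegrableOn (fun x => ‖u x‖ ^ 2) U := hu2.integrable_norm_pow (by simp)
    have hSf : ∀ k, volume (S k) < ⊤ := fun k => measure_closedBall_lt_top
    -- On the ball of radius `2δ` the integrand is at most `B M ‖u‖/δ`, and `‖u‖/δ ≤ ‖u‖² + 1/δ²`.
    -- The first part tends to zero with the ball; the second gives a multiple of `δ^(n-2)`, hence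
    -- of `δ` when `n ≥ 3`.
    have bound : ∀ k, ‖∫ x in U, (partialD i (pointCutoff y (δ k)) x * η x) • u x‖ ≤
        B * M * ∫ x in S k, ‖u x‖ ^ 2 ∂(volume.restrict U) + B * M * ((2 ^ n * c) * δ k) := by
      intro k
      have h1 : ‖∫ x in U, (partialD i (pointCutoff y (δ k)) x * η x) • u x‖ ≤
          ∫ x in U, (S k).indicator (fun x => B * M * (‖u x‖ ^ 2 + 1 / δ k ^ 2)) x := by
        refine norm_integral_le_of_norm_le ?_ (Filter.Eventually.of_forall fun x => ?_)
        · rw [integrable_indicator_iff measurableSet_closedBall]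
          refine Integrable.const_mul (Integrable.add hu2'.integrableOn ?_) _
          refine integrableOn_const ?_
          exact ((Measure.restrict_apply_le _ _).trans_lt (hSf k)).ne
        · by_cases hx : x ∈ S k
          · rw [Set.indicator_of_mem hx, norm_smul, norm_mul]
            have b1 : ‖partialD i (pointCutoff y (δ k)) x‖ * ‖η x‖ ≤ B / δ k * M :=
              mul_le_mul (hB i y x _ (hδ0 k)) (hM x) (norm_nonneg _)
                (div_nonneg hB0 (hδ0 k).le)
            calc _ ≤ B / δ k * M * ‖u x‖ := by gcongr
              _ = B * M * (1 / δ k * ‖u x‖) := by ring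
              _ ≤ _ := by
                gcongr
                have : 1 / δ k ^ 2 = (1 / δ k) ^ 2 := by ring
                rw [this]
                nlinarith [sq_nonneg (1 / δ k - ‖u x‖), sq_nonneg ‖u x‖, sq_nonneg (1 / δ k)]
          · rw [Set.indicator_of_notMem hx, partialD_pointCutoff_eq_zero (hδ0 k)
              (by simpa [hS, dist_eq_norm] using hx)]
            simp
      refine h1.trans ?_
      rw [integral_indicator measurableSet_closedBall, integral_const_mul,
        integral_add hu2'.integrableOn (integrableOn_const
          ((Measure.restrict_apply_le _ _).trans_lt (hSf k)).ne), mul_add]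
      gcongr
      rw [setIntegral_const, smul_eq_mul]
      have hr : (volume.restrict U).real (S k) ≤ (2 * δ k) ^ n * c := by
        rw [← hvol k]
        exact ENNReal.toReal_mono (hSf k).ne (Measure.restrict_apply_le _ _)
      have hδ1 : δ k ≤ 1 := by
        simp only [hδ]; rw [div_le_one (by positivity)]; linarith [Nat.cast_nonneg (α := ℝ) k]
      have hc0 : 0 ≤ c := ENNReal.toReal_nonneg
      calc _ ≤ (2 * δ k) ^ n * c * (1 / δ k ^ 2) := by
            have := hδ0 k
            gcongr
        _ = 2 ^ n * c * δ k ^ (n - 2) := by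
            have : δ k ^ n = δ k ^ (n - 2) * δ k ^ 2 := by rw [← pow_add]; congr 1; omega
            have := (hδ0 k).ne'
            rw [mul_pow, ‹δ k ^ n = _›]; field_simp
        _ ≤ 2 ^ n * c * δ k := by
            gcongr
            exact pow_le_of_le_one (hδ0 k).le hδ1 (by omega)
    refine squeeze_zero_norm bound ?_
    have t1 : Filter.Tendsto (fun k => ∫ x in S k, ‖u x‖ ^ 2 ∂(volume.restrict U)) Filter.atTop
        (nhds 0) := by
      refine hu2'.tendsto_setIntegral_nhds_zero ?_
      refine tendsto_of_tendsto_of_tendsto_of_le_of_le (h := fun k => volume (S k))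
        tendsto_const_nhds ?_ (fun k => zero_le) (fun k => Measure.restrict_apply_le _ _)
      have : Filter.Tendsto (fun k => ENNReal.ofReal ((2 * δ k) ^ n * c)) Filter.atTop (nhds 0) := by
        have h0 : (0 : ENNReal) = ENNReal.ofReal ((2 * 0) ^ n * c) := by
          rw [mul_zero, zero_pow (by omega)]; simp
        rw [h0]
        exact ENNReal.tendsto_ofReal (((hδt.const_mul 2).pow n).mul_const c)
      refine this.congr fun k => ?_
      rw [← hvol k, measureReal_def, ENNReal.ofReal_toReal (hSf k).ne]
    have := (t1.const_mul (B * M)).add ((hδt.const_mul (2 ^ n * c)).const_mul (B * M))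
    simpa using this
  have hlim2 := (L Iv).neg.sub (L Iu)
  have := tendsto_nhds_unique (hzero.congr hid) hlim2
  linear_combination this

end RemovablePoint

/-! ### Radial diffeomorphisms -/

/-- Mutually inverse smooth profiles `h`, `f`: `h` maps `(c, r)` onto `(0, r)`, is expanding, and is
the identity beyond `r'`. -/
structure IsProfile (h f : ℝ → ℝ) (c r' r : ℝ) : Prop where
  smooth : ContDiff ℝ ∞ h
  smooth_inv : ContDiff ℝ ∞ f
  left_inv : ∀ t, f (h t) = t
  right_inv : ∀ s, h (f s) = s
  map_c : h c = 0
  eq_self : ∀ t, r' ≤ t → h t = t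
  one_le_deriv : ∀ t, 1 ≤ deriv h t
  c_pos : 0 < c
  c_lt : c < r'
  lt_r : r' < r

/-- A smooth step lifts the line `t - (1 - ε)` to the line `t` while `t` runs from `1 - ε` to `1 -
ε/2`. The added term is monotone, so the slope never drops below `1`, and the inverse is smooth as
well. -/
theorem exists_isProfile_one {ε : ℝ} (h0 : 0 < ε) (h1 : ε < 1) :
    ∃ h f : ℝ → ℝ, IsProfile h f (1 - ε) (1 - ε / 2) 1 := by
  set S := Real.smoothTransition with hS
  set h : ℝ → ℝ := fun t => t - (1 - ε) * (1 - S ((t - (1 - ε)) / (ε / 2))) with hh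
  have smooth : ContDiff ℝ ∞ h := by
    refine contDiff_id.sub (contDiff_const.mul (contDiff_const.sub ?_))
    exact Real.smoothTransition.contDiff.comp ((contDiff_id.sub contDiff_const).div_const _)
  have hmono : Monotone fun t => -((1 - ε) * (1 - S ((t - (1 - ε)) / (ε / 2)))) := by
    intro a b hab
    have : S ((a - (1 - ε)) / (ε / 2)) ≤ S ((b - (1 - ε)) / (ε / 2)) := by
      apply Real.smoothTransition.monotone; gcongr
    have h2 : 0 < 1 - ε := by linarith
    simp only [neg_le_neg_iff]
    gcongr
  have one_le : ∀ t, 1 ≤ deriv h t := by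
    intro t
    have hd : DifferentiableAt ℝ (fun t => -((1 - ε) * (1 - S ((t - (1 - ε)) / (ε / 2))))) t := by
      have : (fun t => -((1 - ε) * (1 - S ((t - (1 - ε)) / (ε / 2))))) = fun t => h t - t := by
        funext t; simp only [hh]; ring
      rw [this]
      exact (smooth.differentiable (by simp)).differentiableAt.sub differentiableAt_id
    have e : h = fun t => t + -((1 - ε) * (1 - S ((t - (1 - ε)) / (ε / 2)))) := by
      funext t; simp only [hh]; ring
    have := hmono.deriv_nonneg (x := t)
    have h3 := (hasDerivAt_id t).add hd.hasDerivAt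
    have h4 : deriv h t = 1 + deriv (fun t => -((1 - ε) * (1 - S ((t - (1 - ε)) / (ε / 2))))) t := by
      rw [e]; exact h3.deriv
    rw [h4]
    simpa using this
  have hsm : StrictMono h := strictMono_of_deriv_pos fun t => by linarith [one_le t]
  have hlow : ∀ t, t - 1 ≤ h t := fun t => by
    have : 0 ≤ S ((t - (1 - ε)) / (ε / 2)) := Real.smoothTransition.nonneg _
    simp only [hh]; nlinarith
  have hup : ∀ t, h t ≤ t := fun t => by
    have : S ((t - (1 - ε)) / (ε / 2)) ≤ 1 := Real.smoothTransition.le_one _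
    simp only [hh]; nlinarith
  have hsurj : Function.Surjective h := smooth.continuous.surjective
    (Filter.tendsto_atTop_mono hlow (Filter.tendsto_atTop_add_const_right _ _ Filter.tendsto_id))
    (Filter.tendsto_atBot_mono hup Filter.tendsto_id)
  set e : ℝ ≃ₜ ℝ := (hsm.orderIsoOfSurjective h hsurj).toHomeomorph with he
  have heh : ∀ t, e t = h t := fun t => rfl
  refine ⟨h, e.symm, smooth, ?_, fun t => ?_, fun s => ?_, ?_, fun t ht => ?_, one_le, by linarith,
    by linarith, by linarith⟩
  · refine e.contDiff_symm_deriv (f' := deriv h) (fun t => by have := one_le t; positivity) (fun t => ?_) smooth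
    exact (smooth.differentiable (by simp)).differentiableAt.hasDerivAt
  · rw [← heh, e.symm_apply_apply]
  · rw [← heh, e.apply_symm_apply]
  · simp [hh, hS]
  · have : S ((t - (1 - ε)) / (ε / 2)) = 1 := by
      refine Real.smoothTransition.one_of_one_le ?_
      rw [le_div_iff₀ (by positivity)]; linarith
    simp [hh, this]

/-- Dilation lets a single unit profile serve for every radius while the radius is integrated. -/
theorem IsProfile.scale {h f : ℝ → ℝ} {c r' r R : ℝ} (p : IsProfile h f c r' r) (hR : 0 < R) :
    IsProfile (fun t => R * h (t / R)) (fun s => R * f (s / R)) (R * c) (R * r') (R * r) where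
  smooth := contDiff_const.mul (p.smooth.comp (contDiff_id.div_const _))
  smooth_inv := contDiff_const.mul (p.smooth_inv.comp (contDiff_id.div_const _))
  left_inv t := by rw [mul_div_cancel_left₀ _ hR.ne', p.left_inv]; field_simp
  right_inv t := by rw [mul_div_cancel_left₀ _ hR.ne', p.right_inv]; field_simp
  map_c := by rw [mul_div_cancel_left₀ _ hR.ne', p.map_c, mul_zero]
  eq_self t ht := by
    rw [p.eq_self _ (by rw [le_div_iff₀ hR]; linarith)]; field_simp
  one_le_deriv t := by
    have h1 : HasDerivAt (fun t => t / R) (1 / R) t := (hasDerivAt_id t).div_const R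
    have h2 : HasDerivAt h (deriv h (t / R)) (t / R) :=
      (p.smooth.differentiable (by simp)).differentiableAt.hasDerivAt
    have h3 := (h2.comp t h1).const_mul R
    have : deriv (fun t => R * h (t / R)) t = R * (deriv h (t / R) * (1 / R)) := h3.deriv
    rw [this]
    have := p.one_le_deriv (t / R)
    field_simp
    exact this
  c_pos := mul_pos hR p.c_pos
  c_lt := mul_lt_mul_of_pos_left p.c_lt hR
  lt_r := mul_lt_mul_of_pos_left p.lt_r hR

theorem deriv_scale {h : ℝ → ℝ} (hh : Differentiable ℝ h) {R : ℝ} (hR : R ≠ 0) (t : ℝ) :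
    deriv (fun t => R * h (t / R)) t = deriv h (t / R) := by
  have h1 : HasDerivAt (fun t => t / R) (1 / R) t := (hasDerivAt_id t).div_const R
  have h3 := ((hh (t / R)).hasDerivAt.comp t h1).const_mul R
  have : deriv (fun t => R * h (t / R)) t = R * (deriv h (t / R) * (1 / R)) := h3.deriv
  rw [this]; field_simp

namespace IsProfile

variable {h f : ℝ → ℝ} {c r' r : ℝ}

theorem hasDerivAt (p : IsProfile h f c r' r) (t : ℝ) : HasDerivAt h (deriv h t) t :=
  (p.smooth.differentiable (by simp)).differentiableAt.hasDerivAt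

theorem hasDerivAt_inv (p : IsProfile h f c r' r) (t : ℝ) : HasDerivAt f (deriv f t) t :=
  (p.smooth_inv.differentiable (by simp)).differentiableAt.hasDerivAt

theorem deriv_pos (p : IsProfile h f c r' r) (t : ℝ) : 0 < deriv h t :=
  zero_lt_one.trans_le (p.one_le_deriv t)

theorem strictMono (p : IsProfile h f c r' r) : StrictMono h :=
  strictMono_of_deriv_pos p.deriv_pos

theorem deriv_inv_mul (p : IsProfile h f c r' r) (t : ℝ) : deriv f (h t) * deriv h t = 1 := by
  have h1 := (p.hasDerivAt_inv (h t)).comp t (p.hasDerivAt t)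
  have h2 : HasDerivAt (f ∘ h) 1 t := by
    have : f ∘ h = id := funext p.left_inv
    rw [this]; exact hasDerivAt_id t
  exact h1.unique h2

theorem strictMono_inv (p : IsProfile h f c r' r) : StrictMono f := fun a b hab => by
  rw [← p.strictMono.lt_iff_lt, p.right_inv, p.right_inv]; exact hab

theorem inv_zero (p : IsProfile h f c r' r) : f 0 = c := by rw [← p.map_c, p.left_inv]

theorem pos (p : IsProfile h f c r' r) {t : ℝ} (ht : c < t) : 0 < h t := by
  rw [← p.map_c]; exact p.strictMono ht

theorem map_r (p : IsProfile h f c r' r) : h r = r := p.eq_self r p.lt_r.le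

theorem lt_of_lt (p : IsProfile h f c r' r) {t : ℝ} (ht : t < r) : h t < r := by
  conv_rhs => rw [← p.map_r]
  exact p.strictMono ht

theorem inv_eq_self (p : IsProfile h f c r' r) {s : ℝ} (hs : r' ≤ s) : f s = s := by
  conv_lhs => rw [← p.eq_self s hs]
  exact p.left_inv s

theorem c_lt_inv (p : IsProfile h f c r' r) {s : ℝ} (hs : 0 < s) : c < f s := by
  rw [← p.inv_zero]; exact p.strictMono_inv hs

theorem inv_lt_r (p : IsProfile h f c r' r) {s : ℝ} (hs : s < r) : f s < r := by
  conv_rhs => rw [← p.inv_eq_self p.lt_r.le]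
  exact p.strictMono_inv hs

end IsProfile

section RadialMap

variable {n : ℕ}

/-- The radial map with profile `q` and centre `y`. -/
def radialMap (q : ℝ → ℝ) (y x : Euc n) : Euc n := y + (q ‖x - y‖ / ‖x - y‖) • (x - y)

theorem norm_radialMap_sub {q : ℝ → ℝ} {y x : Euc n} (hx : x ≠ y) (hq : 0 ≤ q ‖x - y‖) :
    ‖radialMap q y x - y‖ = q ‖x - y‖ := by
  have h0 : 0 < ‖x - y‖ := norm_pos_iff.2 (sub_ne_zero.2 hx)
  rw [radialMap, add_sub_cancel_left, norm_smul, norm_div, norm_norm, Real.norm_of_nonneg hq,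
    div_mul_cancel₀ _ h0.ne']

theorem radialMap_radialMap {q p : ℝ → ℝ} {y x : Euc n} (hx : x ≠ y) (hq : 0 < q ‖x - y‖)
    (h : p (q ‖x - y‖) = ‖x - y‖) : radialMap p y (radialMap q y x) = x := by
  have h0 : 0 < ‖x - y‖ := norm_pos_iff.2 (sub_ne_zero.2 hx)
  rw [radialMap, norm_radialMap_sub hx hq.le, h, radialMap, add_sub_cancel_left, smul_smul,
    div_mul_div_cancel₀ hq.ne', div_self h0.ne', one_smul, add_sub_cancel]

theorem contDiffOn_comp_norm_sub {q : ℝ → ℝ} (hq : ContDiff ℝ ∞ q) (y : Euc n) :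
    ContDiffOn ℝ ∞ (fun x => q ‖x - y‖) {y}ᶜ := by
  refine hq.comp_contDiffOn ?_
  exact (contDiffOn_id.sub contDiffOn_const).norm ℝ fun x hx => sub_ne_zero.2 hx

theorem contDiffOn_norm_sub (y : Euc n) : ContDiffOn ℝ ∞ (fun x => ‖x - y‖) {y}ᶜ :=
  contDiffOn_comp_norm_sub (q := fun t => t) contDiff_id y

theorem contDiffOn_radialMap {q : ℝ → ℝ} (hq : ContDiff ℝ ∞ q) (y : Euc n) :
    ContDiffOn ℝ ∞ (radialMap q y) {y}ᶜ := by
  refine contDiffOn_const.add (((contDiffOn_comp_norm_sub hq y).div (contDiffOn_norm_sub y) ?_).smul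
    (contDiffOn_id.sub contDiffOn_const))
  exact fun x hx => norm_ne_zero_iff.2 (sub_ne_zero.2 hx)

theorem HasDerivAt.comp_norm_sub {q : ℝ → ℝ} {q' : ℝ} {y x : Euc n} (hx : x ≠ y)
    (hq : HasDerivAt q q' ‖x - y‖) :
    HasFDerivAt (fun x => q ‖x - y‖) ((q' / ‖x - y‖) • innerSL ℝ (x - y)) x := by
  have h0 : ‖x - y‖ ≠ 0 := norm_ne_zero_iff.2 (sub_ne_zero.2 hx)
  have h1 : HasFDerivAt (fun x : Euc n => ‖x - y‖ ^ 2) (2 • innerSL ℝ (x - y)) x := by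
    simpa using ((hasFDerivAt_id x).sub_const y).norm_sq
  have h2 := h1.sqrt (pow_ne_zero 2 h0)
  simp only [Real.sqrt_sq (norm_nonneg _)] at h2
  have h3 := hq.comp_hasFDerivAt x h2
  refine h3.congr_fderiv ?_
  ext v
  simp
  field_simp

theorem partialD_comp_norm_sub {q : ℝ → ℝ} {q' : ℝ} {y x : Euc n} (hx : x ≠ y)
    (hq : HasDerivAt q q' ‖x - y‖) (i : Fin n) :
    partialD i (fun x => q ‖x - y‖) x = q' / ‖x - y‖ * (x i - y i) := by
  rw [partialD, (hq.comp_norm_sub hx).fderiv]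
  simp [EuclideanSpace.inner_single_right]

/-- The isotropic coefficient of the differential of the radial map. -/
def radialA (q : ℝ → ℝ) (s : ℝ) : ℝ := q s / s

/-- The rank-one coefficient of the differential of the radial map. -/
def radialB (q : ℝ → ℝ) (s : ℝ) : ℝ := deriv q s / s ^ 2 - q s / s ^ 3

/-- The rank-one coefficient of the second differential of the radial map. -/
def radialC (q : ℝ → ℝ) (s : ℝ) : ℝ :=
  deriv (deriv q) s / s ^ 3 - 3 * (deriv q s / s ^ 4) + 3 * (q s / s ^ 5)

theorem hasDerivAt_radialA {q : ℝ → ℝ} (hq : ContDiff ℝ ∞ q) {s : ℝ} (hs : s ≠ 0) :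
    HasDerivAt (radialA q) (radialB q s * s) s := by
  have h1 := ((hq.differentiable (by simp)).differentiableAt (x := s)).hasDerivAt
  refine (h1.fun_div (hasDerivAt_id s) hs).congr_deriv ?_
  simp only [radialB, id]
  field_simp

theorem hasDerivAt_radialB {q : ℝ → ℝ} (hq : ContDiff ℝ ∞ q) {s : ℝ} (hs : s ≠ 0) :
    HasDerivAt (radialB q) (radialC q s * s) s := by
  have h1 := ((hq.differentiable (by simp)).differentiableAt (x := s)).hasDerivAt
  have h2 : HasDerivAt (deriv q) (deriv (deriv q) s) s := by
    have : ContDiff ℝ 1 (deriv q) := (contDiff_succ_iff_deriv (n := 1) |>.1 (hq.of_le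
      (by norm_cast))).2.2
    exact ((this.differentiable (by simp)).differentiableAt (x := s)).hasDerivAt
  refine ((h2.fun_div ((hasDerivAt_id s).fun_pow 2) (pow_ne_zero 2 hs)).fun_sub
    (h1.fun_div ((hasDerivAt_id s).fun_pow 3) (pow_ne_zero 3 hs))).congr_deriv ?_
  simp only [radialC, id]
  field_simp
  norm_num
  ring

theorem hasFDerivAt_radialMap {q : ℝ → ℝ} (hq : ContDiff ℝ ∞ q) {y x : Euc n} (hx : x ≠ y) :
    HasFDerivAt (radialMap q y) (radialA q ‖x - y‖ • ContinuousLinearMap.id ℝ (Euc n) +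
      radialB q ‖x - y‖ • (innerSL ℝ (x - y)).smulRight (x - y)) x := by
  have h0 : ‖x - y‖ ≠ 0 := norm_ne_zero_iff.2 (sub_ne_zero.2 hx)
  have h1 := (hasDerivAt_radialA hq h0).comp_norm_sub hx
  have h2 := (h1.smul ((hasFDerivAt_id x).sub_const y)).const_add y
  refine h2.congr_fderiv ?_
  ext v k
  simp
  field_simp

/-- The Jacobian matrix `∂ⱼφₖ` of the radial map. -/
def radialJac (q : ℝ → ℝ) (y : Euc n) (j k : Fin n) (x : Euc n) : ℝ :=
  (if j = k then radialA q ‖x - y‖ else 0) + radialB q ‖x - y‖ * ((x j - y j) * (x k - y k))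

/-- The second derivatives `∂ᵢ∂ⱼφₖ` of the radial map. -/
def radialHess (q : ℝ → ℝ) (y : Euc n) (i j k : Fin n) (x : Euc n) : ℝ :=
  radialB q ‖x - y‖ * ((if j = k then x i - y i else 0) + (if i = j then x k - y k else 0) +
    (if i = k then x j - y j else 0)) +
  radialC q ‖x - y‖ * ((x i - y i) * (x j - y j) * (x k - y k))

theorem radialHess_symm (q : ℝ → ℝ) (y : Euc n) (i j k : Fin n) (x : Euc n) :
    radialHess q y i j k x = radialHess q y j i k x := by
  simp only [radialHess, eq_comm (a := i) (b := j)]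
  ring

theorem fderiv_radialMap_apply {q : ℝ → ℝ} (hq : ContDiff ℝ ∞ q) {y x : Euc n} (hx : x ≠ y)
    (j k : Fin n) : fderiv ℝ (radialMap q y) x (EuclideanSpace.single j 1) k =
      radialJac q y j k x := by
  rw [(hasFDerivAt_radialMap hq hx).fderiv, radialJac]
  simp [EuclideanSpace.inner_single_right, eq_comm]

theorem contDiffOn_radialJac {q : ℝ → ℝ} (hq : ContDiff ℝ ∞ q) (y : Euc n) (j k : Fin n) :
    ContDiffOn ℝ ∞ (radialJac q y j k) {y}ᶜ := by
  have h1 : ContDiffOn ℝ ∞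
      (fun x => fderiv ℝ (radialMap q y) x (EuclideanSpace.single j 1)) {y}ᶜ :=
    ((contDiffOn_radialMap hq y).fderiv_of_isOpen isOpen_compl_singleton (m := ∞)
      (by simp)).clm_apply contDiffOn_const
  refine ((EuclideanSpace.proj k : Euc n →L[ℝ] ℝ).contDiff.comp_contDiffOn h1).congr fun x hx => ?_
  exact (fderiv_radialMap_apply hq hx j k).symm

theorem hasFDerivAt_coord_sub (y x : Euc n) (k : Fin n) :
    HasFDerivAt (fun x : Euc n => x k - y k) (EuclideanSpace.proj k : Euc n →L[ℝ] ℝ) x :=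
  (EuclideanSpace.proj k : Euc n →L[ℝ] ℝ).hasFDerivAt.sub_const _

theorem partialD_radialJac {q : ℝ → ℝ} (hq : ContDiff ℝ ∞ q) {y x : Euc n} (hx : x ≠ y)
    (i j k : Fin n) : partialD i (radialJac q y j k) x = radialHess q y i j k x := by
  have h0 : ‖x - y‖ ≠ 0 := norm_ne_zero_iff.2 (sub_ne_zero.2 hx)
  have hA := (hasDerivAt_radialA hq h0).comp_norm_sub hx
  have hB := (hasDerivAt_radialB hq h0).comp_norm_sub hx
  have hX := (hasFDerivAt_coord_sub y x j).fun_mul (hasFDerivAt_coord_sub y x k)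
  have hBX := hB.fun_mul hX
  by_cases hjk : j = k
  · have e : radialJac q y j k = fun x => radialA q ‖x - y‖ +
        radialB q ‖x - y‖ * ((x j - y j) * (x k - y k)) := by
      funext x; simp [radialJac, hjk]
    rw [partialD, e, (hA.fun_add hBX).fderiv, radialHess]
    simp [EuclideanSpace.inner_single_right, hjk]
    simp only [eq_comm (a := i), mul_div_cancel_right₀ _ h0]
    split_ifs <;> ring
  · have e : radialJac q y j k = fun x =>
        radialB q ‖x - y‖ * ((x j - y j) * (x k - y k)) := by
      funext x; simp [radialJac, hjk]
    rw [partialD, e, hBX.fderiv, radialHess]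
    simp [EuclideanSpace.inner_single_right, hjk]
    simp only [eq_comm (a := i), mul_div_cancel_right₀ _ h0]
    split_ifs <;> ring

/-- The matrix is `a` times a rank-one perturbation of the identity, so the matrix determinant lemma
applies. -/
theorem det_radialMap {a b : ℝ} (ha : a ≠ 0) (hn : 1 ≤ n) (X : Euc n) :
    (a • ContinuousLinearMap.id ℝ (Euc n) + b • (innerSL ℝ X).smulRight X).det =
      a ^ (n - 1) * (a + b * ‖X‖ ^ 2) := by
  have hM : LinearMap.toMatrix (EuclideanSpace.basisFun (Fin n) ℝ).toBasis
      (EuclideanSpace.basisFun (Fin n) ℝ).toBasis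
      ((a • ContinuousLinearMap.id ℝ (Euc n) + b • (innerSL ℝ X).smulRight X : Euc n →L[ℝ] Euc n) :
        Euc n →ₗ[ℝ] Euc n) =
      a • (1 + Matrix.replicateCol (Unit) (fun k => b / a * X k) *
        Matrix.replicateRow (Unit) (fun k => X k)) := by
    ext k j
    simp [LinearMap.toMatrix_apply, Matrix.mul_apply, Matrix.one_apply,
      EuclideanSpace.inner_single_right]
    field_simp
    split_ifs <;> simp
  rw [ContinuousLinearMap.det, ← LinearMap.det_toMatrix (EuclideanSpace.basisFun (Fin n) ℝ).toBasis,
    hM, Matrix.det_smul, Matrix.det_one_add_replicateCol_mul_replicateRow]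
  have hX : (fun k => X k) ⬝ᵥ (fun k => b / a * X k) = b / a * ‖X‖ ^ 2 := by
    rw [EuclideanSpace.real_norm_sq_eq, dotProduct, Finset.mul_sum]
    exact Finset.sum_congr rfl fun k _ => by ring
  rw [hX, Fintype.card_fin]
  have : a ^ n = a ^ (n - 1) * a := by rw [← pow_succ]; congr 1; omega
  rw [this]; field_simp

end RadialMap

/-! ### The radial diffeomorphism between annulus and punctured ball. -/

section RadialDiffeo

variable {n : ℕ} {h f : ℝ → ℝ} {c r' r : ℝ}

/-- The open annulus `c < |x - y| < r`. -/
def openAnnulus (y : Euc n) (c r : ℝ) : Set (Euc n) := ball y r \ closedBall y c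

theorem mem_openAnnulus {y z : Euc n} : z ∈ openAnnulus y c r ↔ c < ‖z - y‖ ∧ ‖z - y‖ < r := by
  rw [openAnnulus, Set.mem_sdiff, mem_ball, mem_closedBall, dist_eq_norm, not_le, and_comm]

theorem isOpen_openAnnulus (y : Euc n) : IsOpen (openAnnulus y c r) :=
  isOpen_ball.sdiff isClosed_closedBall

theorem mem_punctured {y x : Euc n} : x ∈ ball y r \ {y} ↔ 0 < ‖x - y‖ ∧ ‖x - y‖ < r := by
  rw [Set.mem_sdiff, mem_ball, dist_eq_norm, Set.mem_singleton_iff, norm_pos_iff, sub_ne_zero,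
    and_comm, Ne]

theorem isOpen_punctured (y : Euc n) : IsOpen (ball y r \ {y}) :=
  isOpen_ball.sdiff isClosed_singleton

theorem ne_of_mem_openAnnulus (hc : 0 < c) {y z : Euc n} (hz : z ∈ openAnnulus y c r) : z ≠ y := by
  have := hc.trans (mem_openAnnulus.1 hz).1
  exact sub_ne_zero.1 (norm_pos_iff.1 this)

theorem restrict_punctured [Nonempty (Fin n)] (y : Euc n) :
    volume.restrict (ball y r \ {y}) = volume.restrict (ball y r) :=
  Measure.restrict_congr_set (sdiff_null_ae_eq_self (measure_singleton y))

namespace IsProfile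

theorem mapsTo_inv (p : IsProfile h f c r' r) (y : Euc n) :
    Set.MapsTo (radialMap f y) (ball y r \ {y}) (openAnnulus y c r) := by
  intro x hx
  obtain ⟨h1, h2⟩ := mem_punctured.1 hx
  have h3 := p.c_lt_inv h1
  rw [mem_openAnnulus, norm_radialMap_sub hx.2 (p.c_pos.trans h3).le]
  exact ⟨h3, p.inv_lt_r h2⟩

theorem norm_map_sub (p : IsProfile h f c r' r) {y z : Euc n} (hz : z ∈ openAnnulus y c r) :
    ‖radialMap h y z - y‖ = h ‖z - y‖ :=
  norm_radialMap_sub (ne_of_mem_openAnnulus p.c_pos hz) (p.pos (mem_openAnnulus.1 hz).1).le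

theorem mapsTo (p : IsProfile h f c r' r) (y : Euc n) :
    Set.MapsTo (radialMap h y) (openAnnulus y c r) (ball y r \ {y}) := by
  intro z hz
  rw [mem_punctured, p.norm_map_sub hz]
  exact ⟨p.pos (mem_openAnnulus.1 hz).1, p.lt_of_lt (mem_openAnnulus.1 hz).2⟩

theorem radialMap_inv_map (p : IsProfile h f c r' r) {y z : Euc n} (hz : z ∈ openAnnulus y c r) :
    radialMap f y (radialMap h y z) = z :=
  radialMap_radialMap (ne_of_mem_openAnnulus p.c_pos hz) (p.pos (mem_openAnnulus.1 hz).1)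
    (p.left_inv _)

theorem radialMap_map_inv (p : IsProfile h f c r' r) {y x : Euc n} (hx : x ∈ ball y r \ {y}) :
    radialMap h y (radialMap f y x) = x :=
  radialMap_radialMap hx.2 (p.c_pos.trans (p.c_lt_inv (mem_punctured.1 hx).1)) (p.right_inv _)

end IsProfile

/-- The Jacobian determinant of the radial map with profile `h`. -/
def radialDet (n : ℕ) (h : ℝ → ℝ) (t : ℝ) : ℝ := (h t / t) ^ (n - 1) * deriv h t

theorem contDiffOn_radialDet (hh : ContDiff ℝ ∞ h) (y : Euc n) :
    ContDiffOn ℝ ∞ (fun z => radialDet n h ‖z - y‖) {y}ᶜ := by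
  have hd : ContDiff ℝ ∞ (deriv h) := (contDiff_infty_iff_deriv.1 hh).2
  exact (((contDiffOn_comp_norm_sub hh y).div (contDiffOn_norm_sub y)
    fun x hx => norm_ne_zero_iff.2 (sub_ne_zero.2 hx)).pow _).mul (contDiffOn_comp_norm_sub hd y)

theorem IsProfile.abs_det (p : IsProfile h f c r' r) (hn : 1 ≤ n) {y z : Euc n}
    (hz : z ∈ openAnnulus y c r) :
    |(fderiv ℝ (radialMap h y) z).det| = radialDet n h ‖z - y‖ := by
  have h1 := p.pos (mem_openAnnulus.1 hz).1
  have h2 := p.c_pos.trans (mem_openAnnulus.1 hz).1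
  have h3 := p.deriv_pos ‖z - y‖
  rw [(hasFDerivAt_radialMap p.smooth (ne_of_mem_openAnnulus p.c_pos hz)).fderiv,
    det_radialMap (show radialA h ‖z - y‖ ≠ 0 from (div_pos h1 h2).ne') hn]
  have : radialA h ‖z - y‖ + radialB h ‖z - y‖ * ‖z - y‖ ^ 2 = deriv h ‖z - y‖ := by
    simp only [radialA, radialB]; field_simp; ring
  rw [this]
  exact abs_of_pos (mul_pos (pow_pos (div_pos h1 h2) _) h3)

theorem IsProfile.radialDet_pos (p : IsProfile h f c r' r) {t : ℝ} (ht : c < t) :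
    0 < radialDet n h t :=
  mul_pos (pow_pos (div_pos (p.pos ht) (p.c_pos.trans ht)) _) (p.deriv_pos t)

theorem IsProfile.image_eq (p : IsProfile h f c r' r) (y : Euc n) :
    radialMap h y '' openAnnulus y c r = ball y r \ {y} :=
  Set.Subset.antisymm (Set.image_subset_iff.2 (p.mapsTo y))
    fun x hx => ⟨radialMap f y x, p.mapsTo_inv y hx, p.radialMap_map_inv hx⟩

theorem IsProfile.injOn (p : IsProfile h f c r' r) (y : Euc n) :
    Set.InjOn (radialMap h y) (openAnnulus y c r) := fun z hz z' hz' e => by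
  rw [← p.radialMap_inv_map hz, ← p.radialMap_inv_map hz', e]

theorem IsProfile.hasFDerivWithinAt (p : IsProfile h f c r' r) {y z : Euc n}
    (hz : z ∈ openAnnulus y c r) : HasFDerivWithinAt (radialMap h y) (fderiv ℝ (radialMap h y) z)
      (openAnnulus y c r) z :=
  (hasFDerivAt_radialMap p.smooth
    (ne_of_mem_openAnnulus p.c_pos hz)).differentiableAt.hasFDerivAt.hasFDerivWithinAt

theorem IsProfile.lintegral_eq (p : IsProfile h f c r' r) (hn : 1 ≤ n) (y : Euc n)
    (g : Euc n → ENNReal) : ∫⁻ x in ball y r \ {y}, g x =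
      ∫⁻ z in openAnnulus y c r, ENNReal.ofReal (radialDet n h ‖z - y‖) * g (radialMap h y z) := by
  rw [← p.image_eq y, lintegral_image_eq_lintegral_abs_det_fderiv_mul volume
    (isOpen_openAnnulus y).measurableSet (fun z hz => p.hasFDerivWithinAt hz) (p.injOn y)]
  exact setLIntegral_congr_fun (isOpen_openAnnulus y).measurableSet fun z hz => by
    simp only [p.abs_det hn hz]

theorem IsProfile.integral_eq (p : IsProfile h f c r' r) (hn : 1 ≤ n) (y : Euc n)
    (g : Euc n → ℝ) : ∫ x in ball y r \ {y}, g x =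
      ∫ z in openAnnulus y c r, radialDet n h ‖z - y‖ * g (radialMap h y z) := by
  rw [← p.image_eq y, integral_image_eq_integral_abs_det_fderiv_smul volume
    (isOpen_openAnnulus y).measurableSet (fun z hz => p.hasFDerivWithinAt hz) (p.injOn y)]
  exact setIntegral_congr_fun (isOpen_openAnnulus y).measurableSet fun z hz => by
    simp only [p.abs_det hn hz, smul_eq_mul]

theorem measurable_radialMap {q : ℝ → ℝ} (hq : Continuous q) (y : Euc n) :
    Measurable (radialMap q y) := by
  have : Measurable q := hq.measurable
  unfold radialMap
  fun_prop

/-- By the change of variables the preimage of a null set is null. This makes composition with the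
radial map compatible with conditions that hold only almost everywhere. -/
theorem IsProfile.quasiMeasurePreserving (p : IsProfile h f c r' r) (hn : 1 ≤ n) (y : Euc n) :
    Measure.QuasiMeasurePreserving (radialMap f y) (volume.restrict (ball y r \ {y}))
      (volume.restrict (openAnnulus y c r)) := by
  have hm := measurable_radialMap p.smooth_inv.continuous y
  refine ⟨hm, Measure.AbsolutelyContinuous.mk fun s hs h0 => ?_⟩
  rw [Measure.map_apply hm hs, ← lintegral_indicator_one (hm hs), p.lintegral_eq hn]
  rw [lintegral_eq_zero_iff' ?_]
  · have h0' : ∀ᵐ z ∂(volume.restrict (openAnnulus y c r)), z ∉ s := measure_eq_zero_iff_ae_notMem.1 h0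
    filter_upwards [h0', ae_restrict_mem (isOpen_openAnnulus y).measurableSet] with z hz hzV
    rw [Set.indicator_of_notMem]
    · simp
    · rwa [Set.mem_preimage, p.radialMap_inv_map hzV]
  · have h1 : Measurable (radialMap h y) := measurable_radialMap p.smooth.continuous y
    refine AEMeasurable.mul ?_ ((measurable_one.indicator (hm hs)).comp h1).aemeasurable
    have h2 : ContinuousOn (fun z => radialDet n h ‖z - y‖) (openAnnulus y c r) :=
      (contDiffOn_radialDet p.smooth y).continuousOn.mono
        fun z hz => ne_of_mem_openAnnulus p.c_pos hz
    exact (h2.aemeasurable (isOpen_openAnnulus y).measurableSet).ennreal_ofReal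

/-- Composition with the radial map preserves `Lᵖ`, even after multiplication by a function with a
mild singularity at the centre. -/
theorem IsProfile.memLp_smul_comp (p : IsProfile h f c r' r) (hn : 1 ≤ n) (y : Euc n)
    {q k : ℕ} (hq : q ≠ 0) (hk : k * q ≤ n - 1) {u : Euc n → ℂ}
    (hu : MemLp u q (volume.restrict (openAnnulus y c r))) {s : Euc n → ℝ}
    (hs : ContinuousOn s {y}ᶜ) {C : ℝ}
    (hsC : ∀ x, 0 < ‖x - y‖ → ‖x - y‖ < r → |s x| ≤ C / ‖x - y‖ ^ k) :
    MemLp (fun x => s x • u (radialMap f y x)) q (volume.restrict (ball y r \ {y})) := by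
  have hr : 0 < r := p.c_pos.trans (p.c_lt.trans p.lt_r)
  obtain ⟨H, hH⟩ := (isCompact_Icc (a := c) (b := r)).exists_bound_of_continuousOn
    ((contDiff_infty_iff_deriv.1 p.smooth).2.continuous.continuousOn)
  have hH0 : 0 ≤ H := (norm_nonneg _).trans (hH c ⟨le_rfl, (p.c_lt.trans p.lt_r).le⟩)
  have hq' : (q : ENNReal) ≠ 0 := by exact_mod_cast hq
  have hqt : (q : ENNReal) ≠ ⊤ := ENNReal.natCast_ne_top q
  have hmU : MeasurableSet (ball y r \ {y}) := (isOpen_punctured y).measurableSet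
  refine ⟨AEStronglyMeasurable.fun_smul ?_ (hu.1.comp_quasiMeasurePreserving
    (p.quasiMeasurePreserving hn y)), ?_⟩
  · exact (hs.mono fun x hx => hx.2).aestronglyMeasurable hmU
  rw [eLpNorm_lt_top_iff_lintegral_rpow_enorm_lt_top hq' hqt, p.lintegral_eq hn]
  have hu' := (eLpNorm_lt_top_iff_lintegral_rpow_enorm_lt_top hq' hqt).1 hu.2
  -- A bound for Jacobian times `|s|^q` on the annulus: `H` bounds `h'`, the remaining power of `h`
  -- is at most that of `r`, and `‖z - y‖ ≥ c` in the denominator.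
  set K : ℝ := H * |C| ^ q * r ^ (n - 1 - k * q) / c ^ (n - 1) with hK
  have hKt : ENNReal.ofReal K < ⊤ := ENNReal.ofReal_lt_top
  refine lt_of_le_of_lt ?_ (ENNReal.mul_lt_top hKt hu')
  rw [← lintegral_const_mul' _ _ hKt.ne]
  refine setLIntegral_mono_ae' (isOpen_openAnnulus y).measurableSet
    (Filter.Eventually.of_forall fun z hz => ?_)
  have hzV := mem_openAnnulus.1 hz
  have ht0 : 0 < ‖z - y‖ := p.c_pos.trans hzV.1
  have hh0 := p.pos hzV.1
  have hhr := p.lt_of_lt hzV.2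
  simp only [ENNReal.toReal_natCast, ENNReal.rpow_natCast]
  rw [p.radialMap_inv_map hz, enorm_smul, mul_pow, ← mul_assoc]
  gcongr
  rw [Real.enorm_eq_ofReal_abs, ← ENNReal.ofReal_pow (abs_nonneg _),
    ← ENNReal.ofReal_mul (p.radialDet_pos hzV.1).le]
  apply ENNReal.ofReal_le_ofReal
  have hb := hsC (radialMap h y z) (by rw [p.norm_map_sub hz]; exact hh0)
    (by rw [p.norm_map_sub hz]; exact hhr)
  rw [p.norm_map_sub hz] at hb
  have hb2 : |s (radialMap h y z)| ^ q ≤ |C| ^ q / h ‖z - y‖ ^ (k * q) := by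
    rw [pow_mul, ← div_pow]
    refine pow_le_pow_left₀ (abs_nonneg _) (hb.trans ?_) q
    gcongr
    exact le_abs_self C
  have hH' : deriv h ‖z - y‖ ≤ H := (le_abs_self _).trans (hH _ ⟨hzV.1.le, hzV.2.le⟩)
  -- The determinant contains `h^(n-1)`, which absorbs the singularity `h^(-kq)` precisely because
  -- `kq ≤ n - 1`.
  have hpow : h ‖z - y‖ ^ (n - 1) = h ‖z - y‖ ^ (n - 1 - k * q) * h ‖z - y‖ ^ (k * q) := by
    rw [← pow_add]; congr 1; omega
  calc radialDet n h ‖z - y‖ * |s (radialMap h y z)| ^ q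
      ≤ ((h ‖z - y‖ / ‖z - y‖) ^ (n - 1) * H) * (|C| ^ q / h ‖z - y‖ ^ (k * q)) := by
        unfold radialDet
        have := p.deriv_pos ‖z - y‖
        gcongr
    _ = H * |C| ^ q * h ‖z - y‖ ^ (n - 1 - k * q) / ‖z - y‖ ^ (n - 1) := by
        rw [div_pow, hpow]; field_simp
    _ ≤ K := by
        rw [hK]
        have := p.c_pos
        gcongr
        exact hzV.1.le

theorem abs_coord_sub_le (y x : Euc n) (j : Fin n) : |x j - y j| ≤ ‖x - y‖ := by
  simpa using PiLp.norm_apply_le (x - y) j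

/-- The profile `q` need not vanish at `0`; for an inverse profile `q 0 = c > 0`, so the map really
is singular at the centre. Bounds for `q`, `q'`, `q''` on `[0, r]` turn into these rates, with a
constant that does not depend on the centre. -/
theorem exists_bound_radialJac_radialHess {q : ℝ → ℝ} (hq : ContDiff ℝ ∞ q) {r : ℝ} (hr : 0 < r) :
    ∃ C : ℝ, ∀ (n : ℕ) (y x : Euc n), 0 < ‖x - y‖ → ‖x - y‖ < r → ∀ i j k,
      |radialJac q y j k x| ≤ C / ‖x - y‖ ^ 1 ∧ |radialHess q y i j k x| ≤ C / ‖x - y‖ ^ 2 := by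
  have hd := (contDiff_infty_iff_deriv.1 hq).2
  have hdd := (contDiff_infty_iff_deriv.1 hd).2
  obtain ⟨F0, h0⟩ := (isCompact_Icc (a := 0) (b := r)).exists_bound_of_continuousOn
    hq.continuous.continuousOn
  obtain ⟨F1, h1⟩ := (isCompact_Icc (a := 0) (b := r)).exists_bound_of_continuousOn
    hd.continuous.continuousOn
  obtain ⟨F2, h2⟩ := (isCompact_Icc (a := 0) (b := r)).exists_bound_of_continuousOn
    hdd.continuous.continuousOn
  have mem0 : (0 : ℝ) ∈ Set.Icc 0 r := ⟨le_rfl, hr.le⟩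
  have F0n : 0 ≤ F0 := (norm_nonneg _).trans (h0 0 mem0)
  have F1n : 0 ≤ F1 := (norm_nonneg _).trans (h1 0 mem0)
  have F2n : 0 ≤ F2 := (norm_nonneg _).trans (h2 0 mem0)
  refine ⟨(2 * F0 + F1 * r) + (3 * (F1 * r + F0) + (F2 * r ^ 2 + 3 * (F1 * r) + 3 * F0)), ?_⟩
  intro n y x hs hsr i j k
  have hX := abs_coord_sub_le y x
  set s := ‖x - y‖ with hsdef
  have mem : s ∈ Set.Icc 0 r := ⟨hs.le, hsr.le⟩
  have g0 := h0 s mem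
  have g1 := h1 s mem
  have g2 := h2 s mem
  rw [Real.norm_eq_abs] at g0 g1 g2
  have bA : |radialA q s| ≤ F0 / s := by
    rw [radialA, abs_div, abs_of_pos hs]; gcongr
  have bB : |radialB q s| ≤ (F1 * r + F0) / s ^ 3 := by
    rw [radialB]
    have : deriv q s / s ^ 2 - q s / s ^ 3 = (deriv q s * s - q s) / s ^ 3 := by field_simp
    rw [this, abs_div, abs_of_pos (pow_pos hs 3)]
    gcongr
    refine (abs_sub _ _).trans ?_
    rw [abs_mul, abs_of_pos hs]
    gcongr
  have bC : |radialC q s| ≤ (F2 * r ^ 2 + 3 * (F1 * r) + 3 * F0) / s ^ 5 := by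
    rw [radialC]
    have : deriv (deriv q) s / s ^ 3 - 3 * (deriv q s / s ^ 4) + 3 * (q s / s ^ 5) =
        (deriv (deriv q) s * s ^ 2 - 3 * (deriv q s * s) + 3 * q s) / s ^ 5 := by field_simp
    rw [this, abs_div, abs_of_pos (pow_pos hs 5)]
    gcongr
    refine (abs_add_le _ _).trans (add_le_add ((abs_sub _ _).trans (add_le_add ?_ ?_)) ?_)
    · rw [abs_mul, abs_of_pos (pow_pos hs 2)]; gcongr
    · rw [abs_mul, abs_mul, abs_of_pos hs, abs_of_pos (three_pos : (0 : ℝ) < 3)]; gcongr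
    · rw [abs_mul, abs_of_pos (three_pos : (0 : ℝ) < 3)]; gcongr
  have hXX : ∀ j k, |(x j - y j) * (x k - y k)| ≤ s ^ 2 := fun j k => by
    rw [abs_mul, pow_two]; exact mul_le_mul (hX j) (hX k) (abs_nonneg _) hs.le
  have hXXX : |(x i - y i) * (x j - y j) * (x k - y k)| ≤ s ^ 3 := by
    rw [abs_mul, pow_succ]; exact mul_le_mul (hXX i j) (hX k) (abs_nonneg _) (by positivity)
  have ite_le : ∀ (P : Prop) [Decidable P] (a b : ℝ), |a| ≤ b → 0 ≤ b →
      |if P then a else 0| ≤ b := by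
    intro P _ a b h hb; split_ifs
    · exact h
    · simpa using hb
  have hF0s : 0 ≤ F0 / s := by positivity
  constructor
  · calc |radialJac q y j k x| ≤ F0 / s + (F1 * r + F0) / s ^ 3 * s ^ 2 := by
          unfold radialJac
          refine (abs_add_le _ _).trans (add_le_add (ite_le _ _ _ bA hF0s) ?_)
          rw [abs_mul]
          exact mul_le_mul bB (hXX j k) (abs_nonneg _) (by positivity)
      _ = (2 * F0 + F1 * r) / s ^ 1 := by field_simp; ring
      _ ≤ _ := by
          refine div_le_div_of_nonneg_right ?_ (by positivity)
          have : 0 ≤ 3 * (F1 * r + F0) + (F2 * r ^ 2 + 3 * (F1 * r) + 3 * F0) := by positivity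
          linarith
  · calc |radialHess q y i j k x| ≤ (F1 * r + F0) / s ^ 3 * (s + s + s) +
          (F2 * r ^ 2 + 3 * (F1 * r) + 3 * F0) / s ^ 5 * s ^ 3 := by
          unfold radialHess
          refine (abs_add_le _ _).trans (add_le_add ?_ ?_)
          · rw [abs_mul]
            refine mul_le_mul bB ?_ (abs_nonneg _) (by positivity)
            refine (abs_add_le _ _).trans (add_le_add ((abs_add_le _ _).trans (add_le_add ?_ ?_)) ?_)
            all_goals exact ite_le _ _ _ (hX _) hs.le
          · rw [abs_mul]
            exact mul_le_mul bC hXXX (abs_nonneg _) (by positivity)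
      _ = (3 * (F1 * r + F0) + (F2 * r ^ 2 + 3 * (F1 * r) + 3 * F0)) / s ^ 2 := by field_simp; ring
      _ ≤ _ := by
          refine div_le_div_of_nonneg_right ?_ (by positivity)
          have : 0 ≤ 2 * F0 + F1 * r := by positivity
          linarith

end RadialDiffeo

/-! ### The competitor: pull-back of a form and its energy. -/

section Competitor

variable {m : ℕ} {G : Subgroup (GL (Fin m) ℂ)} {n : ℕ} {Ω : Set (Euc n)}

theorem IsWeakPartial.congr {U : Set (Euc n)} (hU : MeasurableSet U) {i : Fin n}
    {u u' v v' : Euc n → ℂ} (h : IsWeakPartial U i u v) (hu : ∀ x ∈ U, u x = u' x)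
    (hv : ∀ x ∈ U, v x = v' x) : IsWeakPartial U i u' v' := by
  intro φ hφ hc hs
  have := h φ hφ hc hs
  rwa [setIntegral_congr_fun hU (f := fun x => partialD i φ x • u x)
      (g := fun x => partialD i φ x • u' x) (fun x hx => by simp only [hu x hx]),
    setIntegral_congr_fun hU (f := fun x => φ x • v x) (g := fun x => φ x • v' x)
      (fun x hx => by simp only [hv x hx])] at this

namespace SobolevForm

/-- The coefficients of the pull-back of `A` by the radial map with profile `f`. -/
def pullCoeff (A : SobolevForm G Ω) (f : ℝ → ℝ) (y x : Euc n) (j : Fin n) : CMat m :=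
  ∑ k, radialJac f y j k x • A.coeff (radialMap f y x) k

/-- The derivatives of the coefficients of the pull-back of `A` by the radial map. -/
def pullGrad (A : SobolevForm G Ω) (f : ℝ → ℝ) (y x : Euc n) (i j : Fin n) : CMat m :=
  ∑ k, (radialHess f y i j k x • A.coeff (radialMap f y x) k +
    radialJac f y j k x • ∑ l, radialJac f y i l x • A.grad (radialMap f y x) l k)

/-- Curvature commutes with pull-back: the terms with second derivatives of the map are symmetric in
`i, j` and drop out of the antisymmetrized gradient. -/
theorem pull_curv (A : SobolevForm G Ω) (f : ℝ → ℝ) (y x : Euc n) (i j : Fin n) :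
    A.pullGrad f y x i j - A.pullGrad f y x j i + (A.pullCoeff f y x i * A.pullCoeff f y x j -
      A.pullCoeff f y x j * A.pullCoeff f y x i) =
    ∑ k, ∑ l, (radialJac f y i l x * radialJac f y j k x) • A.curv (radialMap f y x) l k := by
  have g1 : A.pullGrad f y x i j = ∑ k, radialHess f y i j k x • A.coeff (radialMap f y x) k +
      ∑ k, ∑ l, (radialJac f y i l x * radialJac f y j k x) • A.grad (radialMap f y x) l k := by
    simp only [pullGrad, Finset.sum_add_distrib, Finset.smul_sum, smul_smul]
    congr 1
    exact Finset.sum_congr rfl fun k _ => Finset.sum_congr rfl fun l _ => by rw [mul_comm]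
  have g2 : A.pullGrad f y x j i = ∑ k, radialHess f y i j k x • A.coeff (radialMap f y x) k +
      ∑ k, ∑ l, (radialJac f y i l x * radialJac f y j k x) • A.grad (radialMap f y x) k l := by
    simp only [pullGrad, Finset.sum_add_distrib, Finset.smul_sum, smul_smul]
    congr 1
    · exact Finset.sum_congr rfl fun k _ => by rw [radialHess_symm]
    · rw [Finset.sum_comm]
  have g3 : A.pullCoeff f y x i * A.pullCoeff f y x j =
      ∑ k, ∑ l, (radialJac f y i l x * radialJac f y j k x) •
        (A.coeff (radialMap f y x) l * A.coeff (radialMap f y x) k) := by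
    simp only [pullCoeff, Finset.sum_mul, Finset.mul_sum, smul_mul_smul_comm]
  have g4 : A.pullCoeff f y x j * A.pullCoeff f y x i =
      ∑ k, ∑ l, (radialJac f y i l x * radialJac f y j k x) •
        (A.coeff (radialMap f y x) k * A.coeff (radialMap f y x) l) := by
    simp only [pullCoeff, Finset.sum_mul, Finset.mul_sum, smul_mul_smul_comm]
    rw [Finset.sum_comm]
    exact Finset.sum_congr rfl fun k _ => Finset.sum_congr rfl fun l _ => by rw [mul_comm]
  rw [g1, g2, g3, g4, add_sub_add_left_eq_sub, ← Finset.sum_sub_distrib, ← Finset.sum_sub_distrib,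
    ← Finset.sum_add_distrib]
  refine Finset.sum_congr rfl fun k _ => ?_
  rw [← Finset.sum_sub_distrib, ← Finset.sum_sub_distrib, ← Finset.sum_add_distrib]
  refine Finset.sum_congr rfl fun l _ => ?_
  rw [curv, ← smul_sub, ← smul_sub, ← smul_add]

variable {h f : ℝ → ℝ} {c r' r : ℝ}

theorem openAnnulus_subset {y : Euc n} (hr : ball y r ⊆ Ω) : openAnnulus y c r ⊆ Ω :=
  Set.sdiff_subset.trans hr

theorem measure_openAnnulus_lt_top (y : Euc n) : volume (openAnnulus y c r) < ⊤ :=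
  (measure_mono Set.sdiff_subset).trans_lt measure_ball_lt_top

/-- The pull-back of a form on the annulus to the ball by the radial map. -/
def pullback (A : SobolevForm G Ω) (p : IsProfile h f c r' r) (hn : 5 ≤ n) (y : Euc n)
    (hr : ball y r ⊆ Ω) : SobolevForm G (ball y r) :=
  have hn1 : 1 ≤ n := by omega
  have : Nonempty (Fin n) := ⟨⟨0, by omega⟩⟩
  have hres : volume.restrict (ball y r \ {y}) = volume.restrict (ball y r) := restrict_punctured y
  have hmono : volume.restrict (openAnnulus y c r) ≤ volume.restrict Ω :=
    Measure.restrict_mono (openAnnulus_subset hr) le_rfl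
  have hr0 : 0 < r := p.c_pos.trans (p.c_lt.trans p.lt_r)
  have hqmp := p.quasiMeasurePreserving hn1 y
  have hjac : ∀ j k, ContDiffOn ℝ ∞ (radialJac f y j k) {y}ᶜ :=
    contDiffOn_radialJac p.smooth_inv y
  have hhess : ∀ i j k, ContinuousOn (radialHess f y i j k) {y}ᶜ := fun i j k => by
    have h1 : ContDiffOn ℝ ∞ (partialD i (radialJac f y j k)) {y}ᶜ :=
      ((hjac j k).fderiv_of_isOpen isOpen_compl_singleton (m := ∞) (by simp)).clm_apply
        contDiffOn_const
    exact h1.continuousOn.congr fun x hx => (partialD_radialJac p.smooth_inv hx i j k).symm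
  have bd := exists_bound_radialJac_radialHess p.smooth_inv hr0
  have hc2 : ∀ k a b, MemLp (fun x => A.coeff x k a b) 2 (volume.restrict (openAnnulus y c r)) :=
    fun k a b => (A.memLp_two k a b).mono_measure hmono
  have hc4 : ∀ k a b, MemLp (fun x => A.coeff x k a b) 4 (volume.restrict (openAnnulus y c r)) :=
    fun k a b => (A.memLp_four k a b).mono_measure hmono
  have hg2 : ∀ l k a b, MemLp (fun x => A.grad x l k a b) 2
      (volume.restrict (openAnnulus y c r)) :=
    fun l k a b => (A.grad_memLp l k a b).mono_measure hmono
  have M2 : ∀ j a b, MemLp (fun x => A.pullCoeff f y x j a b) 2 (volume.restrict (ball y r)) := by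
    intro j a b
    obtain ⟨C, hC⟩ := bd
    simp only [pullCoeff, Matrix.sum_apply, Matrix.smul_apply]
    rw [← hres]
    exact memLp_finsetSum _ fun k _ => p.memLp_smul_comp hn1 y (q := 2) (k := 1) two_ne_zero
      (by omega) (hc2 k a b) (hjac j k).continuousOn fun x h1 h2 => (hC n y x h1 h2 j j k).1
  have M4 : ∀ j a b, MemLp (fun x => A.pullCoeff f y x j a b) 4 (volume.restrict (ball y r)) := by
    intro j a b
    obtain ⟨C, hC⟩ := bd
    simp only [pullCoeff, Matrix.sum_apply, Matrix.smul_apply]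
    rw [← hres]
    -- A singularity `|x-y|⁻¹` in `L⁴` needs `4 ≤ n - 1`, that is `n ≥ 5`.
    exact memLp_finsetSum _ fun k _ => p.memLp_smul_comp hn1 y (q := 4) (k := 1) four_ne_zero
      (by omega) (hc4 k a b) (hjac j k).continuousOn fun x h1 h2 => (hC n y x h1 h2 j j k).1
  have MG1 : ∀ i k a b, MemLp (fun x => ∑ l, radialJac f y i l x • A.grad (radialMap f y x) l k a b)
      2 (volume.restrict (ball y r \ {y})) := by
    intro i k a b
    obtain ⟨C, hC⟩ := bd
    exact memLp_finsetSum _ fun l _ => p.memLp_smul_comp hn1 y (q := 2) (k := 1) two_ne_zero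
      (by omega) (hg2 l k a b) (hjac i l).continuousOn fun x h1 h2 => (hC n y x h1 h2 i i l).1
  have MG : ∀ i j a b, MemLp (fun x => A.pullGrad f y x i j a b) 2 (volume.restrict (ball y r)) := by
    intro i j a b
    obtain ⟨C, hC⟩ := bd
    simp only [pullGrad, Matrix.sum_apply, Matrix.smul_apply, Matrix.add_apply, Finset.smul_sum,
      smul_smul]
    rw [← hres]
    refine memLp_finsetSum _ fun k _ => MemLp.add ?_ (memLp_finsetSum _ fun l _ => ?_)
    -- The Hessian, of size `|x-y|⁻²`, in `L²` leads to the same condition `4 ≤ n - 1`.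
    · exact p.memLp_smul_comp hn1 y (q := 2) (k := 2) two_ne_zero
        (by omega) (hc2 k a b) (hhess i j k) fun x h1 h2 => (hC n y x h1 h2 i j k).2
    · refine p.memLp_smul_comp hn1 y (q := 2) (k := 2) (C := C * C) two_ne_zero
        (by omega) (hg2 l k a b) ((hjac j k).mul (hjac i l)).continuousOn fun x h1 h2 => ?_
      rw [abs_mul]
      calc _ ≤ C / ‖x - y‖ ^ 1 * (C / ‖x - y‖ ^ 1) :=
            mul_le_mul (hC n y x h1 h2 i j k).1 (hC n y x h1 h2 j i l).1 (abs_nonneg _)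
              ((abs_nonneg _).trans (hC n y x h1 h2 i j k).1)
        _ = _ := by field_simp
  have fin1 : IsFiniteMeasure (volume.restrict (openAnnulus y c r)) :=
    ⟨by simpa using measure_openAnnulus_lt_top y⟩
  have fin2 : IsFiniteMeasure (volume.restrict (ball y r)) :=
    ⟨by simpa using measure_ball_lt_top⟩
  { coeff := A.pullCoeff f y
    grad := A.pullGrad f y
    coeff_mem := by
      rw [← hres]
      have h1 := hqmp.ae (ae_mono hmono A.coeff_mem)
      filter_upwards [h1] with x hx j
      exact (lieAlg G).sum_mem fun k _ => (lieAlg G).smul_mem _ (hx k)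
    grad_mem := by
      rw [← hres]
      have h1 := hqmp.ae (ae_mono hmono A.coeff_mem)
      have h2 := hqmp.ae (ae_mono hmono A.grad_mem)
      filter_upwards [h1, h2] with x hx hx2 i j
      exact (lieAlg G).sum_mem fun k _ => (lieAlg G).add_mem ((lieAlg G).smul_mem _ (hx k))
        ((lieAlg G).smul_mem _ ((lieAlg G).sum_mem fun l _ => (lieAlg G).smul_mem _ (hx2 l k)))
    memLp_two := M2
    memLp_four := M4
    grad_memLp := MG
    weak := by
      intro i j a b
      -- The radial map is smooth only off the centre, so the chain and product rules are applied on
      -- the punctured ball and the point is then filled in.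
      refine IsWeakPartial.of_punctured (y := y) (by omega) (M2 j a b)
        ((M2 j a b).integrable (by norm_num)) ((MG i j a b).integrable (by norm_num)) ?_
      have hsub : ball y r \ {y} ⊆ {y}ᶜ := fun x hx => hx.2
      have hsub2 : openAnnulus y c r ⊆ {y}ᶜ := fun z hz => ne_of_mem_openAnnulus p.c_pos hz
      have hweak : ∀ k, IsWeakPartial (ball y r \ {y}) i
          (fun x => A.coeff (radialMap f y x) k a b)
          (fun x => ∑ l, radialJac f y i l x • A.grad (radialMap f y x) l k a b) := by
        intro k
        have := IsWeakPartial.comp_diffeo (i := i) (isOpen_punctured y) (isOpen_openAnnulus y)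
          ((contDiffOn_radialMap p.smooth_inv y).mono hsub)
          ((contDiffOn_radialMap p.smooth y).mono hsub2)
          (p.mapsTo_inv y) (p.mapsTo y) (fun z hz => p.radialMap_inv_map hz)
          (fun x hx => p.radialMap_map_inv hx) ((contDiffOn_radialDet p.smooth y).mono hsub2)
          (fun z hz => p.abs_det hn1 hz) (u := fun x => A.coeff x k a b)
          (v := fun l x => A.grad x l k a b) ((hc2 k a b).integrable (by norm_num))
          (fun l => (hg2 l k a b).integrable (by norm_num))
          (fun l => (A.weak l k a b).mono (openAnnulus_subset hr))
        refine this.congr (isOpen_punctured y).measurableSet (fun x _ => rfl) fun x hx => ?_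
        exact Finset.sum_congr rfl fun l _ => by
          rw [fderiv_radialMap_apply p.smooth_inv (hsub hx)]
      have hcU : ∀ k, IntegrableOn (fun x => A.coeff (radialMap f y x) k a b)
          (ball y r \ {y}) := by
        intro k
        have := p.memLp_smul_comp hn1 y (q := 2) (k := 0) two_ne_zero (by omega) (hc2 k a b)
          (s := fun _ => 1) continuousOn_const (C := 1) (fun x _ _ => by simp)
        simp only [one_smul, hres] at this
        rw [IntegrableOn, hres]
        exact MemLp.integrable (q := 2) (by norm_num) this
      have := IsWeakPartial.sum_smul (i := i) (isOpen_punctured y)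
        (s := fun k => radialJac f y j k) (fun k => (hjac j k).mono hsub) hcU
        (fun k => by
          have := MG1 i k a b
          rw [hres] at this
          rw [IntegrableOn, hres]
          exact this.integrable (by norm_num)) hweak
      refine this.congr (isOpen_punctured y).measurableSet (fun x _ => ?_) fun x hx => ?_
      · simp [pullCoeff, Matrix.sum_apply]
      · simp only [pullGrad, Matrix.sum_apply, Matrix.add_apply, Matrix.smul_apply]
        exact Finset.sum_congr rfl fun k _ => by
          rw [partialD_radialJac p.smooth_inv (hsub hx)] }

/-- Beyond `r'` the inverse profile is the identity on an open set, so its first derivative is `1`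
and its second is `0` there. The gradients must agree too, since the trace is defined through both.
-/
theorem pullback_eq (A : SobolevForm G Ω) (p : IsProfile h f c r' r) (hn : 5 ≤ n) (y : Euc n)
    (hr : ball y r ⊆ Ω) {x : Euc n} (hx : r' < ‖x - y‖) :
    (A.pullback p hn y hr).coeff x = A.coeff x ∧ (A.pullback p hn y hr).grad x = A.grad x := by
  have hr'0 : 0 < r' := p.c_pos.trans p.c_lt
  have hs0 : ‖x - y‖ ≠ 0 := (hr'0.trans hx).ne'
  have hev : ∀ s, r' < s → f =ᶠ[nhds s] id := fun s hs => by
    filter_upwards [Ioi_mem_nhds hs] with t ht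
    exact p.inv_eq_self (le_of_lt ht)
  have hd1 : ∀ s, r' < s → deriv f s = 1 := fun s hs => by
    rw [(hev s hs).deriv_eq]; exact deriv_id s
  have hd2 : deriv (deriv f) ‖x - y‖ = 0 := by
    have : deriv f =ᶠ[nhds ‖x - y‖] fun _ => 1 := by
      filter_upwards [Ioi_mem_nhds hx] with t ht
      exact hd1 t ht
    rw [this.deriv_eq]; simp
  have hf : f ‖x - y‖ = ‖x - y‖ := p.inv_eq_self hx.le
  have hA : radialA f ‖x - y‖ = 1 := by rw [radialA, hf, div_self hs0]
  have hB : radialB f ‖x - y‖ = 0 := by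
    rw [radialB, hd1 _ hx, hf]; field_simp; ring
  have hC : radialC f ‖x - y‖ = 0 := by
    rw [radialC, hd1 _ hx, hf, hd2]; field_simp; ring
  have hmap : radialMap f y x = x := by
    rw [radialMap, hf, div_self hs0, one_smul, add_sub_cancel]
  have hJ : ∀ j k, radialJac f y j k x = if j = k then 1 else 0 := fun j k => by
    rw [radialJac, hA, hB]; simp
  have hH : ∀ i j k, radialHess f y i j k x = 0 := fun i j k => by
    rw [radialHess, hB, hC]; simp
  constructor
  · funext j
    change A.pullCoeff f y x j = _
    simp [pullCoeff, hJ, hmap]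
  · funext i j
    change A.pullGrad f y x i j = _
    simp [pullGrad, hJ, hH, hmap]

/-- At `h t` the map stretches by `t/h` tangentially and by `1/h'` radially. The squared curvature
thus gains `(t/h)⁴` on its tangential part and `(t/h)²/h'²` on its radial part; multiplying by the
Jacobian `(h/t)^(n-1) h'` gives the two weights. -/
theorem pullback_curvSq {κ : LinearMap.BilinForm ℝ (CMat m)} (hκ : IsAdInvariantInner G κ)
    (A : SobolevForm G Ω) (p : IsProfile h f c r' r) (hn : 5 ≤ n) (y : Euc n)
    (hr : ball y r ⊆ Ω) {z : Euc n} (hz : z ∈ openAnnulus y c r)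
    (hzG : ∀ i j, A.curv z i j ∈ lieAlg G) :
    radialDet n h ‖z - y‖ * (A.pullback p hn y hr).curvSq κ (radialMap h y z) =
      (h ‖z - y‖ / ‖z - y‖) ^ (n - 5) * deriv h ‖z - y‖ * (A.curvSq κ z - A.radialCurvSq κ y z) +
      (h ‖z - y‖ / ‖z - y‖) ^ (n - 3) / deriv h ‖z - y‖ * A.radialCurvSq κ y z := by
  have hzV := mem_openAnnulus.1 hz
  have hzy := ne_of_mem_openAnnulus p.c_pos hz
  set t := ‖z - y‖ with ht
  have ht0 : 0 < t := p.c_pos.trans hzV.1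
  have hs0 : 0 < h t := p.pos hzV.1
  have hd0 := p.deriv_pos t
  set x := radialMap h y z with hx
  have hxs : ‖x - y‖ = h t := p.norm_map_sub hz
  have hφ : radialMap f y x = z := p.radialMap_inv_map hz
  -- Radial maps preserve the direction `ν`, so the Jacobian matrix at the image point is of the
  -- form `a I + c ν νᵀ` with `ν` taken at `z`.
  have hcoord : ∀ i, x i - y i = h t * ((z i - y i) / t) := fun i => by
    rw [hx, radialMap]; simp; ring
  have hJ : ∀ i l, radialJac f y i l x = (if i = l then radialA f (h t) else 0) +
      (radialB f (h t) * h t ^ 2) * ((z i - y i) / t * ((z l - y l) / t)) := fun i l => by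
    rw [radialJac, hxs, hcoord, hcoord]; ring
  have key := radial_conj_sq (ν := fun i => (z i - y i) / t) hκ.symm (A.curv_antisymm z) hzG
    (sum_sq_direction hzy) (radialA f (h t)) (radialB f (h t) * h t ^ 2)
    (F' := (A.pullback p hn y hr).curv x) (fun i j => by
      have := A.pull_curv f y x i j
      rw [hφ] at this
      refine (show (A.pullback p hn y hr).curv x i j = _ from this).trans ?_
      simp_rw [hJ])
  have hsum : radialA f (h t) + radialB f (h t) * h t ^ 2 = (deriv h t)⁻¹ := by
    have : deriv f (h t) = (deriv h t)⁻¹ := eq_inv_of_mul_eq_one_left (p.deriv_inv_mul t)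
    rw [← this, radialA, radialB]; field_simp; ring
  have hA : radialA f (h t) = t / h t := by rw [radialA, p.left_inv]
  rw [hsum, hA] at key
  have e1 : (A.pullback p hn y hr).curvSq κ x = (t / h t) ^ 4 * (A.curvSq κ z - A.radialCurvSq κ y z) +
      (t / h t) ^ 2 * (deriv h t)⁻¹ ^ 2 * A.radialCurvSq κ y z := key
  rw [e1, radialDet]
  have p1 : (h t / t) ^ (n - 1) = (h t / t) ^ (n - 5) * (h t / t) ^ 4 := by
    rw [← pow_add]; congr 1; omega
  have p2 : (h t / t) ^ (n - 3) = (h t / t) ^ (n - 5) * (h t / t) ^ 2 := by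
    rw [← pow_add]; congr 1; omega
  rw [p1, p2]
  generalize (h t / t) ^ (n - 5) = w
  field_simp

theorem energy_pullback {κ : LinearMap.BilinForm ℝ (CMat m)} (hκ : IsAdInvariantInner G κ)
    (A : SobolevForm G Ω) (p : IsProfile h f c r' r) (hn : 5 ≤ n) (y : Euc n)
    (hr : ball y r ⊆ Ω) : (A.pullback p hn y hr).energy κ (ball y r) =
      ∫ z in openAnnulus y c r,
        ((h ‖z - y‖ / ‖z - y‖) ^ (n - 5) * deriv h ‖z - y‖ *
          (A.curvSq κ z - A.radialCurvSq κ y z) +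
        (h ‖z - y‖ / ‖z - y‖) ^ (n - 3) / deriv h ‖z - y‖ * A.radialCurvSq κ y z) := by
  have : Nonempty (Fin n) := ⟨⟨0, by omega⟩⟩
  rw [energy, ← restrict_punctured y, p.integral_eq (by omega)]
  refine integral_congr_ae ?_
  filter_upwards [ae_mono (Measure.restrict_mono (openAnnulus_subset hr) le_rfl) A.curv_mem,
    ae_restrict_mem (isOpen_openAnnulus y).measurableSet] with z hzG hz
  exact A.pullback_curvSq hκ p hn y hr hz hzG

end SobolevForm

end Competitor

/-! ### Integration in polar coordinates. -/

section Polar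

variable {n : ℕ}

/-- The measure `tⁿ⁻¹ dt` on the half-line. -/
def radialMeasure (n : ℕ) : Measure ℝ :=
  (volume.restrict (Set.Ioi (0 : ℝ))).withDensity fun t => ENNReal.ofReal (t ^ (n - 1))

instance (n : ℕ) : SFinite (radialMeasure n) := by unfold radialMeasure; infer_instance

theorem map_volumeIoiPow (n : ℕ) :
    (Measure.volumeIoiPow (n - 1)).map (Subtype.val : Set.Ioi (0 : ℝ) → ℝ) = radialMeasure n := by
  ext s hs
  rw [Measure.map_apply measurable_subtype_coe hs, Measure.volumeIoiPow,
    withDensity_apply _ (measurable_subtype_coe hs), radialMeasure, withDensity_apply _ hs,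
    setLIntegral_subtype measurableSet_Ioi _ fun t : ℝ => ENNReal.ofReal (t ^ (n - 1)),
    Measure.restrict_restrict hs, Subtype.image_preimage_coe, Set.inter_comm]

/-- Polar coordinates around `y`. -/
def polarMap (y : Euc n) (q : sphere (0 : Euc n) 1 × ℝ) : Euc n := y + q.2 • (q.1 : Euc n)

theorem measurePreserving_polarMap (hn : 1 ≤ n) (y : Euc n) :
    MeasurePreserving (polarMap y)
      ((volume : Measure (Euc n)).toSphere.prod (radialMeasure n)) volume := by
  have : Nonempty (Fin n) := ⟨⟨0, by omega⟩⟩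
  have h1 := (volume : Measure (Euc n)).measurePreserving_homeomorphUnitSphereProd
  rw [finrank_euclideanSpace_fin] at h1
  have h2 := (show MeasurePreserving (homeomorphUnitSphereProd (Euc n)).toMeasurableEquiv _ _ from h1).symm
  have h3 : MeasurePreserving (Subtype.val : ({0}ᶜ : Set (Euc n)) → Euc n)
      ((volume : Measure (Euc n)).comap Subtype.val) volume := by
    refine ⟨measurable_subtype_coe, ?_⟩
    rw [map_comap_subtype_coe (measurableSet_singleton _).compl]
    exact Measure.restrict_eq_self_of_ae_mem (by simp [ae_iff])
  have h4 := h3.comp h2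
  have h5 : MeasurePreserving (fun x : Euc n => y + x) volume volume :=
    measurePreserving_add_left volume y
  have h6 := h5.comp h4
  have h7 : MeasurePreserving (Prod.map id (Subtype.val : Set.Ioi (0 : ℝ) → ℝ))
      ((volume : Measure (Euc n)).toSphere.prod (Measure.volumeIoiPow (n - 1)))
      ((volume : Measure (Euc n)).toSphere.prod (radialMeasure n)) :=
    (MeasurePreserving.id _).prod ⟨measurable_subtype_coe, map_volumeIoiPow n⟩
  have hm : Measurable (polarMap y) := by unfold polarMap; fun_prop
  refine ⟨hm, ?_⟩
  rw [← h7.map_eq, Measure.map_map hm h7.measurable]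
  exact h6.map_eq

theorem ae_radialMeasure_iff {n : ℕ} {P : ℝ → Prop} :
    (∀ᵐ t ∂(radialMeasure n), P t) ↔ ∀ᵐ t ∂(volume.restrict (Set.Ioi (0 : ℝ))), P t := by
  rw [radialMeasure, ae_withDensity_iff (by fun_prop)]
  refine Filter.eventually_congr ?_
  filter_upwards [ae_restrict_mem measurableSet_Ioi] with t ht
  have : ENNReal.ofReal (t ^ (n - 1)) ≠ 0 := by
    simpa using pow_pos (Set.mem_Ioi.1 ht) _
  simp [this]

theorem integral_radialMeasure {n : ℕ} {E : Type*} [NormedAddCommGroup E] [NormedSpace ℝ E]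
    (g : ℝ → E) :
    ∫ t, g t ∂(radialMeasure n) = ∫ t in Set.Ioi (0 : ℝ), t ^ (n - 1) • g t := by
  rw [radialMeasure, integral_withDensity_eq_integral_toReal_smul (by fun_prop) (by simp)]
  refine setIntegral_congr_fun measurableSet_Ioi fun t ht => ?_
  simp only [ENNReal.toReal_ofReal (pow_nonneg (le_of_lt ht) _)]

theorem integrable_radialMeasure_iff {n : ℕ} {E : Type*} [NormedAddCommGroup E] [NormedSpace ℝ E]
    {g : ℝ → E} : Integrable g (radialMeasure n) ↔
      IntegrableOn (fun t => t ^ (n - 1) • g t) (Set.Ioi 0) := by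
  rw [radialMeasure, integrable_withDensity_iff_integrable_smul' (by fun_prop) (by simp)]
  refine integrable_congr ?_
  filter_upwards [ae_restrict_mem measurableSet_Ioi] with t ht
  rw [ENNReal.toReal_ofReal (pow_nonneg (le_of_lt ht) _)]

variable {E : Type*} [NormedAddCommGroup E] [NormedSpace ℝ E]

theorem integral_polar (hn : 1 ≤ n) (y : Euc n) {g : Euc n → E} (hg : Integrable g) :
    ∫ x, g x = ∫ t in Set.Ioi (0 : ℝ), t ^ (n - 1) •
      ∫ θ : sphere (0 : Euc n) 1, g (y + t • (θ : Euc n)) ∂(volume : Measure (Euc n)).toSphere := by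
  have mp := measurePreserving_polarMap hn y
  have h1 : Integrable (fun q => g (polarMap y q))
      ((volume : Measure (Euc n)).toSphere.prod (radialMeasure n)) := mp.integrable_comp_of_integrable hg
  have h2 : ∫ x, g x = ∫ q, g (polarMap y q)
      ∂((volume : Measure (Euc n)).toSphere.prod (radialMeasure n)) := by
    have := integral_map (f := g) mp.aemeasurable
      (by rw [mp.map_eq]; exact hg.aestronglyMeasurable)
    rwa [mp.map_eq] at this
  rw [← integral_radialMeasure (n := n), h2, integral_prod_symm _ h1]
  rfl

theorem integrableOn_polar (hn : 1 ≤ n) (y : Euc n) {g : Euc n → E} (hg : Integrable g) :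
    IntegrableOn (fun t : ℝ => t ^ (n - 1) • ∫ θ : sphere (0 : Euc n) 1, g (y + t • (θ : Euc n))
      ∂(volume : Measure (Euc n)).toSphere) (Set.Ioi 0) := by
  have mp := measurePreserving_polarMap hn y
  have h1 : Integrable (fun q => g (polarMap y q))
      ((volume : Measure (Euc n)).toSphere.prod (radialMeasure n)) := mp.integrable_comp_of_integrable hg
  exact integrable_radialMeasure_iff.1 h1.integral_prod_right

theorem ae_integrable_sphere {E : Type*} [NormedAddCommGroup E] (hn : 1 ≤ n) (y : Euc n) {g : Euc n → E} (hg : Integrable g) :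
    ∀ᵐ t ∂(volume.restrict (Set.Ioi (0 : ℝ))),
      Integrable (fun θ : sphere (0 : Euc n) 1 => g (y + t • (θ : Euc n)))
        (volume : Measure (Euc n)).toSphere := by
  have mp := measurePreserving_polarMap hn y
  have h1 : Integrable (fun q => g (polarMap y q))
      ((volume : Measure (Euc n)).toSphere.prod (radialMeasure n)) := mp.integrable_comp_of_integrable hg
  exact ae_radialMeasure_iff.1 h1.prod_left_ae

theorem ae_memLp_two_sphere (hn : 1 ≤ n) (y : Euc n) {g : Euc n → ℂ} (hg : MemLp g 2) :
    ∀ᵐ t ∂(volume.restrict (Set.Ioi (0 : ℝ))),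
      MemLp (fun θ : sphere (0 : Euc n) 1 => g (y + t • (θ : Euc n))) 2
        (volume : Measure (Euc n)).toSphere := by
  have mp := measurePreserving_polarMap hn y
  have h1 : AEStronglyMeasurable (fun q => g (polarMap y q))
      ((volume : Measure (Euc n)).toSphere.prod (radialMeasure n)) :=
    hg.aestronglyMeasurable.comp_measurePreserving mp
  have h3 : ∀ᵐ t ∂(volume.restrict (Set.Ioi (0 : ℝ))),
      AEStronglyMeasurable (fun θ : sphere (0 : Euc n) 1 => g (y + t • (θ : Euc n)))
        (volume : Measure (Euc n)).toSphere :=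
    ae_radialMeasure_iff.1 h1.prodMk_right
  have h2 : Integrable (fun x => ‖g x‖ ^ 2) := hg.integrable_norm_pow (by simp)
  filter_upwards [ae_integrable_sphere hn y h2, h3] with t ht ht'
  rwa [memLp_two_iff_integrable_sq_norm ht']

end Polar

/-! ### The Gauss–Green formula on almost every sphere. -/

section Trace

variable {n : ℕ} {i : Fin n}

/-- The primitive of `-k` vanishing at `R`, as a radial function, is a smooth cutoff. -/
theorem contDiff_radial_primitive {k : ℝ → ℝ} (hk : ContDiff ℝ ∞ k) {R : ℝ} (hR : 0 < R)
    (hkR : tsupport k ⊆ Set.Ioo 0 R) (hkc : HasCompactSupport k) (y : Euc n) :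
    ContDiff ℝ ∞ (fun x : Euc n => ∫ t in ‖x - y‖..R, k t) ∧
      (∀ i x, x ≠ y → partialD i (fun x : Euc n => ∫ t in ‖x - y‖..R, k t) x =
        -k ‖x - y‖ / ‖x - y‖ * (x i - y i)) ∧
      tsupport (fun x : Euc n => ∫ t in ‖x - y‖..R, k t) ⊆ ball y R := by
  set K : ℝ → ℝ := fun s => ∫ t in s..R, k t with hK
  have hKd : ∀ s, HasDerivAt K (-k s) s := fun s =>
    intervalIntegral.integral_hasDerivAt_left (hk.continuous.intervalIntegrable _ _)
      (hk.continuous.stronglyMeasurableAtFilter _ _) hk.continuous.continuousAt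
  have hKs : ContDiff ℝ ∞ K := by
    rw [contDiff_infty_iff_deriv]
    refine ⟨fun s => (hKd s).differentiableAt, ?_⟩
    rw [show deriv K = fun s => -k s from funext fun s => (hKd s).deriv]
    exact hk.neg
  -- The support of `k` stays away from both ends of `(0, R)`: the primitive is constant near `0`,
  -- hence smooth at the centre as a function of `x`, and vanishes before the boundary of the ball.
  obtain ⟨a, b, ha, hab, hb, hsub⟩ : ∃ a b, 0 < a ∧ a < b ∧ b < R ∧ ∀ t, k t ≠ 0 → a < t ∧ t < b := by
    by_cases hne : (tsupport k).Nonempty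
    · obtain ⟨a, haS, ha⟩ := hkc.isCompact.exists_isLeast hne
      obtain ⟨b, hbS, hb⟩ := hkc.isCompact.exists_isGreatest hne
      have h1 := hkR haS
      have h2 := hkR hbS
      have h3 := ha hbS
      refine ⟨a / 2, (b + R) / 2, by linarith [h1.1], by linarith [h1.1, h2.2], by linarith [h2.2],
        fun t ht => ?_⟩
      have := ha (subset_tsupport k ht)
      have := hb (subset_tsupport k ht)
      constructor <;> linarith [h1.1, h2.2]
    · refine ⟨R / 3, R / 2, by linarith, by linarith, by linarith, fun t ht => ?_⟩
      exact absurd ⟨t, subset_tsupport k ht⟩ hne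
  have hKb : ∀ s, b ≤ s → K s = 0 := by
    intro s hs
    simp only [hK]
    rw [intervalIntegral.integral_zero_ae]
    refine Filter.Eventually.of_forall fun t ht => ?_
    by_contra h0
    have := (hsub t h0).2
    rcases Set.mem_uIoc.1 ht with h | h <;> linarith [h.1, h.2]
  have hKa : ∀ s, s ≤ a → K s = K a := by
    intro s hs
    have : (∫ t in s..a, k t) = 0 := by
      rw [intervalIntegral.integral_zero_ae]
      refine Filter.Eventually.of_forall fun t ht => ?_
      by_contra h0
      have := (hsub t h0).1
      rcases Set.mem_uIoc.1 ht with h | h <;> linarith [h.1, h.2]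
    simp only [hK]
    rw [← intervalIntegral.integral_add_adjacent_intervals (hk.continuous.intervalIntegrable s a)
      (hk.continuous.intervalIntegrable a R), this, zero_add]
  refine ⟨?_, ?_, ?_⟩
  · refine contDiff_iff_contDiffAt.2 fun x => ?_
    by_cases hx : x = y
    · have : (fun x : Euc n => K ‖x - y‖) =ᶠ[nhds x] fun _ => K a := by
        filter_upwards [ball_mem_nhds x ha] with z hz
        rw [mem_ball, hx, dist_eq_norm] at hz
        exact hKa _ hz.le
      exact contDiffAt_const.congr_of_eventuallyEq this
    · exact (contDiffOn_comp_norm_sub hKs y).contDiffAt (isOpen_compl_singleton.mem_nhds hx)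
  · intro i x hx
    exact partialD_comp_norm_sub hx (hKd _) i
  · have : tsupport (fun x : Euc n => K ‖x - y‖) ⊆ closedBall y b := by
      refine closure_minimal (fun x hx => ?_) isClosed_closedBall
      rw [mem_closedBall, dist_eq_norm]
      by_contra h
      exact hx (hKb _ (not_le.1 h).le)
    exact this.trans (closedBall_subset_ball hb)

theorem norm_smul_sphere {t : ℝ} (ht : 0 < t) (θ : sphere (0 : Euc n) 1) :
    ‖t • (θ : Euc n)‖ = t := by
  rw [norm_smul, norm_eq_of_mem_sphere, mul_one, Real.norm_of_nonneg ht.le]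

/-- The Gauss--Green formula on almost every sphere, for a fixed test function. -/
theorem IsWeakPartial.ae_gauss_green (hn : 1 ≤ n) {y : Euc n} {R : ℝ} (hR : 0 < R)
    {u v : Euc n → ℂ} (hu : IntegrableOn u (ball y R)) (hv : IntegrableOn v (ball y R))
    (h : IsWeakPartial (ball y R) i u v) {φ : Euc n → ℝ} (hφ : ContDiff ℝ ∞ φ)
    (hc : HasCompactSupport φ) :
    ∀ᵐ t ∂(volume.restrict (Set.Ioo 0 R)),
      ∫ x in ball y t, (φ x • v x + partialD i φ x • u x) =
        t ^ (n - 1) • ∫ θ : sphere (0 : Euc n) 1,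
          (φ (y + t • (θ : Euc n)) * (θ : Euc n) i) • u (y + t • (θ : Euc n))
          ∂(volume : Measure (Euc n)).toSphere := by
  have : Nonempty (Fin n) := ⟨⟨0, by omega⟩⟩
  set w : Euc n → ℂ := (ball y R).indicator fun x => φ x • v x + partialD i φ x • u x with hw
  set g : Euc n → ℂ := (ball y R).indicator fun x =>
    (φ x * ((x i - y i) / ‖x - y‖)) • u x with hg
  have hwB : IntegrableOn (fun x => φ x • v x + partialD i φ x • u x) (ball y R) :=
    (integrableOn_smul_of_hasCompactSupport hφ.continuous hc hv).add
      (integrableOn_smul_of_hasCompactSupport (hφ.partialD i).continuous (hc.partialD i) hu)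
  have hwI : Integrable w := (integrable_indicator_iff measurableSet_ball).2 hwB
  obtain ⟨M, hM⟩ := hc.exists_bound_of_continuous hφ.continuous
  have hgI : Integrable g := by
    rw [hg, integrable_indicator_iff measurableSet_ball]
    have hφm : Measurable φ := hφ.continuous.measurable
    have hm : Measurable fun x : Euc n => φ x * ((x i - y i) / ‖x - y‖) := by fun_prop
    refine Integrable.bdd_smul hu M hm.aestronglyMeasurable
      (Filter.Eventually.of_forall fun x => ?_)
    rw [norm_mul]
    refine (mul_le_of_le_one_right (norm_nonneg _) ?_).trans (hM x)
    rw [Real.norm_eq_abs, abs_div, abs_norm]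
    exact div_le_one_of_le₀ (abs_coord_sub_le y x i) (norm_nonneg _)
  set F : ℝ × Euc n → ℂ := fun q => (ball y q.1).indicator w q.2 with hF
  have hFv : ∀ q, F q = if ‖q.2 - y‖ < q.1 then w q.2 else 0 := fun q => by
    by_cases hq : ‖q.2 - y‖ < q.1
    · rw [if_pos hq]
      exact Set.indicator_of_mem (by rwa [mem_ball, dist_eq_norm]) _
    · rw [if_neg hq]
      exact Set.indicator_of_notMem (by rwa [mem_ball, dist_eq_norm]) _
  have hFI : Integrable F ((volume.restrict (Set.Ioo 0 R)).prod volume) := by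
    have hs : MeasurableSet {q : ℝ × Euc n | ‖q.2 - y‖ < q.1} :=
      measurableSet_lt (by fun_prop) (by fun_prop)
    have : F = {q : ℝ × Euc n | ‖q.2 - y‖ < q.1}.indicator (fun q => w q.2) := by
      funext q
      rw [hFv, Set.indicator_apply]
      rfl
    rw [this]
    exact (hwI.comp_snd _).indicator hs
  set f1 : ℝ → ℂ := fun t => ∫ x, F (t, x) with hf1
  set f2 : ℝ → ℂ := fun t => t ^ (n - 1) • ∫ θ : sphere (0 : Euc n) 1, g (y + t • (θ : Euc n))
    ∂(volume : Measure (Euc n)).toSphere with hf2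
  have If1 : IntegrableOn f1 (Set.Ioo 0 R) := hFI.integral_prod_left
  have If2' : IntegrableOn f2 (Set.Ioi 0) := integrableOn_polar hn y hgI
  have If2 : IntegrableOn f2 (Set.Ioo 0 R) := If2'.mono_set Set.Ioo_subset_Ioi_self
  -- Both sides are tested against `k ∈ C_c^∞(0, R)`. With `κ(x) = ∫_{|x-y|}^R k`, Fubini turns `∫
  -- k(t) ∫_{B_t} w` into `∫ κ w`, while `∇κ = -k ν` turns the sphere integrals into the term of the
  -- weak formula for `κφ` in which `κ` is differentiated.
  have key : ∀ᵐ t, t ∈ Set.Ioo 0 R → f1 t - f2 t = 0 := by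
    refine isOpen_Ioo.ae_eq_zero_of_integral_contDiff_smul_eq_zero
      (IntegrableOn.locallyIntegrableOn (If1.sub If2)) fun k hk hkc hkR => ?_
    obtain ⟨B, hB⟩ := hkc.exists_bound_of_continuous hk.continuous
    obtain ⟨K1, K2, K3⟩ := contDiff_radial_primitive hk hR hkR hkc y
    set κ : Euc n → ℝ := fun x => ∫ t in ‖x - y‖..R, k t with hκ
    have hk0 : ∀ t, t ∉ Set.Ioo 0 R → k t = 0 := fun t ht =>
      image_eq_zero_of_notMem_tsupport fun h' => ht (hkR h')
    have Ik : ∀ {f : ℝ → ℂ} {s : Set ℝ}, IntegrableOn f s →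
        IntegrableOn (fun t => k t • f t) s := fun hf =>
      Integrable.bdd_smul hf B hk.continuous.aestronglyMeasurable (Filter.Eventually.of_forall hB)
    rw [← setIntegral_eq_integral_of_forall_compl_eq_zero (s := Set.Ioo 0 R)
      (fun t ht => by rw [hk0 t ht, zero_smul])]
    simp_rw [smul_sub]
    rw [integral_sub (Ik If1) (Ik If2), sub_eq_zero]
    have e1 : ∫ t in Set.Ioo 0 R, k t • f1 t = ∫ x in ball y R,
        κ x • (φ x • v x + partialD i φ x • u x) := by
      have hsw : Integrable (fun q : ℝ × Euc n => k q.1 • F q)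
          ((volume.restrict (Set.Ioo 0 R)).prod volume) :=
        Integrable.bdd_smul hFI B (hk.continuous.comp continuous_fst).aestronglyMeasurable
          (Filter.Eventually.of_forall fun q => hB q.1)
      simp_rw [hf1, ← integral_smul]
      rw [integral_integral_swap (f := fun t x => k t • F (t, x)) hsw,
        ← integral_indicator measurableSet_ball]
      refine integral_congr_ae (Filter.Eventually.of_forall fun x => ?_)
      simp only
      by_cases hx : x ∈ ball y R
      · rw [Set.indicator_of_mem hx]
        have hxR : ‖x - y‖ < R := by rwa [mem_ball, dist_eq_norm] at hx
        have : ∀ t, k t • F (t, x) = (Set.Ioi ‖x - y‖).indicator k t • w x := by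
          intro t
          rw [hFv]
          simp only [Set.indicator_apply, Set.mem_Ioi]
          split_ifs <;> simp
        simp_rw [this]
        rw [integral_smul_const, integral_indicator measurableSet_Ioi,
          Measure.restrict_restrict measurableSet_Ioi]
        have hset : Set.Ioi ‖x - y‖ ∩ Set.Ioo 0 R = Set.Ioo ‖x - y‖ R := by
          ext t; simp only [Set.mem_inter_iff, Set.mem_Ioi, Set.mem_Ioo]
          have := norm_nonneg (x - y)
          constructor
          · rintro ⟨h1, h2, h3⟩; exact ⟨h1, h3⟩
          · rintro ⟨h1, h2⟩; exact ⟨h1, by linarith, h2⟩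
        rw [hset, ← integral_Ioc_eq_integral_Ioo, ← intervalIntegral.integral_of_le hxR.le]
        simp only [hκ, hw, Set.indicator_of_mem hx]
      · rw [Set.indicator_of_notMem hx]
        have : ∀ t, k t • F (t, x) = 0 := by
          intro t
          have hwx : w x = 0 := Set.indicator_of_notMem hx _
          rw [hFv, hwx, ite_self, smul_zero]
        simp [this]
    have e2 : ∫ t in Set.Ioo 0 R, k t • f2 t = ∫ x, k ‖x - y‖ • g x := by
      have hkm : Measurable k := hk.continuous.measurable
      have hkg : Integrable (fun x => k ‖x - y‖ • g x) :=
        Integrable.bdd_smul hgI B (Measurable.aestronglyMeasurable (by fun_prop))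
          (Filter.Eventually.of_forall fun x => hB _)
      rw [integral_polar hn y hkg, setIntegral_eq_integral_of_forall_compl_eq_zero
        (fun t ht => by rw [hk0 t ht, zero_smul]),
        ← setIntegral_eq_integral_of_forall_compl_eq_zero (s := Set.Ioi 0)
        (fun t ht => by rw [hk0 t (fun h' => ht h'.1), zero_smul])]
      refine setIntegral_congr_fun measurableSet_Ioi fun t ht => ?_
      simp only [hf2, add_sub_cancel_left, norm_smul_sphere ht]
      rw [integral_smul, smul_comm]
    have hχ := h (fun x => κ x * φ x) (K1.mul hφ) hc.mul_left (tsupport_mul_subset_left.trans K3)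
    have hκb : Continuous κ := K1.continuous
    have I1 : IntegrableOn (fun x => (κ x * φ x) • v x) (ball y R) :=
      integrableOn_smul_of_hasCompactSupport (hκb.mul hφ.continuous) hc.mul_left hv
    have I2 : IntegrableOn (fun x => (κ x * partialD i φ x) • u x) (ball y R) :=
      integrableOn_smul_of_hasCompactSupport (hκb.mul (hφ.partialD i).continuous)
        (hc.partialD i).mul_left hu
    have I3 : IntegrableOn (fun x => (partialD i κ x * φ x) • u x) (ball y R) :=
      integrableOn_smul_of_hasCompactSupport ((K1.partialD i).continuous.mul hφ.continuous)
        hc.mul_left hu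
    have e : ∀ x, partialD i (fun x => κ x * φ x) x = κ x * partialD i φ x + partialD i κ x * φ x :=
      fun x => partialD_mul (K1.differentiable (by simp)).differentiableAt
        (hφ.differentiable (by simp)).differentiableAt i
    simp_rw [e, add_smul] at hχ
    rw [integral_add I2 I3] at hχ
    have e3 : ∫ x in ball y R, (partialD i κ x * φ x) • u x = -∫ x, k ‖x - y‖ • g x := by
      have hg' : (fun x => k ‖x - y‖ • g x) = (ball y R).indicator fun x =>
          k ‖x - y‖ • (φ x * ((x i - y i) / ‖x - y‖)) • u x := by
        funext x
        by_cases hx : x ∈ ball y R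
        · simp only [hg, Set.indicator_of_mem hx]
        · simp only [hg, Set.indicator_of_notMem hx, smul_zero]
      rw [hg', integral_indicator measurableSet_ball, ← integral_neg]
      refine integral_congr_ae ?_
      have hne : ∀ᵐ x ∂(volume.restrict (ball y R)), x ≠ y :=
        ae_restrict_of_ae (by simp [ae_iff])
      filter_upwards [hne] with x hx
      rw [K2 i x hx, smul_smul, ← neg_smul]
      congr 1; ring
    have e4 : ∫ x in ball y R, κ x • (φ x • v x + partialD i φ x • u x) =
        (∫ x in ball y R, (κ x * φ x) • v x) + ∫ x in ball y R, (κ x * partialD i φ x) • u x := by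
      rw [← integral_add I1 I2]
      simp_rw [smul_add, smul_smul]
    rw [e1, e2, e4]
    rw [e3] at hχ
    linear_combination hχ
  rw [ae_restrict_iff' measurableSet_Ioo]
  filter_upwards [key] with t ht htR
  have h0 := sub_eq_zero.1 (ht htR)
  have a1 : f1 t = ∫ x in ball y t, (φ x • v x + partialD i φ x • u x) := by
    simp only [hf1, hF]
    rw [integral_indicator measurableSet_ball]
    exact setIntegral_congr_fun measurableSet_ball fun x hx =>
      Set.indicator_of_mem (ball_subset_ball htR.2.le hx) _
  rw [← a1, h0]
  simp only [hf2]
  congr 1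
  refine integral_congr_ae (Filter.Eventually.of_forall fun θ => ?_)
  have hmem : y + t • (θ : Euc n) ∈ ball y R := by
    rw [mem_ball, dist_eq_norm, add_sub_cancel_left, norm_smul_sphere htR.1]; exact htR.2
  simp only [hg, Set.indicator_of_mem hmem, add_sub_cancel_left, norm_smul_sphere htR.1]
  congr 2
  simp [mul_div_cancel_left₀ _ htR.1.ne']

end Trace

/-! ### Traces on almost every sphere, and admissibility of the competitor. -/

section TraceExistence

variable {n : ℕ}

/-- A subset of the separable space of continuous maps on the closed ball is separable; this is
applied to the pairs formed by a test function and its differential. Density in `C¹` is what the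
Gauss–Green formula needs in order to extend from a countable family. -/
theorem exists_countable_dense_testFunctions (y : Euc n) (R : ℝ) :
    ∃ D : Set (Euc n → ℝ), D.Countable ∧ (∀ ψ ∈ D, ContDiff ℝ ∞ ψ ∧ HasCompactSupport ψ) ∧
      ∀ φ : Euc n → ℝ, ContDiff ℝ ∞ φ → HasCompactSupport φ → ∀ δ > 0, ∃ ψ ∈ D,
        ∀ x ∈ closedBall y R, |φ x - ψ x| ≤ δ ∧ ∀ i, |partialD i φ x - partialD i ψ x| ≤ δ := by
  have : CompactSpace (closedBall y R) := isCompact_iff_compactSpace.1 (isCompact_closedBall y R)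
  set T := {φ : Euc n → ℝ // ContDiff ℝ ∞ φ ∧ HasCompactSupport φ}
  have hdc : ∀ φ : T, Continuous fun x : closedBall y R => (φ.1 x, fderiv ℝ φ.1 x) := fun φ =>
    (φ.2.1.continuous.comp continuous_subtype_val).prodMk
      ((φ.2.1.continuous_fderiv (by simp)).comp continuous_subtype_val)
  set Φ : T → C(closedBall y R, ℝ × (Euc n →L[ℝ] ℝ)) := fun φ => ⟨_, hdc φ⟩ with hΦ
  obtain ⟨c, hc, hcc, hcd⟩ := (TopologicalSpace.IsSeparable.of_separableSpace
    (Set.range Φ)).exists_countable_dense_subset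
  by_cases hT : Nonempty T
  swap
  · exact ⟨∅, Set.countable_empty, by simp, fun φ h1 h2 => absurd ⟨⟨φ, h1, h2⟩⟩ hT⟩
  have hc' : ∀ z ∈ c, ∃ φ, Φ φ = z := fun z hz => hc hz
  choose! g hg using hc'
  refine ⟨(fun z => (g z).1) '' c, hcc.image _, ?_, fun φ h1 h2 δ hδ => ?_⟩
  · rintro _ ⟨z, hz, rfl⟩
    exact (g z).2
  · have hmem : Φ ⟨φ, h1, h2⟩ ∈ closure c := hcd ⟨_, rfl⟩
    obtain ⟨z, hz, hd⟩ := (Metric.mem_closure_iff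
      (α := C(closedBall y R, ℝ × (Euc n →L[ℝ] ℝ)))).1 hmem δ hδ
    refine ⟨(g z).1, ⟨z, hz, rfl⟩, fun x hx => ?_⟩
    have h3 : dist (Φ ⟨φ, h1, h2⟩ ⟨x, hx⟩) (z ⟨x, hx⟩) ≤ δ :=
      (ContinuousMap.dist_apply_le_dist _).trans hd.le
    rw [← hg z hz, Prod.dist_eq] at h3
    refine ⟨(le_max_left _ _).trans h3, fun i => ?_⟩
    have h4 : ‖fderiv ℝ φ x - fderiv ℝ (g z).1 x‖ ≤ δ := by
      rw [← dist_eq_norm]; exact (le_max_right _ _).trans h3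
    have h5 := (fderiv ℝ φ x - fderiv ℝ (g z).1 x).le_of_opNorm_le h4 (EuclideanSpace.single i 1)
    simpa [partialD] using h5

variable {m : ℕ} {G : Subgroup (GL (Fin m) ℂ)} {Ω : Set (Euc n)}

namespace SobolevForm

/-- On almost every sphere the restriction of the coefficients is the boundary trace. -/
theorem ae_isTrace (A : SobolevForm G Ω) (hn : 1 ≤ n) {y : Euc n} {R : ℝ} (hR : 0 < R)
    (hRΩ : ball y R ⊆ Ω) : ∀ᵐ t ∂(volume.restrict (Set.Ioo 0 R)),
      A.IsTrace y t fun θ j => A.coeff (y + t • (θ : Euc n)) j := by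
  have hmono : volume.restrict (ball y R) ≤ volume.restrict Ω := Measure.restrict_mono hRΩ le_rfl
  have fin1 : IsFiniteMeasure (volume.restrict (ball y R)) :=
    ⟨by simpa using measure_ball_lt_top⟩
  have hu2 : ∀ j a b, MemLp (fun x => A.coeff x j a b) 2 (volume.restrict (ball y R)) :=
    fun j a b => (A.memLp_two j a b).mono_measure hmono
  have hu : ∀ j a b, IntegrableOn (fun x => A.coeff x j a b) (ball y R) := fun j a b =>
    (hu2 j a b).integrable (by norm_num)
  have hv : ∀ i j a b, IntegrableOn (fun x => A.grad x i j a b) (ball y R) := fun i j a b =>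
    ((A.grad_memLp i j a b).mono_measure hmono).integrable (by norm_num)
  obtain ⟨D, hDc, hDs, hDd⟩ := exists_countable_dense_testFunctions y R
  -- The null set of radii in the Gauss–Green formula depends on the test function; countability of
  -- `D` gives one null set for all of them.
  have h1 : ∀ᵐ t ∂(volume.restrict (Set.Ioo 0 R)), ∀ ψ ∈ D, ∀ i j a b,
      ∫ x in ball y t, (ψ x • A.grad x i j a b + partialD i ψ x • A.coeff x j a b) =
        t ^ (n - 1) • ∫ θ : sphere (0 : Euc n) 1,
          (ψ (y + t • (θ : Euc n)) * (θ : Euc n) i) • A.coeff (y + t • (θ : Euc n)) j a b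
          ∂(volume : Measure (Euc n)).toSphere := by
    refine (ae_ball_iff hDc).2 fun ψ hψ => ?_
    simp only [ae_all_iff]
    exact fun i j a b => ((A.weak i j a b).mono hRΩ).ae_gauss_green hn hR (hu j a b)
      (hv i j a b) (hDs ψ hψ).1 (hDs ψ hψ).2
  have h2 : ∀ᵐ t ∂(volume.restrict (Set.Ioo 0 R)), ∀ j a b,
      MemLp (fun θ : sphere (0 : Euc n) 1 => A.coeff (y + t • (θ : Euc n)) j a b) 2
        (volume : Measure (Euc n)).toSphere := by
    simp only [ae_all_iff]
    intro j a b
    have h3 : MemLp ((ball y R).indicator fun x => A.coeff x j a b) 2 volume :=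
      (memLp_indicator_iff_restrict measurableSet_ball).2 (hu2 j a b)
    filter_upwards [ae_mono (Measure.restrict_mono Set.Ioo_subset_Ioi_self le_rfl)
      (ae_memLp_two_sphere hn y h3), ae_restrict_mem measurableSet_Ioo] with t ht htR
    refine ht.ae_eq (Filter.Eventually.of_forall fun θ => ?_)
    refine Set.indicator_of_mem ?_ _
    rw [mem_ball, dist_eq_norm, add_sub_cancel_left, norm_smul_sphere htR.1]; exact htR.2
  filter_upwards [h1, h2, ae_restrict_mem measurableSet_Ioo] with t ht1 ht2 htR
  refine ⟨ht2, fun φ hφ hφc i j a b => ?_⟩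
  have hsubt : ball y t ⊆ ball y R := ball_subset_ball htR.2.le
  have hut : IntegrableOn (fun x => A.coeff x j a b) (ball y t) := (hu j a b).mono_set hsubt
  have hvt : IntegrableOn (fun x => A.grad x i j a b) (ball y t) := (hv i j a b).mono_set hsubt
  have huS := (ht2 j a b).integrable (by norm_num)
  set σ := (volume : Measure (Euc n)).toSphere
  set Lf : (Euc n → ℝ) → ℂ := fun ψ =>
    ∫ x in ball y t, (ψ x • A.grad x i j a b + partialD i ψ x • A.coeff x j a b) with hLf
  set Rf : (Euc n → ℝ) → ℂ := fun ψ => t ^ (n - 1) • ∫ θ : sphere (0 : Euc n) 1,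
    (ψ (y + t • (θ : Euc n)) * (θ : Euc n) i) • A.coeff (y + t • (θ : Euc n)) j a b ∂σ with hRf
  have iL : ∀ ψ : Euc n → ℝ, ContDiff ℝ ∞ ψ → HasCompactSupport ψ → IntegrableOn
      (fun x => ψ x • A.grad x i j a b + partialD i ψ x • A.coeff x j a b) (ball y t) :=
    fun ψ h h' => (integrableOn_smul_of_hasCompactSupport h.continuous h' hvt).add
      (integrableOn_smul_of_hasCompactSupport (h.partialD i).continuous (h'.partialD i) hut)
  have hθ : ∀ θ : sphere (0 : Euc n) 1, |(θ : Euc n) i| ≤ 1 := fun θ => by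
    have := PiLp.norm_apply_le (θ : Euc n) i
    rwa [norm_eq_of_mem_sphere] at this
  have iR : ∀ ψ : Euc n → ℝ, ContDiff ℝ ∞ ψ → HasCompactSupport ψ → Integrable
      (fun θ : sphere (0 : Euc n) 1 => (ψ (y + t • (θ : Euc n)) * (θ : Euc n) i) •
        A.coeff (y + t • (θ : Euc n)) j a b) σ := by
    intro ψ h h'
    obtain ⟨M, hM⟩ := h'.exists_bound_of_continuous h.continuous
    have hcont : Continuous fun θ : sphere (0 : Euc n) 1 =>
        ψ (y + t • (θ : Euc n)) * (θ : Euc n) i := by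
      have := h.continuous
      fun_prop
    refine Integrable.bdd_smul huS M hcont.aestronglyMeasurable
      (Filter.Eventually.of_forall fun θ => ?_)
    rw [norm_mul]
    exact (mul_le_of_le_one_right (norm_nonneg _) (hθ θ)).trans (hM _)
  set M1 : ℝ := ∫ x in ball y t, (‖A.grad x i j a b‖ + ‖A.coeff x j a b‖) with hM1
  set M2 : ℝ := ∫ θ : sphere (0 : Euc n) 1, ‖A.coeff (y + t • (θ : Euc n)) j a b‖ ∂σ with hM2
  have hM1n : 0 ≤ M1 := integral_nonneg fun x => by positivity
  have hM2n : 0 ≤ M2 := integral_nonneg fun x => by positivity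
  have hball : ∀ x ∈ ball y t, x ∈ closedBall y R := fun x hx =>
    ball_subset_closedBall (hsubt hx)
  -- Both sides of the formula are continuous in the `C¹` norm of the test function, and they agree
  -- on `D`.
  have bound : ∀ δ > 0, ‖Lf φ - Rf φ‖ ≤ δ * (M1 + t ^ (n - 1) * M2) := by
    intro δ hδ
    obtain ⟨ψ, hψD, hψ⟩ := hDd φ hφ hφc δ hδ
    obtain ⟨s1, s2⟩ := hDs ψ hψD
    have e0 : Lf ψ = Rf ψ := ht1 ψ hψD i j a b
    have b1 : ‖Lf φ - Lf ψ‖ ≤ δ * M1 := by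
      simp only [hLf]
      rw [← integral_sub (iL φ hφ hφc) (iL ψ s1 s2), hM1, ← integral_const_mul]
      refine norm_integral_le_of_norm_le ((hvt.norm.add hut.norm).const_mul δ) ?_
      filter_upwards [ae_restrict_mem measurableSet_ball] with x hx
      have h5 := hψ x (hball x hx)
      have : φ x • A.grad x i j a b + partialD i φ x • A.coeff x j a b -
          (ψ x • A.grad x i j a b + partialD i ψ x • A.coeff x j a b) =
          (φ x - ψ x) • A.grad x i j a b + (partialD i φ x - partialD i ψ x) • A.coeff x j a b := by
        module
      rw [this, mul_add]
      refine (norm_add_le _ _).trans (add_le_add ?_ ?_)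
      · rw [norm_smul]; exact mul_le_mul_of_nonneg_right h5.1 (norm_nonneg _)
      · rw [norm_smul]; exact mul_le_mul_of_nonneg_right (h5.2 i) (norm_nonneg _)
    have b2 : ‖Rf ψ - Rf φ‖ ≤ δ * (t ^ (n - 1) * M2) := by
      simp only [hRf]
      rw [← smul_sub, ← integral_sub (iR ψ s1 s2) (iR φ hφ hφc), norm_smul,
        Real.norm_of_nonneg (pow_nonneg htR.1.le _), mul_left_comm]
      refine mul_le_mul_of_nonneg_left ?_ (pow_nonneg htR.1.le _)
      rw [hM2, ← integral_const_mul]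
      refine norm_integral_le_of_norm_le (huS.norm.const_mul δ)
        (Filter.Eventually.of_forall fun θ => ?_)
      have hmem : y + t • (θ : Euc n) ∈ closedBall y R := by
        rw [mem_closedBall, dist_eq_norm, add_sub_cancel_left, norm_smul_sphere htR.1]
        exact htR.2.le
      have h5 := (hψ _ hmem).1
      rw [← sub_smul, ← sub_mul, norm_smul, norm_mul]
      refine mul_le_mul_of_nonneg_right ?_ (norm_nonneg _)
      refine (mul_le_of_le_one_right (norm_nonneg _) (hθ θ)).trans ?_
      rwa [Real.norm_eq_abs, abs_sub_comm]
    calc ‖Lf φ - Rf φ‖ = ‖(Lf φ - Lf ψ) + (Rf ψ - Rf φ)‖ := by rw [e0]; congr 1; ring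
      _ ≤ δ * M1 + δ * (t ^ (n - 1) * M2) := (norm_add_le _ _).trans (add_le_add b1 b2)
      _ = _ := by ring
  have hK : 0 ≤ M1 + t ^ (n - 1) * M2 := by have := htR.1.le; positivity
  have hz : ‖Lf φ - Rf φ‖ ≤ 0 := by
    refine le_of_forall_pos_le_add fun ε hε => ?_
    refine (bound (ε / (M1 + t ^ (n - 1) * M2 + 1)) (by positivity)).trans ?_
    rw [zero_add, div_mul_eq_mul_div, div_le_iff₀ (by positivity)]
    nlinarith
  exact sub_eq_zero.1 (norm_le_zero_iff.1 hz)

/-- Forms that agree near the boundary sphere have the same trace. -/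
theorem IsTrace.of_eq_near_boundary {A : SobolevForm G Ω} {y : Euc n} {r r' : ℝ}
    (hr' : 0 < r') (hr'r : r' < r) (hrΩ : ball y r ⊆ Ω) {A' : SobolevForm G (ball y r)}
    (h : ∀ x, r' < ‖x - y‖ → A'.coeff x = A.coeff x ∧ A'.grad x = A.grad x)
    {τ : sphere (0 : Euc n) 1 → Fin n → CMat m} (hτ : A.IsTrace y r τ) : A'.IsTrace y r τ := by
  refine ⟨hτ.1, fun φ hφ hc i j a b => ?_⟩
  rw [← hτ.2 φ hφ hc i j a b]
  have hmono : volume.restrict (ball y r) ≤ volume.restrict Ω := Measure.restrict_mono hrΩ le_rfl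
  have fin1 : IsFiniteMeasure (volume.restrict (ball y r)) :=
    ⟨by simpa using measure_ball_lt_top⟩
  have hu : IntegrableOn (fun x => A.coeff x j a b) (ball y r) :=
    ((A.memLp_two j a b).mono_measure hmono).integrable (by norm_num)
  have hv : IntegrableOn (fun x => A.grad x i j a b) (ball y r) :=
    ((A.grad_memLp i j a b).mono_measure hmono).integrable (by norm_num)
  have hu' : IntegrableOn (fun x => A'.coeff x j a b) (ball y r) :=
    (A'.memLp_two j a b).integrable (by norm_num)
  have hv' : IntegrableOn (fun x => A'.grad x i j a b) (ball y r) :=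
    (A'.grad_memLp i j a b).integrable (by norm_num)
  -- The inner radius exceeds `r'` and the outer one is below `r`. Thus `ζφ` is an interior test
  -- function for both forms that coincides with `φ` wherever they may differ, and the two boundary
  -- identities have the same left side.
  set ζ : ContDiffBump y := ⟨(2 * r' + r) / 3, (r' + 2 * r) / 3, by linarith, by linarith⟩ with hζ
  have hζs : tsupport ζ ⊆ ball y r := by
    rw [ζ.tsupport_eq]
    exact closedBall_subset_ball (by simp only [hζ]; linarith)
  have hχ : ContDiff ℝ ∞ (fun x => ζ x * φ x) := ζ.contDiff.mul hφ
  have hχs : tsupport (fun x => ζ x * φ x) ⊆ ball y r := tsupport_mul_subset_left.trans hζs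
  have hχc : HasCompactSupport (fun x => ζ x * φ x) := hc.mul_left
  have w1 := (A.weak i j a b).mono hrΩ _ hχ hχc hχs
  have w2 := A'.weak i j a b _ hχ hχc hχs
  have I : ∀ {g : Euc n → ℝ} {w : Euc n → ℂ}, ContDiff ℝ ∞ g → HasCompactSupport g →
      IntegrableOn w (ball y r) → IntegrableOn (fun x => g x • w x) (ball y r) := fun h1 h2 h3 =>
    integrableOn_smul_of_hasCompactSupport h1.continuous h2 h3
  have w1' : ∫ x in ball y r, ((ζ x * φ x) • A.grad x i j a b +
      partialD i (fun x => ζ x * φ x) x • A.coeff x j a b) = 0 := by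
    rw [integral_add (I hχ hχc hv) (I (hχ.partialD i) (hχc.partialD i) hu), w1]; ring
  have w2' : ∫ x in ball y r, ((ζ x * φ x) • A'.grad x i j a b +
      partialD i (fun x => ζ x * φ x) x • A'.coeff x j a b) = 0 := by
    rw [integral_add (I hχ hχc hv') (I (hχ.partialD i) (hχc.partialD i) hu'), w2]; ring
  have J : ∀ {g : Euc n → ℝ}, ContDiff ℝ ∞ g → HasCompactSupport g → IntegrableOn (fun x =>
      g x • A.grad x i j a b + partialD i g x • A.coeff x j a b) (ball y r) := fun h1 h2 =>
    (I h1 h2 hv).add (I (h1.partialD i) (h2.partialD i) hu)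
  have J' : ∀ {g : Euc n → ℝ}, ContDiff ℝ ∞ g → HasCompactSupport g → IntegrableOn (fun x =>
      g x • A'.grad x i j a b + partialD i g x • A'.coeff x j a b) (ball y r) := fun h1 h2 =>
    (I h1 h2 hv').add (I (h1.partialD i) (h2.partialD i) hu')
  rw [← sub_eq_zero, ← integral_sub (J' hφ hc) (J hφ hc)]
  have w3 := sub_eq_zero.2 (w2'.trans w1'.symm)
  rw [← integral_sub (J' hχ hχc) (J hχ hχc)] at w3
  rw [← w3]
  refine integral_congr_ae (Filter.Eventually.of_forall fun x => ?_)
  simp only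
  rcases lt_or_ge r' ‖x - y‖ with hx | hx
  · rw [(h x hx).1, (h x hx).2]; simp
  · have hev : (fun x => ζ x * φ x) =ᶠ[nhds x] φ := by
      have hxb : x ∈ ball y ζ.rIn := by
        rw [mem_ball, dist_eq_norm]
        simp only [hζ]; linarith
      filter_upwards [isOpen_ball.mem_nhds hxb] with z hz
      rw [ζ.one_of_mem_closedBall (ball_subset_closedBall hz), one_mul]
    have e1 : ζ x * φ x = φ x := hev.eq_of_nhds
    have e2 : partialD i (fun x => ζ x * φ x) x = partialD i φ x := by
      rw [partialD, hev.fderiv_eq]; rfl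
    rw [e1, e2]

/-- For almost every radius, the energy of an almost minimizer is controlled by the energy of its
radial pull-back. -/
theorem ae_energy_le {κ : LinearMap.BilinForm ℝ (CMat m)}
    (A : SobolevForm G Ω) (hn : 5 ≤ n) {C α ρ₀ : ℝ}
    (hA : ∀ (y : Euc n) (r : ℝ), 0 < r → r < ρ₀ → closedBall y r ⊆ Ω →
      ∀ A' : SobolevForm G (ball y r), SameTangentialTrace A A' y r →
        A.energy κ (ball y r) ≤ A'.energy κ (ball y r) + C * r ^ ((n : ℝ) - 4 + α))
    {y : Euc n} {R : ℝ} (hR : 0 < R) (hRρ : R ≤ ρ₀) (hRΩ : ball y R ⊆ Ω) :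
    ∀ᵐ r ∂(volume.restrict (Set.Ioo 0 R)), ∀ (h f : ℝ → ℝ) (c r' : ℝ)
      (p : IsProfile h f c r' r) (hr : ball y r ⊆ Ω),
        A.energy κ (ball y r) ≤ (A.pullback p hn y hr).energy κ (ball y r) +
          C * r ^ ((n : ℝ) - 4 + α) := by
  -- The exceptional radii come from the trace alone, so the profile may be chosen after `r`. This
  -- matters because the profile used later is rescaled with `r`.
  filter_upwards [A.ae_isTrace (by omega) hR hRΩ, ae_restrict_mem measurableSet_Ioo]
    with r hτ hrR h f c r' p hr
  refine hA y r hrR.1 (hrR.2.trans_le hRρ) ((closedBall_subset_ball hrR.2).trans hRΩ) _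
    ⟨_, _, hτ, hτ.of_eq_near_boundary (p.c_pos.trans p.c_lt) p.lt_r hr fun x hx =>
      A.pullback_eq p hn y hr hx, ?_⟩
  exact Filter.Eventually.of_forall fun θ v _ => rfl

end SobolevForm

end TraceExistence

/-! ### Integration over the radii -/

section Kernel

variable {β : Type*} [MeasurableSpace β] {μ : Measure β} [SFinite μ] {W : ℝ → ℝ → ℝ}
  {σ ρ M : ℝ} {N F : β → ℝ}

theorem integrable_kernel_mul (hW : Measurable (Function.uncurry W))
    (hM : ∀ r ∈ Set.Ioo σ ρ, ∀ t, |W r t| ≤ M) (hN : Measurable N) (hF : Integrable F μ) :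
    Integrable (fun q : ℝ × β => W q.1 (N q.2) * F q.2)
      ((volume.restrict (Set.Ioo σ ρ)).prod μ) := by
  refine (hF.comp_snd _).bdd_mul (c := M) ?_ ?_
  · exact (hW.comp (measurable_fst.prodMk (hN.comp measurable_snd))).aestronglyMeasurable
  · exact Measure.quasiMeasurePreserving_fst.ae
      ((ae_restrict_mem measurableSet_Ioo).mono fun r hr => fun t => hM r hr t) |>.mono
      fun q hq => hq _

theorem integrable_integral_kernel_mul (hW : Measurable (Function.uncurry W))
    (hM : ∀ r ∈ Set.Ioo σ ρ, ∀ t, |W r t| ≤ M) (hN : Measurable N) (hF : Integrable F μ) :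
    IntegrableOn (fun r => ∫ x, W r (N x) * F x ∂μ) (Set.Ioo σ ρ) :=
  (integrable_kernel_mul hW hM hN hF).integral_prod_left

theorem integral_integral_kernel_mul (hW : Measurable (Function.uncurry W))
    (hM : ∀ r ∈ Set.Ioo σ ρ, ∀ t, |W r t| ≤ M) (hN : Measurable N) (hF : Integrable F μ) :
    ∫ r in Set.Ioo σ ρ, ∫ x, W r (N x) * F x ∂μ =
      ∫ x, (∫ r in Set.Ioo σ ρ, W r (N x)) * F x ∂μ := by
  rw [integral_integral_swap (integrable_kernel_mul hW hM hN hF)]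
  simp_rw [integral_mul_const]

theorem integrable_integral_kernel_mul' (hW : Measurable (Function.uncurry W))
    (hM : ∀ r ∈ Set.Ioo σ ρ, ∀ t, |W r t| ≤ M) (hN : Measurable N) (hF : Integrable F μ) :
    Integrable (fun x => (∫ r in Set.Ioo σ ρ, W r (N x)) * F x) μ := by
  simp_rw [← integral_mul_const]
  exact (integrable_kernel_mul hW hM hN hF).integral_prod_right

theorem integral_Ioo_div_pow (e : ℕ) (h0 : 0 < σ) (h1 : σ ≤ ρ) :
    ∫ r in Set.Ioo σ ρ, ((e : ℝ) + 1) / r ^ (e + 2) = 1 / σ ^ (e + 1) - 1 / ρ ^ (e + 1) := by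
  have hd : ∀ r ∈ Set.uIcc σ ρ, HasDerivAt (fun r : ℝ => -(1 / r ^ (e + 1)))
      (((e : ℝ) + 1) / r ^ (e + 2)) r := by
    intro r hr
    rw [Set.uIcc_of_le h1] at hr
    have hr0 : r ≠ 0 := (h0.trans_le hr.1).ne'
    have := ((hasDerivAt_pow (e + 1) r).inv (pow_ne_zero _ hr0)).neg
    refine (this.congr_deriv ?_).congr_of_eventuallyEq (Filter.Eventually.of_forall fun _ => ?_)
    · push_cast
      field_simp
      ring
    · simp
  rw [← integral_Ioc_eq_integral_Ioo, ← intervalIntegral.integral_of_le h1,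
    intervalIntegral.integral_eq_sub_of_hasDerivAt hd]
  · ring
  · refine ContinuousOn.intervalIntegrable fun r hr => ?_
    rw [Set.uIcc_of_le h1] at hr
    have hr0 : r ^ (e + 2) ≠ 0 := pow_ne_zero _ (h0.trans_le hr.1).ne'
    exact ContinuousAt.continuousWithinAt (by fun_prop (disch := assumption))

theorem integral_Ioo_rpow {α : ℝ} (hα : 0 < α) (h1 : σ ≤ ρ) :
    ∫ r in Set.Ioo σ ρ, r ^ (α - 1) = (ρ ^ α - σ ^ α) / α := by
  rw [← integral_Ioc_eq_integral_Ioo, ← intervalIntegral.integral_of_le h1,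
    integral_rpow (Or.inl (by linarith))]
  simp

theorem integrableOn_Ioo_rpow {α : ℝ} (h0 : 0 < σ) :
    IntegrableOn (fun r : ℝ => r ^ (α - 1)) (Set.Ioo σ ρ) := by
  refine (ContinuousOn.integrableOn_Icc fun r hr => ?_).mono_set Set.Ioo_subset_Icc_self
  exact (Real.continuousAt_rpow_const _ _ (Or.inl (h0.trans_le hr.1).ne')).continuousWithinAt

end Kernel

/-! ### One-dimensional kernels from rescaled profiles. -/

section ProfileKernel

variable {h f : ℝ → ℝ} {ε r' s : ℝ}

/-- The kernel `(e+1) r^{-e-2} w(t/r)`, cut off to `c r < t < r`. -/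
def cutKernel (e : ℕ) (c : ℝ) (w : ℝ → ℝ) (r t : ℝ) : ℝ :=
  if c * r < t ∧ t < r then ((e : ℝ) + 1) / r ^ (e + 2) * w (t / r) else 0

theorem measurable_cutKernel (e : ℕ) (c : ℝ) {w : ℝ → ℝ} (hw : Measurable w) :
    Measurable (Function.uncurry (cutKernel e c w)) := by
  refine Measurable.ite ?_ ?_ measurable_const
  · exact (measurableSet_lt (measurable_fst.const_mul c) measurable_snd).inter
      (measurableSet_lt measurable_snd measurable_fst)
  · have := hw.comp (measurable_snd.div measurable_fst : Measurable fun q : ℝ × ℝ => q.2 / q.1)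
    exact (measurable_const.div (measurable_fst.pow_const _)).mul this

theorem abs_cutKernel_le {e : ℕ} {c σ ρ D : ℝ} {w : ℝ → ℝ} (hσ : 0 < σ)
    (hw : ∀ s, c < s → s < 1 → |w s| ≤ D) (r : ℝ) (hr : r ∈ Set.Ioo σ ρ) (t : ℝ) :
    |cutKernel e c w r t| ≤ ((e : ℝ) + 1) / σ ^ (e + 2) * |D| := by
  have hr0 : 0 < r := hσ.trans hr.1
  rw [cutKernel]
  split_ifs with h
  · rw [abs_mul, abs_of_nonneg (by positivity)]
    have h1 := hw (t / r) ((lt_div_iff₀ hr0).2 h.1) ((div_lt_one hr0).2 h.2)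
    have h2 := hr.1.le
    exact mul_le_mul (by gcongr) (h1.trans (le_abs_self D)) (abs_nonneg _) (by positivity)
  · rw [abs_zero]; positivity

theorem cutKernel_eq_indicator {e : ℕ} {c : ℝ} (hc : 0 < c) (w : ℝ → ℝ) {r t : ℝ} :
    cutKernel e c w r t = (Set.Ioo t (t / c)).indicator
      (fun r => ((e : ℝ) + 1) / r ^ (e + 2) * w (t / r)) r := by
  rw [cutKernel, Set.indicator_apply]
  congr 1
  rw [Set.mem_Ioo, lt_div_iff₀ hc, mul_comm, and_comm]

theorem integral_cutKernel_eq_zero {e : ℕ} {c σ ρ t : ℝ} {w : ℝ → ℝ} (hc : 0 < c)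
    (ht : ¬ (c * σ < t ∧ t < ρ)) : ∫ r in Set.Ioo σ ρ, cutKernel e c w r t = 0 := by
  refine setIntegral_eq_zero_of_forall_eq_zero fun r hr => if_neg fun h => ht ?_
  exact ⟨(mul_lt_mul_of_pos_left hr.1 hc).trans h.1, h.2.trans hr.2⟩

theorem integral_cutKernel_eq {e : ℕ} {c σ ρ t : ℝ} (w : ℝ → ℝ) (hc : 0 < c) :
    ∫ r in Set.Ioo σ ρ, cutKernel e c w r t =
      ∫ r in Set.Ioo σ ρ ∩ Set.Ioo t (t / c), ((e : ℝ) + 1) / r ^ (e + 2) * w (t / r) := by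
  rw [← setIntegral_indicator measurableSet_Ioo]
  exact integral_congr_ae (Filter.Eventually.of_forall fun r => cutKernel_eq_indicator hc w)

namespace IsProfile

/-- Since `h' ≥ 1`, the function `h - id` is nondecreasing, and it vanishes at `1`. -/
theorem le_self (p : IsProfile h f (1 - ε) r' 1) (hs : s ≤ 1) : h s ≤ s := by
  have hm : Monotone fun t => h t - t := monotone_of_deriv_nonneg
    (fun t => ((p.hasDerivAt t).sub (hasDerivAt_id t)).differentiableAt) fun t => by
      have := ((p.hasDerivAt t).sub (hasDerivAt_id t)).deriv
      have h2 := p.one_le_deriv t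
      simp only [Pi.sub_def, id] at this
      rw [this]; linarith
  have h1 := hm hs
  simp only [p.map_r] at h1
  linarith

theorem ratio_mem (p : IsProfile h f (1 - ε) r' 1) (h0 : 1 - ε < s) (h1 : s < 1) :
    0 ≤ h s / s ∧ h s / s ≤ 1 := by
  have hs : 0 < s := p.c_pos.trans h0
  exact ⟨div_nonneg (p.pos h0).le hs.le, (div_le_one hs).2 (p.le_self h1.le)⟩

theorem exists_deriv_le (p : IsProfile h f (1 - ε) r' 1) : ∃ D, ∀ s, 1 - ε < s → s < 1 →
    deriv h s ≤ D := by
  obtain ⟨D, hD⟩ := (isCompact_Icc (a := 1 - ε) (b := 1)).exists_bound_of_continuousOn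
    (p.smooth.continuous_deriv (by simp)).continuousOn
  exact ⟨D, fun s h0 h1 => (le_abs_self _).trans (hD s ⟨h0.le, h1.le⟩)⟩

/-- The weight of the tangential part of the energy of the radial pull-back. -/
theorem tangential_weight_le (p : IsProfile h f (1 - ε) r' 1) (e : ℕ) {D : ℝ}
    (hD : ∀ s, 1 - ε < s → s < 1 → deriv h s ≤ D) (s : ℝ) (h0 : 1 - ε < s) (h1 : s < 1) :
    |(h s / s) ^ e * deriv h s| ≤ D := by
  obtain ⟨a, b⟩ := p.ratio_mem h0 h1
  have c := (p.deriv_pos s).le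
  rw [abs_of_nonneg (by positivity)]
  exact (mul_le_of_le_one_left c (pow_le_one₀ a b)).trans (hD s h0 h1)

theorem radial_weight_le (p : IsProfile h f (1 - ε) r' 1) (e : ℕ) (s : ℝ) (h0 : 1 - ε < s)
    (h1 : s < 1) : |(h s / s) ^ e / deriv h s| ≤ 1 := by
  obtain ⟨a, b⟩ := p.ratio_mem h0 h1
  have c := p.deriv_pos s
  rw [abs_of_nonneg (by positivity), div_le_one c]
  exact (pow_le_one₀ a b).trans (p.one_le_deriv s)

/-- The integrand is the exact derivative of `-(h(t/r)/t)^(e+1)`. This vanishes at `r = t/(1-ε)`,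
where `h(1-ε) = 0`, and equals `-1/t^(e+1)` at `r = t`, so the full integral is independent of the
profile; restricting to `(σ, ρ)` only decreases it. -/
theorem integral_tangential_kernel_le (p : IsProfile h f (1 - ε) r' 1) (e : ℕ) (σ ρ : ℝ)
    {t : ℝ} (hε : 0 < ε) (ht : 0 < t) :
    ∫ r in Set.Ioo σ ρ, cutKernel e (1 - ε) (fun s => (h s / s) ^ e * deriv h s) r t ≤
      1 / t ^ (e + 1) := by
  have hc := p.c_pos
  have htc : t ≤ t / (1 - ε) := by
    rw [le_div_iff₀ hc]; nlinarith
  set q : ℝ → ℝ := fun r => ((e : ℝ) + 1) / r ^ (e + 2) *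
    ((h (t / r) / (t / r)) ^ e * deriv h (t / r)) with hq
  have hdc : Continuous (deriv h) := p.smooth.continuous_deriv (by simp)
  have hcont : ContinuousOn q (Set.Icc t (t / (1 - ε))) := fun r hr => by
    have hr0 : r ≠ 0 := (ht.trans_le hr.1).ne'
    have hr1 : r ^ (e + 2) ≠ 0 := pow_ne_zero _ hr0
    have hr2 : t / r ≠ 0 := div_ne_zero ht.ne' hr0
    have := p.smooth.continuous
    have h3 : ContinuousAt (fun r => t / r) r := by fun_prop (disch := assumption)
    have h4 : ContinuousAt (fun r => h (t / r)) r := this.continuousAt.comp h3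
    have h5 : ContinuousAt (fun r => deriv h (t / r)) r := hdc.continuousAt.comp h3
    have h6 : ContinuousAt (fun r => ((e : ℝ) + 1) / r ^ (e + 2)) r := by
      fun_prop (disch := assumption)
    exact (h6.mul (((h4.div h3 hr2).pow e).mul h5)).continuousWithinAt
  have hd : ∀ r ∈ Set.uIcc t (t / (1 - ε)),
      HasDerivAt (fun r => -(h (t / r) ^ (e + 1) / t ^ (e + 1))) (q r) r := by
    intro r hr
    rw [Set.uIcc_of_le htc] at hr
    have hr0 : r ≠ 0 := (ht.trans_le hr.1).ne'
    have h1 : HasDerivAt (fun r => t / r) (-t / r ^ 2) r := by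
      have := (_root_.hasDerivAt_inv hr0).const_mul t
      refine (this.congr_deriv (by ring)).congr_of_eventuallyEq
        (Filter.Eventually.of_forall fun _ => div_eq_mul_inv _ _)
    have h2 := ((((p.hasDerivAt (t / r)).comp r h1).pow (e + 1)).div_const (t ^ (e + 1))).neg
    refine h2.congr_deriv ?_
    simp only [hq, Function.comp]
    push_cast
    rw [div_pow, div_pow]
    field_simp
    ring
  rw [integral_cutKernel_eq _ hc]
  calc _ ≤ ∫ r in Set.Ioo t (t / (1 - ε)), q r := by
        refine setIntegral_mono_set (hcont.integrableOn_Icc.mono_set Set.Ioo_subset_Icc_self) ?_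
          (Filter.Eventually.of_forall fun r hr => hr.2)
        filter_upwards [ae_restrict_mem measurableSet_Ioo] with r hr
        have hr0 : 0 < r := ht.trans hr.1
        have h1 : 1 - ε < t / r := by
          rw [lt_div_iff₀ hr0, mul_comm]; exact (lt_div_iff₀ hc).1 hr.2
        have := (p.ratio_mem h1 ((div_lt_one hr0).2 hr.1)).1
        have := (p.deriv_pos (t / r)).le
        simp only [Pi.zero_apply]
        positivity
    _ = 1 / t ^ (e + 1) := by
        rw [← integral_Ioc_eq_integral_Ioo, ← intervalIntegral.integral_of_le htc,
          intervalIntegral.integral_eq_sub_of_hasDerivAt hd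
            (ContinuousOn.intervalIntegrable (by rwa [Set.uIcc_of_le htc]))]
        have : t / (t / (1 - ε)) = 1 - ε := by field_simp
        rw [this, p.map_c, div_self ht.ne', p.map_r]
        simp

/-- The weight is at most `1` because `h' ≥ 1`, and the integration interval has length at most
`εt/(1-ε)`. The steepness of the profile therefore makes the radial contribution disappear as `ε →
0`. -/
theorem integral_radial_kernel_le (p : IsProfile h f (1 - ε) r' 1) (e : ℕ) (σ ρ : ℝ)
    {t : ℝ} (hε : 0 < ε) (ht : 0 < t) :
    ∫ r in Set.Ioo σ ρ, cutKernel e (1 - ε) (fun s => (h s / s) ^ (e + 2) / deriv h s) r t ≤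
      ((e : ℝ) + 1) * (ε / (1 - ε)) * (1 / t ^ (e + 1)) := by
  have hc := p.c_pos
  have htc : t ≤ t / (1 - ε) := by
    rw [le_div_iff₀ hc]; nlinarith
  rw [integral_cutKernel_eq _ hc]
  have hvol : volume (Set.Ioo σ ρ ∩ Set.Ioo t (t / (1 - ε))) < ⊤ :=
    (measure_mono Set.inter_subset_right).trans_lt (by simp)
  refine (Real.le_norm_self _).trans ((norm_setIntegral_le_of_norm_le_const
    (C := ((e : ℝ) + 1) / t ^ (e + 2)) hvol fun r hr => ?_).trans ?_)
  · have hr0 : 0 < r := ht.trans hr.2.1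
    have h1 : 1 - ε < t / r := by
      rw [lt_div_iff₀ hr0, mul_comm]; exact (lt_div_iff₀ hc).1 hr.2.2
    have h2 := p.radial_weight_le (e + 2) _ h1 ((div_lt_one hr0).2 hr.2.1)
    rw [norm_mul, Real.norm_of_nonneg (by positivity), Real.norm_eq_abs]
    refine (mul_le_of_le_one_right (by positivity) h2).trans ?_
    have := hr.2.1.le
    gcongr
  · have : volume.real (Set.Ioo σ ρ ∩ Set.Ioo t (t / (1 - ε))) ≤ t / (1 - ε) - t := by
      refine (measureReal_mono Set.inter_subset_right (by simp)).trans ?_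
      rw [Real.volume_real_Ioo_of_le htc]
    refine (mul_le_mul_of_nonneg_left this (by positivity)).trans (le_of_eq ?_)
    field_simp
    ring

end IsProfile

end ProfileKernel

/-! ### The monotonicity inequality from the comparison with radial deformations -/

section Deformation

/-- The kernel `(e+1) r^{-e-2}`, cut off to `t < r`. -/
def ballKernel (e : ℕ) (r t : ℝ) : ℝ := if t < r then ((e : ℝ) + 1) / r ^ (e + 2) else 0

theorem measurable_ballKernel (e : ℕ) : Measurable (Function.uncurry (ballKernel e)) :=
  Measurable.ite (measurableSet_lt measurable_snd measurable_fst)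
    (measurable_const.div (measurable_fst.pow_const _)) measurable_const

theorem abs_ballKernel_le {e : ℕ} {σ ρ : ℝ} (hσ : 0 < σ) (r : ℝ) (hr : r ∈ Set.Ioo σ ρ) (t : ℝ) :
    |ballKernel e r t| ≤ ((e : ℝ) + 1) / σ ^ (e + 2) := by
  have hr0 : 0 < r := hσ.trans hr.1
  rw [ballKernel]
  split_ifs with h
  · have := hr.1.le
    rw [abs_of_nonneg (by positivity)]
    gcongr
  · rw [abs_zero]; positivity

theorem integral_ballKernel {e : ℕ} {σ ρ t : ℝ} (hσ : 0 < σ) (hσρ : σ < ρ) (ht : t < ρ) :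
    ∫ r in Set.Ioo σ ρ, ballKernel e r t = 1 / (max σ t) ^ (e + 1) - 1 / ρ ^ (e + 1) := by
  have h : ∀ r, ballKernel e r t = (Set.Ioi t).indicator
      (fun r => ((e : ℝ) + 1) / r ^ (e + 2)) r := fun r => by
    rw [ballKernel, Set.indicator_apply]; rfl
  simp_rw [h]
  rw [setIntegral_indicator measurableSet_Ioi, ← Set.Ioi_inter_Iio, Set.inter_right_comm,
    Set.Ioi_inter_Ioi, Set.Ioi_inter_Iio]
  exact integral_Ioo_div_pow e (lt_max_of_lt_left hσ) (max_lt hσρ ht).le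

variable {β : Type*} [MeasurableSpace β] {μ : Measure β} {N F R : β → ℝ}
  {σ ρ C α : ℝ} {e : ℕ}

theorem integrableOn_div_pow_mul (e : ℕ) {c : ℝ} (hc : 0 < c) {S : Set β} (hS : MeasurableSet S)
    (hSc : ∀ x ∈ S, c ≤ N x) (hN : Measurable N) (hF : Integrable F μ) :
    IntegrableOn (fun x => 1 / N x ^ (e + 1) * F x) S μ := by
  refine hF.integrableOn.bdd_mul (c := 1 / c ^ (e + 1)) ?_ ?_
  · exact (measurable_const.div (hN.pow_const _)).aestronglyMeasurable
  · filter_upwards [ae_restrict_mem hS] with x hx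
    have := hSc x hx
    have h0 := hc.trans_le this
    rw [Real.norm_of_nonneg (by positivity)]
    gcongr

theorem integral_ballKernel_mul (hN : Measurable N) (r : ℝ) :
    ∫ x, ballKernel e r (N x) * F x ∂μ =
      ((e : ℝ) + 1) / r ^ (e + 2) * ∫ x in {x | N x < r}, F x ∂μ := by
  rw [← integral_const_mul, ← integral_indicator (measurableSet_lt hN measurable_const)]
  refine integral_congr_ae (Filter.Eventually.of_forall fun x => ?_)
  simp only [ballKernel, Set.indicator_apply, Set.mem_ofPred_eq, ite_mul, zero_mul]

/-- Integration by parts in the radius. -/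
theorem integral_integral_ballKernel [SFinite μ] (hσ : 0 < σ) (hσρ : σ < ρ) (hN : Measurable N)
    (hNρ : ∀ᵐ x ∂μ, N x < ρ) (hF : Integrable F μ) :
    ∫ r in Set.Ioo σ ρ, ∫ x, ballKernel e r (N x) * F x ∂μ =
      ∫ x in {x | σ ≤ N x}, 1 / N x ^ (e + 1) * F x ∂μ +
        1 / σ ^ (e + 1) * ∫ x in {x | N x < σ}, F x ∂μ - 1 / ρ ^ (e + 1) * ∫ x, F x ∂μ := by
  -- After Fubini a point contributes `1/max(σ, N)^(e+1) - 1/ρ^(e+1)`; the maximum separates the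
  -- inner ball from the annulus.
  rw [integral_integral_kernel_mul (measurable_ballKernel e) (abs_ballKernel_le hσ) hN hF]
  have m1 : MeasurableSet {x | σ ≤ N x} := measurableSet_le measurable_const hN
  have m2 : MeasurableSet {x | N x < σ} := measurableSet_lt hN measurable_const
  have i1 := integrableOn_div_pow_mul e hσ m1 (fun x hx => hx) hN hF
  have i2 : IntegrableOn (fun x => 1 / σ ^ (e + 1) * F x) {x | N x < σ} μ :=
    hF.integrableOn.const_mul _
  have i3 : Integrable (fun x => {x | σ ≤ N x}.indicator (fun x => 1 / N x ^ (e + 1) * F x) x +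
      {x | N x < σ}.indicator (fun x => 1 / σ ^ (e + 1) * F x) x) μ :=
    (i1.integrable_indicator m1).add (i2.integrable_indicator m2)
  rw [← integral_const_mul, ← integral_const_mul, ← integral_indicator m1, ← integral_indicator m2,
    ← integral_add (i1.integrable_indicator m1) (i2.integrable_indicator m2), ← integral_sub i3
      (hF.const_mul _)]
  refine integral_congr_ae ?_
  filter_upwards [hNρ] with x hx
  rw [integral_ballKernel hσ hσρ hx]
  simp only [Set.indicator_apply, Set.mem_ofPred_eq]
  rcases lt_or_ge (N x) σ with h | h
  · rw [max_eq_left h.le, if_neg (not_le.2 h), if_pos h]; ring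
  · rw [max_eq_right h, if_pos h, if_neg (not_lt.2 h)]; ring

theorem integral_cutKernel_mul_add (hN : Measurable N) (c : ℝ) (w₁ w₂ : ℝ → ℝ) (F₁ F₂ : β → ℝ)
    (r : ℝ) : ∫ x, (cutKernel e c w₁ r (N x) * F₁ x + cutKernel e c w₂ r (N x) * F₂ x) ∂μ =
      ((e : ℝ) + 1) / r ^ (e + 2) * ∫ x in {x | c * r < N x ∧ N x < r},
        (w₁ (N x / r) * F₁ x + w₂ (N x / r) * F₂ x) ∂μ := by
  have hm : MeasurableSet {x | c * r < N x ∧ N x < r} :=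
    (measurableSet_lt measurable_const hN).inter (measurableSet_lt hN measurable_const)
  rw [← integral_const_mul, ← integral_indicator hm]
  refine integral_congr_ae (Filter.Eventually.of_forall fun x => ?_)
  simp only [cutKernel, Set.indicator_apply, Set.mem_ofPred_eq]
  split_ifs <;> ring

/-- The comparison with a fixed profile, integrated over the radii. -/
theorem integral_ballKernel_le_of_profile [SFinite μ] {h f : ℝ → ℝ} {ε r' : ℝ} (hε : 0 < ε)
    (p : IsProfile h f (1 - ε) r' 1) (hσ : 0 < σ) (hσρ : σ < ρ) (hα : 0 < α) (hN : Measurable N)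
    (hNρ : ∀ᵐ x ∂μ, N x < ρ) (hF : Integrable F μ) (hR : Integrable R μ)
    (hR0 : ∀ᵐ x ∂μ, 0 ≤ R x) (hRF : ∀ᵐ x ∂μ, R x ≤ F x)
    (key : ∀ᵐ r ∂(volume.restrict (Set.Ioo σ ρ)), ∫ x in {x | N x < r}, F x ∂μ ≤
      ∫ x in {x | (1 - ε) * r < N x ∧ N x < r}, ((h (N x / r) / (N x / r)) ^ e *
        deriv h (N x / r) * (F x - R x) + (h (N x / r) / (N x / r)) ^ (e + 2) /
        deriv h (N x / r) * R x) ∂μ + C * r ^ ((e : ℝ) + 1 + α)) :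
    ∫ r in Set.Ioo σ ρ, ∫ x, ballKernel e r (N x) * F x ∂μ ≤
      ∫ x in {x | (1 - ε) * σ < N x}, 1 / N x ^ (e + 1) * (F x - R x) ∂μ +
        (e + 1) * (ε / (1 - ε)) *
          ∫ x in {x | (1 - ε) * σ < N x}, 1 / N x ^ (e + 1) * R x ∂μ +
        (e + 1) * C / α * (ρ ^ α - σ ^ α) := by
  obtain ⟨D, hD⟩ := p.exists_deriv_le
  set w₁ : ℝ → ℝ := fun s => (h s / s) ^ e * deriv h s with hw₁
  set w₂ : ℝ → ℝ := fun s => (h s / s) ^ (e + 2) / deriv h s with hw₂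
  have hhm : Measurable h := p.smooth.continuous.measurable
  have hdm : Measurable (deriv h) := measurable_deriv h
  have m₁ : Measurable w₁ := ((hhm.div measurable_id).pow_const _).mul hdm
  have m₂ : Measurable w₂ := ((hhm.div measurable_id).pow_const _).div hdm
  have k₁ := measurable_cutKernel e (1 - ε) m₁
  have k₂ := measurable_cutKernel e (1 - ε) m₂
  have b₁ := abs_cutKernel_le (e := e) (ρ := ρ) hσ (p.tangential_weight_le e hD)
  have b₂ := abs_cutKernel_le (e := e) (ρ := ρ) hσ (p.radial_weight_le (e + 2))
  have hFR : Integrable (fun x => F x - R x) μ := hF.sub hR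
  have hm : MeasurableSet {x | (1 - ε) * σ < N x} := measurableSet_lt measurable_const hN
  have hc : 0 < (1 - ε) * σ := mul_pos p.c_pos hσ
  have J₁ := integrable_integral_kernel_mul k₁ b₁ hN hFR
  have J₂ := integrable_integral_kernel_mul k₂ b₂ hN hR
  have J₃ : IntegrableOn (fun r : ℝ => ((e : ℝ) + 1) * C * r ^ (α - 1)) (Set.Ioo σ ρ) :=
    (integrableOn_Ioo_rpow hσ).const_mul _
  have J₁₂ : IntegrableOn (fun r => (∫ x, cutKernel e (1 - ε) w₁ r (N x) * (F x - R x) ∂μ) +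
      ∫ x, cutKernel e (1 - ε) w₂ r (N x) * R x ∂μ) (Set.Ioo σ ρ) := J₁.add J₂
  have step : ∫ r in Set.Ioo σ ρ, ∫ x, ballKernel e r (N x) * F x ∂μ ≤
      ∫ r in Set.Ioo σ ρ, ((∫ x, cutKernel e (1 - ε) w₁ r (N x) * (F x - R x) ∂μ) +
        (∫ x, cutKernel e (1 - ε) w₂ r (N x) * R x ∂μ) + ((e : ℝ) + 1) * C * r ^ (α - 1)) := by
    refine integral_mono_ae (integrable_integral_kernel_mul (measurable_ballKernel e)
      (abs_ballKernel_le hσ) hN hF) (J₁₂.add J₃) ?_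
    filter_upwards [key, ae_restrict_mem measurableSet_Ioo,
      (integrable_kernel_mul k₁ b₁ hN hFR).prod_right_ae,
      (integrable_kernel_mul k₂ b₂ hN hR).prod_right_ae] with r hr hrm i₁ i₂
    have hr0 : 0 < r := hσ.trans hrm.1
    rw [← integral_add i₁ i₂, integral_cutKernel_mul_add hN, integral_ballKernel_mul hN]
    refine (mul_le_mul_of_nonneg_left hr (by positivity)).trans (le_of_eq ?_)
    rw [mul_add]
    congr 1
    -- The kernel factor `r^(-e-2)` reduces the minimality error `r^(e+1+α)` to `r^(α-1)`, which
    -- integrates to a multiple of `ρ^α - σ^α`.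
    have : r ^ ((e : ℝ) + 1 + α) = r ^ (α - 1) * r ^ (e + 2) := by
      rw [← Real.rpow_natCast, ← Real.rpow_add hr0]
      congr 1; push_cast; ring
    rw [this]
    field_simp
  refine step.trans ?_
  rw [integral_add J₁₂ J₃, integral_add J₁ J₂, integral_const_mul,
    integral_Ioo_rpow hα hσρ.le, integral_integral_kernel_mul k₁ b₁ hN hFR,
    integral_integral_kernel_mul k₂ b₂ hN hR]
  refine add_le_add (add_le_add ?_ ?_) (le_of_eq (by ring))
  · rw [← integral_indicator hm]
    refine integral_mono_ae (integrable_integral_kernel_mul' k₁ b₁ hN hFR)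
      ((integrableOn_div_pow_mul e hc hm (fun x hx => le_of_lt hx) hN hFR).integrable_indicator
        hm) ?_
    filter_upwards [hNρ, hRF] with x hx hx'
    rw [Set.indicator_apply]
    split_ifs with h1
    · exact mul_le_mul_of_nonneg_right (p.integral_tangential_kernel_le e σ ρ hε (hc.trans h1))
        (sub_nonneg.2 hx')
    · rw [integral_cutKernel_eq_zero p.c_pos fun h2 => h1 h2.1, zero_mul]
  · rw [← integral_const_mul, ← integral_indicator hm]
    refine integral_mono_ae (integrable_integral_kernel_mul' k₂ b₂ hN hR)
      (IntegrableOn.integrable_indicator ((integrableOn_div_pow_mul e hc hm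
        (fun x hx => le_of_lt hx) hN hR).const_mul _) hm) ?_
    filter_upwards [hNρ, hR0] with x hx hx'
    rw [Set.indicator_apply]
    split_ifs with h1
    · rw [← mul_assoc]
      exact mul_le_mul_of_nonneg_right (p.integral_radial_kernel_le e σ ρ hε (hc.trans h1)) hx'
    · rw [integral_cutKernel_eq_zero p.c_pos fun h2 => h1 h2.1, zero_mul]

/-- The limit of sharp profiles. -/
theorem integral_ballKernel_le_of_forall_profile [SFinite μ] (hσ : 0 < σ) (hσρ : σ < ρ) (hα : 0 < α)
    (hN : Measurable N) (hNρ : ∀ᵐ x ∂μ, N x < ρ) (hF : Integrable F μ) (hR : Integrable R μ)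
    (hR0 : ∀ᵐ x ∂μ, 0 ≤ R x) (hRF : ∀ᵐ x ∂μ, R x ≤ F x)
    (key : ∀ (h f : ℝ → ℝ) (ε r' : ℝ), IsProfile h f (1 - ε) r' 1 →
      ∀ᵐ r ∂(volume.restrict (Set.Ioo σ ρ)), ∫ x in {x | N x < r}, F x ∂μ ≤
      ∫ x in {x | (1 - ε) * r < N x ∧ N x < r}, ((h (N x / r) / (N x / r)) ^ e *
        deriv h (N x / r) * (F x - R x) + (h (N x / r) / (N x / r)) ^ (e + 2) /
        deriv h (N x / r) * R x) ∂μ + C * r ^ ((e : ℝ) + 1 + α)) :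
    ∫ r in Set.Ioo σ ρ, ∫ x, ballKernel e r (N x) * F x ∂μ ≤
      ∫ x in {x | σ ≤ N x}, 1 / N x ^ (e + 1) * (F x - R x) ∂μ +
        (e + 1) * C / α * (ρ ^ α - σ ^ α) := by
  -- The shift by `2` keeps `ε ≤ 1/2`, so all the annuli stay in `N ≥ σ/2`, where the weight is
  -- bounded.
  set ε : ℕ → ℝ := fun k => 1 / ((k : ℝ) + 2) with hε
  have ε0 : ∀ k, 0 < ε k := fun k => by positivity
  have ε2 : ∀ k, ε k ≤ 1 / 2 := fun k => by
    simp only [hε]; gcongr; simp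
  have εanti : Antitone ε := fun a b hab => by
    simp only [hε]; gcongr
  have εlim : Filter.Tendsto ε Filter.atTop (nhds 0) := by
    have := (tendsto_one_div_add_atTop_nhds_zero_nat (𝕜 := ℝ)).comp (Filter.tendsto_add_atTop_nat 1)
    refine this.congr fun k => ?_
    simp only [hε, Function.comp]; push_cast; ring
  set S : ℕ → Set β := fun k => {x | (1 - ε k) * σ < N x} with hS
  have hSm : ∀ k, MeasurableSet (S k) := fun k => measurableSet_lt measurable_const hN
  have hSanti : Antitone S := fun a b hab x (hx : (1 - ε b) * σ < N x) => by
    have := εanti hab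
    exact lt_of_le_of_lt (show (1 - ε a) * σ ≤ (1 - ε b) * σ by gcongr) hx
  -- The domains `N > (1-ε)σ` decrease to the closed condition `σ ≤ N`, matching `B_ρ \ B_σ`
  -- exactly.
  have hSinter : ⋂ k, S k = {x | σ ≤ N x} := by
    ext x
    simp only [hS, Set.mem_iInter, Set.mem_ofPred_eq]
    refine ⟨fun hx => ?_, fun hx k => lt_of_lt_of_le (by nlinarith [ε0 k]) hx⟩
    refine le_of_tendsto' (f := fun k => (1 - ε k) * σ) (x := Filter.atTop) ?_ fun k => (hx k).le
    simpa using ((tendsto_const_nhds (x := (1 : ℝ))).sub εlim).mul_const σ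
  have hSc : ∀ x ∈ S 0, σ / 2 ≤ N x := fun x (hx : (1 - ε 0) * σ < N x) => by
    have h2 := ε2 0
    refine le_trans ?_ hx.le
    rw [div_eq_inv_mul]
    gcongr
    linarith
  have lim : ∀ {H : β → ℝ}, Integrable H μ → Filter.Tendsto
      (fun k => ∫ x in S k, 1 / N x ^ (e + 1) * H x ∂μ) Filter.atTop
      (nhds (∫ x in {x | σ ≤ N x}, 1 / N x ^ (e + 1) * H x ∂μ)) := fun hH => by
    rw [← hSinter]
    exact tendsto_setIntegral_of_antitone hSm hSanti
      ⟨0, integrableOn_div_pow_mul e (half_pos hσ) (hSm 0) hSc hN hH⟩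
  have lim2 : Filter.Tendsto (fun k => ((e : ℝ) + 1) * (ε k / (1 - ε k))) Filter.atTop
      (nhds 0) := by
    simpa using (εlim.div (tendsto_const_nhds (x := (1 : ℝ)).sub εlim) (by simp)).const_mul
      ((e : ℝ) + 1)
  have lim3 := ((lim (hF.sub hR)).add (lim2.mul (lim hR))).add_const
    ((e + 1) * C / α * (ρ ^ α - σ ^ α))
  rw [zero_mul, add_zero] at lim3
  refine ge_of_tendsto' lim3 fun k => ?_
  obtain ⟨h, f, p⟩ := exists_isProfile_one (ε0 k) (by linarith [ε2 k])
  exact integral_ballKernel_le_of_profile (ε0 k) p hσ hσρ hα hN hNρ hF hR hR0 hRF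
    (key h f (ε k) _ p)

end Deformation

/-! ### Almost monotonicity -/

section AlmostMonotonicity

namespace SobolevForm

variable {m : ℕ} {G : Subgroup (GL (Fin m) ℂ)} {e : ℕ} {Ω : Set (Euc (e + 5))}
  {κ : LinearMap.BilinForm ℝ (CMat m)} {y : Euc (e + 5)} {σ ρ : ℝ}

theorem restrict_ball_restrict_lt {n : ℕ} (y : Euc n) {r ρ : ℝ} (hr : r ≤ ρ) :
    (volume.restrict (ball y ρ)).restrict {x | ‖x - y‖ < r} = volume.restrict (ball y r) := by
  rw [Measure.restrict_restrict (measurableSet_lt (by fun_prop) measurable_const)]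
  congr 1
  ext x
  simp only [Set.mem_inter_iff, Set.mem_ofPred_eq, mem_ball, dist_eq_norm]
  exact ⟨fun h => h.1, fun h => ⟨h, h.trans_le hr⟩⟩

theorem restrict_ball_restrict_le {n : ℕ} (y : Euc n) (σ ρ : ℝ) :
    (volume.restrict (ball y ρ)).restrict {x | σ ≤ ‖x - y‖} =
      volume.restrict (ball y ρ \ ball y σ) := by
  rw [Measure.restrict_restrict (measurableSet_le measurable_const (by fun_prop))]
  congr 1
  ext x
  simp only [Set.mem_inter_iff, Set.mem_ofPred_eq, Set.mem_sdiff, mem_ball, dist_eq_norm, not_lt,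
    and_comm]

theorem restrict_ball_restrict_annulus {n : ℕ} (y : Euc n) {c r ρ : ℝ} (hr : r ≤ ρ) :
    (volume.restrict (ball y ρ)).restrict {x | c < ‖x - y‖ ∧ ‖x - y‖ < r} =
      volume.restrict (openAnnulus y c r) := by
  have hN : Measurable fun x : Euc n => ‖x - y‖ := by fun_prop
  have hm : MeasurableSet {x : Euc n | c < ‖x - y‖ ∧ ‖x - y‖ < r} :=
    (measurableSet_lt measurable_const hN).inter (measurableSet_lt hN measurable_const)
  rw [Measure.restrict_restrict hm]
  congr 1
  ext x
  simp only [Set.mem_inter_iff, Set.mem_ofPred_eq, mem_ball, dist_eq_norm, mem_openAnnulus]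
  exact ⟨fun h => h.1, fun h => ⟨h, h.2.trans_le hr⟩⟩

theorem ae_norm_sub_lt {n : ℕ} (y : Euc n) (ρ : ℝ) :
    ∀ᵐ x ∂(volume.restrict (ball y ρ)), ‖x - y‖ < ρ := by
  filter_upwards [ae_restrict_mem measurableSet_ball] with x hx
  rwa [mem_ball, dist_eq_norm] at hx

/-- The abstract integration by parts, with `n = e + 5`: the exponent `e + 1` is `n - 4`, so the two
boundary terms are the normalized energies. -/
theorem integral_ballKernel_curvSq (A : SobolevForm G Ω) (hσ : 0 < σ) (hσρ : σ < ρ)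
    (hρΩ : ball y ρ ⊆ Ω) :
    ∫ r in Set.Ioo σ ρ, ∫ x in ball y ρ, ballKernel e r ‖x - y‖ * A.curvSq κ x =
      (∫ x in ball y ρ \ ball y σ, 1 / ‖x - y‖ ^ (e + 1) * A.curvSq κ x) +
        normalizedEnergy κ A y σ - normalizedEnergy κ A y ρ := by
  rw [integral_integral_ballKernel (N := fun x => ‖x - y‖) hσ hσρ (by fun_prop)
    (ae_norm_sub_lt y ρ) ((A.integrable_curvSq κ).mono_set hρΩ), restrict_ball_restrict_le,
    restrict_ball_restrict_lt y hσρ.le]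
  rfl

theorem integrableOn_annulus_div_pow (e : ℕ) {n : ℕ} {y : Euc n} (hσ : 0 < σ) {F : Euc n → ℝ}
    (hF : IntegrableOn F (ball y ρ)) :
    IntegrableOn (fun x => 1 / ‖x - y‖ ^ (e + 1) * F x) (ball y ρ \ ball y σ) := by
  have hN : Measurable fun x : Euc n => ‖x - y‖ := by fun_prop
  have := integrableOn_div_pow_mul e hσ (measurableSet_le measurable_const hN)
    (fun x hx => hx) hN hF
  rwa [IntegrableOn, restrict_ball_restrict_le] at this

theorem radialCurvSq_mem_Icc (hκ : IsAdInvariantInner G κ) (A : SobolevForm G Ω) (y : Euc (e + 5)) :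
    ∀ᵐ x ∂(volume.restrict Ω), 0 ≤ A.radialCurvSq κ y x ∧ A.radialCurvSq κ y x ≤ A.curvSq κ x := by
  have hne : ∀ᵐ x ∂(volume.restrict Ω), x ≠ y := ae_restrict_of_ae (by simp [ae_iff])
  filter_upwards [A.curv_mem, hne] with x hx hxy
  exact ⟨A.radialCurvSq_nonneg hκ y hx, A.radialCurvSq_le hκ hxy hx⟩

/-- Almost monotonicity at the scales where the minimality is available. -/
theorem radialEnergy_le_of_le (hκ : IsAdInvariantInner G κ) (A : SobolevForm G Ω)
    {C α ρ₀ : ℝ} (hα : 0 < α)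
    (hA : ∀ (y : Euc (e + 5)) (r : ℝ), 0 < r → r < ρ₀ → closedBall y r ⊆ Ω →
      ∀ A' : SobolevForm G (ball y r), SameTangentialTrace A A' y r →
        A.energy κ (ball y r) ≤ A'.energy κ (ball y r) + C * r ^ (((e + 5 : ℕ) : ℝ) - 4 + α))
    (hσ : 0 < σ) (hσρ : σ < ρ) (hρ : ρ ≤ ρ₀) (hρΩ : ball y ρ ⊆ Ω) :
    radialEnergy κ A y σ ρ ≤ normalizedEnergy κ A y ρ - normalizedEnergy κ A y σ +
      (e + 1) * C / α * (ρ ^ α - σ ^ α) := by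
  have hmono : volume.restrict (ball y ρ) ≤ volume.restrict Ω := Measure.restrict_mono hρΩ le_rfl
  have hF := (A.integrable_curvSq κ).mono_set hρΩ
  have hR := (A.integrable_radialCurvSq κ y).mono_set hρΩ
  have hRF : ∀ᵐ x ∂(volume.restrict (ball y ρ)),
      0 ≤ A.radialCurvSq κ y x ∧ A.radialCurvSq κ y x ≤ A.curvSq κ x := ae_mono hmono (A.radialCurvSq_mem_Icc hκ y)
  have main := integral_ballKernel_le_of_forall_profile (e := e) (C := C) (N := fun x => ‖x - y‖)
    hσ hσρ hα (by fun_prop) (ae_norm_sub_lt y ρ) hF hR (hRF.mono fun x hx => hx.1)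
    (hRF.mono fun x hx => hx.2) fun h f ε r' p => by
      filter_upwards [ae_mono (Measure.restrict_mono (Set.Ioo_subset_Ioo_left hσ.le) le_rfl)
        (A.ae_energy_le (by omega) hA (hσ.trans hσρ) hρ hρΩ), ae_restrict_mem measurableSet_Ioo]
        with r hr hrm
      have hr0 : 0 < r := hσ.trans hrm.1
      -- The unit profile is dilated to the ball of radius `r`; its weights then depend on `‖x - y‖
      -- / r` only.
      have q := p.scale hr0
      rw [mul_one] at q
      have h1 := hr _ _ _ _ q ((ball_subset_ball hrm.2.le).trans hρΩ)
      rw [A.energy_pullback hκ] at h1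
      have e1 : ((e + 5 : ℕ) : ℝ) - 4 + α = (e : ℝ) + 1 + α := by push_cast; ring
      rw [e1] at h1
      rw [restrict_ball_restrict_lt y hrm.2.le, restrict_ball_restrict_annulus y hrm.2.le,
        mul_comm (1 - ε) r]
      refine h1.trans (le_of_eq ?_)
      congr 1
      refine integral_congr_ae (Filter.Eventually.of_forall fun x => ?_)
      simp only
      rw [deriv_scale (p.smooth.differentiable (by simp)) hr0.ne']
      have e2 : r * h (‖x - y‖ / r) / ‖x - y‖ = h (‖x - y‖ / r) / (‖x - y‖ / r) := by
        rw [div_div_eq_mul_div, mul_comm]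
      rw [e2]
      rfl
  rw [A.integral_ballKernel_curvSq hσ hσρ hρΩ, restrict_ball_restrict_le] at main
  have i1 := integrableOn_annulus_div_pow e hσ hF
  have i2 := integrableOn_annulus_div_pow e hσ hR
  simp_rw [mul_sub] at main
  -- The weighted integral of `|F|²` over the annulus now occurs on both sides and cancels.
  rw [integral_sub i1 i2] at main
  have e3 : radialEnergy κ A y σ ρ =
    ∫ x in ball y ρ \ ball y σ, 1 / ‖x - y‖ ^ (e + 1) * A.radialCurvSq κ y x := rfl
  rw [e3]
  linarith

/-- The weak form of the monotonicity formula, without minimality. -/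
theorem radialEnergy_le_of_integral_le (hκ : IsAdInvariantInner G κ) (A : SobolevForm G Ω)
    (hσ : 0 < σ) (hσρ : σ < ρ) (hρΩ : ball y ρ ⊆ Ω) :
    radialEnergy κ A y σ ρ ≤ normalizedEnergy κ A y ρ - normalizedEnergy κ A y σ +
      A.energy κ Ω * (1 / σ ^ (e + 1) - 1 / ρ ^ (e + 1)) := by
  have hF := (A.integrable_curvSq κ).mono_set hρΩ
  have hR := (A.integrable_radialCurvSq κ y).mono_set hρΩ
  have i1 := integrableOn_annulus_div_pow e hσ hF
  have i2 := integrableOn_annulus_div_pow e hσ hR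
  have hRF := A.radialCurvSq_mem_Icc hκ y
  have hF0 : ∀ᵐ x ∂(volume.restrict Ω), 0 ≤ A.curvSq κ x := hRF.mono fun x hx => hx.1.trans hx.2
  have h1 : radialEnergy κ A y σ ρ ≤
      ∫ x in ball y ρ \ ball y σ, 1 / ‖x - y‖ ^ (e + 1) * A.curvSq κ x := by
    refine integral_mono_ae i2 i1 ?_
    filter_upwards [ae_mono (Measure.restrict_mono (Set.sdiff_subset.trans hρΩ) le_rfl) hRF]
      with x hx
    exact mul_le_mul_of_nonneg_left hx.2 (by positivity)
  have h2 := A.integral_ballKernel_curvSq (κ := κ) hσ hσρ hρΩ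
  -- The energy on each ball is bounded by the total energy; no comparison is involved.
  have h3 : ∫ r in Set.Ioo σ ρ, ∫ x in ball y ρ, ballKernel e r ‖x - y‖ * A.curvSq κ x ≤
      A.energy κ Ω * (1 / σ ^ (e + 1) - 1 / ρ ^ (e + 1)) := by
    rw [← integral_Ioo_div_pow e hσ hσρ.le, ← integral_const_mul]
    have i3 := integral_Ioo_div_pow e hσ hσρ.le
    have i4 : IntegrableOn (fun r : ℝ => ((e : ℝ) + 1) / r ^ (e + 2)) (Set.Ioo σ ρ) := by
      refine (ContinuousOn.integrableOn_Icc fun r hr => ?_).mono_set Set.Ioo_subset_Icc_self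
      have hr0 : r ^ (e + 2) ≠ 0 := pow_ne_zero _ (hσ.trans_le hr.1).ne'
      exact ContinuousAt.continuousWithinAt (by fun_prop (disch := assumption))
    refine setIntegral_mono_on (integrable_integral_kernel_mul (N := fun x => ‖x - y‖)
      (measurable_ballKernel e) (abs_ballKernel_le hσ) (by fun_prop) hF) (i4.const_mul _)
      measurableSet_Ioo fun r hr => ?_
    have hr0 : 0 < r := hσ.trans hr.1
    rw [integral_ballKernel_mul (N := fun x => ‖x - y‖) (by fun_prop),
      restrict_ball_restrict_lt y hr.2.le, mul_comm]
    refine mul_le_mul_of_nonneg_right ?_ (by positivity)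
    exact setIntegral_mono_set (A.integrable_curvSq κ) hF0
      (Filter.Eventually.of_forall ((ball_subset_ball hr.2.le).trans hρΩ))
  linarith

theorem radialEnergy_add (κ : LinearMap.BilinForm ℝ (CMat m)) (A : SobolevForm G Ω) {τ : ℝ}
    (hσ : 0 < σ) (hστ : σ ≤ τ) (hτρ : τ ≤ ρ) (hρΩ : ball y ρ ⊆ Ω) :
    radialEnergy κ A y σ ρ = radialEnergy κ A y σ τ + radialEnergy κ A y τ ρ := by
  have hR := (A.integrable_radialCurvSq κ y).mono_set hρΩ
  have e1 : ball y ρ \ ball y σ = (ball y τ \ ball y σ) ∪ (ball y ρ \ ball y τ) := by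
    have h1 := ball_subset_ball (x := y) hστ
    have h2 := ball_subset_ball (x := y) hτρ
    ext x
    have := @h1 x
    have := @h2 x
    simp only [Set.mem_sdiff, Set.mem_union]
    tauto
  have i1 := integrableOn_annulus_div_pow e hσ hR
  rw [radialEnergy, e1, setIntegral_union _ (measurableSet_ball.diff measurableSet_ball)]
  · rfl
  · exact i1.mono_set (Set.sdiff_subset_sdiff_left (ball_subset_ball hτρ))
  · exact i1.mono_set (Set.sdiff_subset_sdiff_right (ball_subset_ball hστ))
  · exact Set.disjoint_left.2 fun x h1 h2 => h2.2 h1.1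

end SobolevForm

/-- Both sides are integrals over `(σ, ρ)`, and `r^(-e-2) = r^(α-1) / r^(e+1+α)` with `r ≥ τ`. This
puts the large-scale error in the form `ρ^α - σ^α`. -/
theorem sub_inv_pow_le_rpow_sub {e : ℕ} {α τ σ ρ : ℝ} (hα : 0 < α) (hτ : 0 < τ) (hτσ : τ ≤ σ)
    (hσρ : σ ≤ ρ) : 1 / σ ^ (e + 1) - 1 / ρ ^ (e + 1) ≤
      (e + 1) / (α * τ ^ ((e : ℝ) + 1 + α)) * (ρ ^ α - σ ^ α) := by
  have hσ := hτ.trans_le hτσ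
  have hτp : 0 < τ ^ ((e : ℝ) + 1 + α) := Real.rpow_pos_of_pos hτ _
  rw [← integral_Ioo_div_pow e hσ hσρ]
  have e1 : (e + 1) / (α * τ ^ ((e : ℝ) + 1 + α)) * (ρ ^ α - σ ^ α) =
      ∫ r in Set.Ioo σ ρ, ((e : ℝ) + 1) / τ ^ ((e : ℝ) + 1 + α) * r ^ (α - 1) := by
    rw [integral_const_mul, integral_Ioo_rpow hα hσρ]
    field_simp
  rw [e1]
  have i4 : IntegrableOn (fun r : ℝ => ((e : ℝ) + 1) / r ^ (e + 2)) (Set.Ioo σ ρ) := by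
    refine (ContinuousOn.integrableOn_Icc fun r hr => ?_).mono_set Set.Ioo_subset_Icc_self
    have hr0 : r ^ (e + 2) ≠ 0 := pow_ne_zero _ (hσ.trans_le hr.1).ne'
    exact ContinuousAt.continuousWithinAt (by fun_prop (disch := assumption))
  refine setIntegral_mono_on i4 ((integrableOn_Ioo_rpow hσ).const_mul _) measurableSet_Ioo
    fun r hr => ?_
  have hr0 : 0 < r := hσ.trans hr.1
  have e2 : r ^ ((e : ℝ) + 1 + α) = r ^ (α - 1) * r ^ (e + 2) := by
    rw [← Real.rpow_natCast, ← Real.rpow_add hr0]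
    congr 1; push_cast; ring
  have h1 : τ ^ ((e : ℝ) + 1 + α) ≤ r ^ (α - 1) * r ^ (e + 2) := by
    rw [← e2]
    exact Real.rpow_le_rpow hτ.le (hτσ.trans hr.1.le) (by positivity)
  rw [div_mul_eq_mul_div, div_le_div_iff₀ (by positivity) hτp]
  have : ((e : ℝ) + 1) * τ ^ ((e : ℝ) + 1 + α) ≤ (e + 1) * (r ^ (α - 1) * r ^ (e + 2)) := by
    gcongr
  linarith

/-- A ball that misses the frontier is covered by `Ω` and the complement of its closure; being
connected and meeting `Ω` at `y`, it cannot meet the other set. An empty frontier is included, the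
distance then being infinite. -/
theorem ball_subset_of_lt_infEDist_frontier {n : ℕ} {Ω : Set (Euc n)} {y : Euc n} {ρ : ℝ}
    (hΩ : IsOpen Ω) (hy : y ∈ Ω) (hρ : 0 < ρ) (h : ENNReal.ofReal ρ < infEDist y (frontier Ω)) :
    ball y ρ ⊆ Ω := by
  have hfr : ∀ z ∈ ball y ρ, z ∉ frontier Ω := fun z hz hzΩ => by
    refine absurd h (not_lt.2 ((infEDist_le_edist_of_mem hzΩ).trans ?_))
    rw [edist_comm, edist_dist]
    exact ENNReal.ofReal_le_ofReal (mem_ball.1 hz).le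
  have hcl : ∀ z ∈ ball y ρ, z ∉ Ω → z ∈ (closure Ω)ᶜ := fun z hz hzΩ hzc => hfr z hz (by
    rw [hΩ.frontier_eq]; exact ⟨hzc, hzΩ⟩)
  intro x hx
  by_contra hxΩ
  obtain ⟨z, -, hz, hz'⟩ := (convex_ball y ρ).isPreconnected Ω (closure Ω)ᶜ hΩ
    isClosed_closure.isOpen_compl (fun z hz => or_iff_not_imp_left.2 (hcl z hz))
    ⟨y, mem_ball_self hρ, hy⟩ ⟨x, hx, hcl x hx hxΩ⟩
  exact hz' (subset_closure hz)

/-- Almost monotonicity at all scales, with the error constant made explicit. -/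
theorem IsAlmostMinimizer.exists_radialEnergy_le {m : ℕ} {G : Subgroup (GL (Fin m) ℂ)}
    {κ : LinearMap.BilinForm ℝ (CMat m)} (hκ : IsAdInvariantInner G κ) {n : ℕ} (hn : 5 ≤ n)
    {Ω : Set (Euc n)} {A : SobolevForm G Ω} (hA : IsAlmostMinimizer κ A) :
    ∃ C > (0 : ℝ), ∃ α > (0 : ℝ), ∀ (y : Euc n) (σ ρ : ℝ), 0 < σ → σ < ρ → ball y ρ ⊆ Ω →
      radialEnergy κ A y σ ρ ≤ normalizedEnergy κ A y ρ - normalizedEnergy κ A y σ +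
        C * (ρ ^ α - σ ^ α) := by
  obtain ⟨e, rfl⟩ := Nat.exists_eq_add_of_le' hn
  obtain ⟨C, hC, α, hα, ρ₀, hρ₀, hA⟩ := hA
  have hM : 0 ≤ A.energy κ Ω := integral_nonneg_of_ae
    ((A.radialCurvSq_mem_Icc hκ 0).mono fun x hx => hx.1.trans hx.2)
  -- `C₁` comes from the comparison at scales up to `ρ₀`, `C₂` from the total energy at scales above
  -- `ρ₀`. Neither depends on the centre.
  set C₁ : ℝ := (e + 1) * C / α with hC₁
  set C₂ : ℝ := A.energy κ Ω * ((e + 1) / (α * ρ₀ ^ ((e : ℝ) + 1 + α))) with hC₂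
  have hC₁p : 0 < C₁ := by positivity
  have hC₂p : 0 ≤ C₂ := by positivity
  refine ⟨C₁ + C₂, by positivity, α, hα, fun y σ ρ hσ hσρ hρΩ => ?_⟩
  have small : ∀ {σ ρ : ℝ}, 0 < σ → σ < ρ → ρ ≤ ρ₀ → ball y ρ ⊆ Ω → radialEnergy κ A y σ ρ ≤
      normalizedEnergy κ A y ρ - normalizedEnergy κ A y σ + (C₁ + C₂) * (ρ ^ α - σ ^ α) := by
    intro σ ρ h1 h2 h3 h4
    have h5 := A.radialEnergy_le_of_le hκ hα hA h1 h2 h3 h4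
    have h6 : 0 ≤ ρ ^ α - σ ^ α := sub_nonneg.2 (Real.rpow_le_rpow h1.le h2.le hα.le)
    nlinarith
  have large : ∀ {σ ρ : ℝ}, ρ₀ ≤ σ → σ < ρ → ball y ρ ⊆ Ω → radialEnergy κ A y σ ρ ≤
      normalizedEnergy κ A y ρ - normalizedEnergy κ A y σ + (C₁ + C₂) * (ρ ^ α - σ ^ α) := by
    intro σ ρ h1 h2 h4
    have h0 := hρ₀.trans_le h1
    have h5 := A.radialEnergy_le_of_integral_le hκ h0 h2 h4
    have h6 : 0 ≤ ρ ^ α - σ ^ α := sub_nonneg.2 (Real.rpow_le_rpow h0.le h2.le hα.le)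
    have h7 := mul_le_mul_of_nonneg_left (sub_inv_pow_le_rpow_sub (e := e) hα hρ₀ h1 h2.le) hM
    rw [← mul_assoc] at h7
    have h8 := mul_nonneg hC₁p.le h6
    rw [add_mul]
    linarith
  rcases le_or_gt ρ ρ₀ with h | h
  · exact small hσ hσρ h hρΩ
  rcases le_or_gt ρ₀ σ with h' | h'
  · exact large h' hσρ hρΩ
  -- If `ρ₀` lies between `σ` and `ρ`, the two inequalities are added: radial energy is additive
  -- over annuli, and the terms at `ρ₀` telescope.
  have h1 := small hσ h' le_rfl ((ball_subset_ball h.le).trans hρΩ)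
  have h2 := large le_rfl h hρΩ
  rw [A.radialEnergy_add κ hσ h'.le h.le hρΩ]
  linarith

end AlmostMonotonicity

end

theorem mainTheorem7 {m : ℕ} (G : Subgroup (GL (Fin m) ℂ))
    (hG : IsCompact (G : Set (GL (Fin m) ℂ)))
    (κ : LinearMap.BilinForm ℝ (CMat m)) (hκ : IsAdInvariantInner G κ)
    (n : ℕ) (hn : 5 ≤ n) (Ω : Set (Euc n)) (hΩ : IsOpen Ω)
    (A : SobolevForm G Ω) (hA : IsAlmostMinimizer κ A) :
    (∃ C > (0 : ℝ), ∃ α > (0 : ℝ), ∀ y ∈ Ω, ∀ σ ρ : ℝ, 0 < σ → σ < ρ →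
      ENNReal.ofReal ρ < infEDist y (frontier Ω) →
        radialEnergy κ A y σ ρ ≤
          (normalizedEnergy κ A y ρ + C * ρ ^ α) -
            (normalizedEnergy κ A y σ + C * σ ^ α)) ∧
    (∃ C > (0 : ℝ), ∃ α > (0 : ℝ), ∃ ρ₁ > (0 : ℝ), ∀ y ∈ Ω, ∀ σ ρ : ℝ, 0 < σ → σ < ρ → ρ < ρ₁ →
      ENNReal.ofReal ρ < infEDist y (frontier Ω) →
        C * radialEnergy κ A y σ ρ ≤
          (normalizedEnergy κ A y ρ + ρ ^ α) -
            (normalizedEnergy κ A y σ + σ ^ α)) := by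
  obtain ⟨C, hC, α, hα, h⟩ := hA.exists_radialEnergy_le hκ hn
  have h' : ∀ y ∈ Ω, ∀ σ ρ : ℝ, 0 < σ → σ < ρ → ENNReal.ofReal ρ < infEDist y (frontier Ω) →
      radialEnergy κ A y σ ρ ≤ normalizedEnergy κ A y ρ - normalizedEnergy κ A y σ +
        C * (ρ ^ α - σ ^ α) := fun y hy σ ρ hσ hσρ hd =>
    h y σ ρ hσ hσρ (ball_subset_of_lt_infEDist_frontier hΩ hy (hσ.trans hσρ) hd)
  -- In the second statement half of the exponent is given up to remove the constant: `ρ₁` is chosen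
  -- so that `ρ^(α/2) ≤ 1/(2C)`. The factor in front of the radial energy can then be `1`.
  refine ⟨⟨C, hC, α, hα, fun y hy σ ρ hσ hσρ hd => ?_⟩, 1, one_pos, α / 2, half_pos hα,
    (1 / (2 * C)) ^ (α / 2)⁻¹, by positivity, fun y hy σ ρ hσ hσρ hρ hd => ?_⟩
  · linarith [h' y hy σ ρ hσ hσρ hd]
  have hρ0 := hσ.trans hσρ
  have sq : ∀ {t : ℝ}, 0 < t → t ^ α = t ^ (α / 2) * t ^ (α / 2) := fun ht => by
    rw [← Real.rpow_add ht, add_halves]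
  have h1 : σ ^ (α / 2) ≤ ρ ^ (α / 2) := Real.rpow_le_rpow hσ.le hσρ.le (half_pos hα).le
  have h2 : ρ ^ (α / 2) ≤ 1 / (2 * C) := by
    refine (Real.rpow_le_rpow hρ0.le hρ.le (half_pos hα).le).trans (le_of_eq ?_)
    exact Real.rpow_inv_rpow (by positivity) (half_pos hα).ne'
  have h3 : C * (ρ ^ (α / 2) + σ ^ (α / 2)) ≤ 1 := by
    have : C * (ρ ^ (α / 2) + σ ^ (α / 2)) ≤ C * (1 / (2 * C) + 1 / (2 * C)) := by
      gcongr
      exact h1.trans h2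
    refine this.trans (le_of_eq ?_)
    field_simp
    norm_num
  -- A difference of squares, whose sum factor times `C` is at most `1`.
  have h4 : C * (ρ ^ α - σ ^ α) ≤ ρ ^ (α / 2) - σ ^ (α / 2) := by
    rw [sq hρ0, sq hσ]
    calc _ = C * (ρ ^ (α / 2) + σ ^ (α / 2)) * (ρ ^ (α / 2) - σ ^ (α / 2)) := by ring
      _ ≤ _ := mul_le_of_le_one_left (sub_nonneg.2 h1) h3
  linarith [h' y hy σ ρ hσ hσρ hd]
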